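/- Conventions. Manifolds are smooth, of constant finite dimension, second countable and Hausdorff, except that the manifold of arrows of a (local) groupoid need not be Hausdorff. A local Lie groupoid $G$ over a manifold $M$ consists of a manifold $G$ with Hausdorff source and target fibres; submersions $s,t:G\to M$; a smooth unit map $u:M\to G$ with $s\circ u=t\circ u=\mathrm{id}_M$; a multiplication $m:\mathcal U\to G$, $(g,h)\mapsto gh$, which is a submersion defined on an open subset $\mathcal U$ of $G\times_{s,t}G=\{(g,h): s(g)=t(h)\}$ containing all $(g,u(s(g)))$ and $(u(t(g)),g)$; and a smooth inversion $i:\mathcal V\to\mathcal V$, where $\mathcal V\subset G$ is an open neighbourhood of $u(M)$ such that $g,h\in\mathcal V$, $s(g)=t(h)$ imply $(g,h)\in\mathcal U$. These satisfy $s(gh)=s(h)$, $t(gh)=t(g)$; $g\,u(s(g))=g=u(t(g))\,g$; $s(i(g))=t(g)$, $t(i(g))=s(g)$, $i(g)g=u(s(g))$ and $g\,i(g)=u(t(g))$ for $g\in\mathcal V$; and $(gh)k=g(hk)$ for all composable triples $(g,h,k)$ near those having at least two units as entries. We assume moreover that $G$ is 3-associative: $(gh)k=g(hk)$ whenever both sides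 are defined. A Lie groupoid is the case $\mathcal U=G\times_{s,t}G$, $\mathcal V=G$. Elements of $\mathcal V$ are called invertible. Let $T^sG=\ker ds$, $T^tG=\ker dt$. $G$ is bi-regular if for all $(h,g)\in\mathcal U$ right multiplication by $g$ induces an isomorphism $T^s_hG\to T^s_{hg}G$, and for all $(g,h)\in\mathcal U$ left multiplication by $g$ induces an isomorphism $T^t_hG\to T^t_{gh}G$. $G$ has products connected to the axes if for every $(g,h)\in\mathcal U$ there is a path $\gamma$ in $G$ from $u(t(h))$ to $g$ with $(\gamma(\tau),h)\in\mathcal U$ for all $\tau$, or a path $\gamma$ in $G$ from $u(s(g))$ to $h$ with $(g,\gamma(\tau))\in\mathcal U$ for all $\tau$. A word is a tuple $(w_1,\dots,w_n)$, $n\ge1$, of elements of $G$ with $s(w_i)=t(w_{i+1})$; the set $W(G)$ of all words is the disjoint union of the iterated fibre products, which are manifolds. If $(w_k,w_{k+1})\in\mathcal U$, then $(w_1,\dots,w_kw_{k+1},\dots,w_n)$ is a contraction of $(w_1,\dots,w_n)$. We write $w'\le w$ if $w'$ arises from $w$ by finitely many contractions. The associative completion $\mathcal{AC}(G)$ is the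 quotient (with the quotient topology) of $W(G)$ by the equivalence relation generated by contractions; the completion map $G\to\mathcal{AC}(G)$ sends $g$ to the class $[g]$ of the word $(g)$. $G$ is inversional if for every $g\in G$ there is a word $w$ with all letters invertible and $(g)\le w$. An associator is an element $g\in G$ with $s(g)=t(g)=x$ such that some word $w$ satisfies $(u(x))\le w$ and $(g)\le w$; $\mathrm{Assoc}(G)$ is the set of associators. It is uniformly discrete if there is an open $U\subset G$ with $u(M)\subset U$ and $U\cap\mathrm{Assoc}(G)=u(M)$. $\mathcal{AC}(G)$ is called smooth if the topological space $\mathcal{AC}(G)$ has a smooth structure as a quotient of $W(G)$, i.e. one (of some dimension) for which the restriction of the projection $W(G)\to\mathcal{AC}(G)$ to words of length $n$ is a submersion for every $n\ge1$. **Theorem (Smoothness of $\mathcal{AC}(G)$).** Let $G$ be a bi-regular, inversional, 3-associative local Lie groupoid over $M$ with products connected to the axes. Then $\mathcal{AC}(G)$ is smooth if and only if $\mathrm{Assoc}(G)$ is uniformly discrete. Moreover, in that case, for every smooth structure on $\mathcal{AC}(G)$ as a quotient of $W(G)$, the space $\mathcal{AC}(G)$ is a Lie groupoid over $M$ with source $[w_1,\dots,w_n]\mapsto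 s(w_n)$, target $[w_1,\dots,w_n]\mapsto t(w_1)$, units $[u(x)]$ and multiplication given by juxtaposition of words; the completion map $G\to\mathcal{AC}(G)$ is a local diffeomorphism; and $G$ and $\mathcal{AC}(G)$ have isomorphic Lie algebroids. (The Lie algebroid is $A=T^sG|_{u(M)}$ with anchor $dt|_A$ and the bracket induced by the Lie bracket of right-invariant vector fields $g\mapsto dR_g(\alpha_{t(g)})$, $\alpha\in\Gamma(A)$, where $R_g$ is right multiplication by $g$; the isomorphism is over $\mathrm{id}_M$.) -/

import Mathlib

open scoped Manifold ContDiff Topology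

noncomputable section

/-- A map `f`, defined on a subset `S` of the manifold `N` that is an embedded submanifold with
tangent spaces `T p ⊆ T_p N` for `p ∈ S`, is a submersion `S → P`: it is smooth along `S`, and its
differential maps `T p` onto the tangent space of `P` at `f p`.
(`mfderivWithin` is determined by `f` on the vectors tangent to `S`, which are the only ones
used.) -/
def IsSubmersionAlong {E H N E' H' P : Type*}
    [NormedAddCommGroup E] [NormedSpace ℝ E] [TopologicalSpace H]
    [NormedAddCommGroup E'] [NormedSpace ℝ E'] [TopologicalSpace H']
    [TopologicalSpace N] [ChartedSpace H N] [TopologicalSpace P] [ChartedSpace H' P]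
    (I : ModelWithCorners ℝ E H) (I' : ModelWithCorners ℝ E' H')
    (f : N → P) (S : Set N) (T : N → Set E) : Prop :=
  ContMDiffOn I I' ∞ f S ∧
    ∀ p ∈ S, ∀ ζ : TangentSpace I' (f p), ∃ v ∈ T p, mfderivWithin I I' f S p v = ζ

/-- A local Lie groupoid with manifold of arrows `G` (modelled on `E`, possibly non-Hausdorff) over
the manifold `M` (modelled on `F`). Arrows compose as `g h` when `s g = t h`. The functions `mul`
and `inv` are total functions whose values are only meaningful on `mulDom` and `invDom`. -/
structure LocalLieGroupoid (E F G M : Type*)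
    [NormedAddCommGroup E] [NormedSpace ℝ E] [NormedAddCommGroup F] [NormedSpace ℝ F]
    [TopologicalSpace G] [ChartedSpace E G] [TopologicalSpace M] [ChartedSpace F M] where
  /-- the source map -/
  src : G → M
  /-- the target map -/
  tgt : G → M
  /-- the unit map -/
  unit : M → G
  /-- the domain `𝒰` of the multiplication -/
  mulDom : Set (G × G)
  /-- the multiplication -/
  mul : G → G → G
  /-- the domain `𝒱` of the inversion -/
  invDom : Set G
  /-- the inversion -/
  inv : G → G
  secondCountable : SecondCountableTopology G
  t2_src_fiber : ∀ x : M, T2Space (src ⁻¹' {x})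
  t2_tgt_fiber : ∀ x : M, T2Space (tgt ⁻¹' {x})
  src_smooth : ContMDiff 𝓘(ℝ, E) 𝓘(ℝ, F) ∞ src
  src_submersion : ∀ g, Function.Surjective (mfderiv 𝓘(ℝ, E) 𝓘(ℝ, F) src g)
  tgt_smooth : ContMDiff 𝓘(ℝ, E) 𝓘(ℝ, F) ∞ tgt
  tgt_submersion : ∀ g, Function.Surjective (mfderiv 𝓘(ℝ, E) 𝓘(ℝ, F) tgt g)
  unit_smooth : ContMDiff 𝓘(ℝ, F) 𝓘(ℝ, E) ∞ unit
  src_unit : ∀ x, src (unit x) = x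
  tgt_unit : ∀ x, tgt (unit x) = x
  /-- `𝒰` is an open subset of the fibre product `{(g, h) | s g = t h}` -/
  mulDom_open : ∃ O : Set (G × G), IsOpen O ∧ mulDom = O ∩ {p | src p.1 = tgt p.2}
  mem_mulDom_unit_right : ∀ g, (g, unit (src g)) ∈ mulDom
  mem_mulDom_unit_left : ∀ g, (unit (tgt g), g) ∈ mulDom
  /-- multiplication is a submersion on `𝒰`, the tangent space of the fibre product at `(g, h)`
  being `{(v, w) | ds v = dt w}` -/
  mul_submersion : IsSubmersionAlong (𝓘(ℝ, E).prod 𝓘(ℝ, E)) 𝓘(ℝ, E)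
    (fun p : G × G => mul p.1 p.2) mulDom
    (fun p => {v : E × E | (mfderiv 𝓘(ℝ, E) 𝓘(ℝ, F) src p.1 v.1 : F) =
      (mfderiv 𝓘(ℝ, E) 𝓘(ℝ, F) tgt p.2 v.2 : F)})
  src_mul : ∀ g h, (g, h) ∈ mulDom → src (mul g h) = src h
  tgt_mul : ∀ g h, (g, h) ∈ mulDom → tgt (mul g h) = tgt g
  mul_unit : ∀ g, mul g (unit (src g)) = g
  unit_mul : ∀ g, mul (unit (tgt g)) g = g
  /-- associativity near the triples having at least two units -/
  assoc_near : ∃ O : Set (G × G × G), IsOpen O ∧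
    (∀ g, (unit (tgt g), unit (tgt g), g) ∈ O ∧ (unit (tgt g), g, unit (src g)) ∈ O ∧
      (g, unit (src g), unit (src g)) ∈ O) ∧
    ∀ g h k, (g, h, k) ∈ O → src g = tgt h → src h = tgt k →
      (g, h) ∈ mulDom ∧ (mul g h, k) ∈ mulDom ∧ (h, k) ∈ mulDom ∧ (g, mul h k) ∈ mulDom ∧
        mul (mul g h) k = mul g (mul h k)
  invDom_open : IsOpen invDom
  unit_mem_invDom : ∀ x, unit x ∈ invDom
  mem_mulDom_of_invDom : ∀ g ∈ invDom, ∀ h ∈ invDom, src g = tgt h → (g, h) ∈ mulDom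
  inv_mem_invDom : ∀ g ∈ invDom, inv g ∈ invDom
  inv_smooth : ContMDiffOn 𝓘(ℝ, E) 𝓘(ℝ, E) ∞ inv invDom
  src_inv : ∀ g ∈ invDom, src (inv g) = tgt g
  tgt_inv : ∀ g ∈ invDom, tgt (inv g) = src g
  inv_mul : ∀ g ∈ invDom, mul (inv g) g = unit (src g)
  mul_inv : ∀ g ∈ invDom, mul g (inv g) = unit (tgt g)

namespace LocalLieGroupoid

section Basic

variable {E F G M : Type*}
  [NormedAddCommGroup E] [NormedSpace ℝ E] [NormedAddCommGroup F] [NormedSpace ℝ F]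
  [TopologicalSpace G] [ChartedSpace E G] [TopologicalSpace M] [ChartedSpace F M]
  (𝒢 : LocalLieGroupoid E F G M)

/-- `(g h) k = g (h k)` whenever both sides are defined. -/
def IsThreeAssociative : Prop :=
  ∀ g h k, (g, h) ∈ 𝒢.mulDom → (𝒢.mul g h, k) ∈ 𝒢.mulDom →
    (h, k) ∈ 𝒢.mulDom → (g, 𝒢.mul h k) ∈ 𝒢.mulDom →
    𝒢.mul (𝒢.mul g h) k = 𝒢.mul g (𝒢.mul h k)

/-- A (global) Lie groupoid: all composable pairs can be multiplied, all arrows can be inverted and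
multiplication is associative. -/
structure IsLieGroupoid : Prop where
  mulDom_eq : 𝒢.mulDom = {p | 𝒢.src p.1 = 𝒢.tgt p.2}
  invDom_eq : 𝒢.invDom = Set.univ
  assoc : 𝒢.IsThreeAssociative

/-! ### Bi-regularity and products connected to the axes -/

/-- `T^s_g G`, the kernel of `ds` at `g`. -/
def srcKer (g : G) : Submodule ℝ (TangentSpace 𝓘(ℝ, E) g) :=
  LinearMap.ker (mfderiv 𝓘(ℝ, E) 𝓘(ℝ, F) 𝒢.src g).toLinearMap

/-- `T^t_g G`, the kernel of `dt` at `g`. -/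
def tgtKer (g : G) : Submodule ℝ (TangentSpace 𝓘(ℝ, E) g) :=
  LinearMap.ker (mfderiv 𝓘(ℝ, E) 𝓘(ℝ, F) 𝒢.tgt g).toLinearMap

/-- The differential at `h` of right multiplication by `g`, which is defined on the open subset
`{k | (k, g) ∈ 𝒰}` of the source fibre over `t g`. It is only meaningful on `T^s_h G`. -/
def dRight (g h : G) :
    TangentSpace 𝓘(ℝ, E) h →L[ℝ] TangentSpace 𝓘(ℝ, E) (𝒢.mul h g) :=
  mfderivWithin 𝓘(ℝ, E) 𝓘(ℝ, E) (fun k => 𝒢.mul k g) {k | (k, g) ∈ 𝒢.mulDom} h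

/-- The differential at `h` of left multiplication by `g`, which is defined on the open subset
`{k | (g, k) ∈ 𝒰}` of the target fibre over `s g`. It is only meaningful on `T^t_h G`. -/
def dLeft (g h : G) :
    TangentSpace 𝓘(ℝ, E) h →L[ℝ] TangentSpace 𝓘(ℝ, E) (𝒢.mul g h) :=
  mfderivWithin 𝓘(ℝ, E) 𝓘(ℝ, E) (fun k => 𝒢.mul g k) {k | (g, k) ∈ 𝒢.mulDom} h

def IsRightRegularAt (g : G) : Prop :=
  ∀ h, (h, g) ∈ 𝒢.mulDom → Set.BijOn (𝒢.dRight g h) (𝒢.srcKer h) (𝒢.srcKer (𝒢.mul h g))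

def IsLeftRegularAt (g : G) : Prop :=
  ∀ h, (g, h) ∈ 𝒢.mulDom → Set.BijOn (𝒢.dLeft g h) (𝒢.tgtKer h) (𝒢.tgtKer (𝒢.mul g h))

def IsBiregular : Prop :=
  ∀ g, 𝒢.IsLeftRegularAt g ∧ 𝒢.IsRightRegularAt g

def HasProductsConnectedToAxes : Prop :=
  ∀ g h, (g, h) ∈ 𝒢.mulDom →
    (∃ γ : Path (𝒢.unit (𝒢.tgt h)) g, ∀ τ, (γ τ, h) ∈ 𝒢.mulDom) ∨
    (∃ γ : Path (𝒢.unit (𝒢.src g)) h, ∀ τ, (g, γ τ) ∈ 𝒢.mulDom)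

/-! ### Words and the associative completion -/

/-- The well-formed words of length `n + 1`. -/
def wordSet (n : ℕ) : Set (Fin (n + 1) → G) :=
  {w | ∀ i : Fin n, 𝒢.src (w i.castSucc) = 𝒢.tgt (w i.succ)}

/-- The set `W(G)` of all well-formed (non-empty) words, the disjoint union of the iterated fibre
products. -/
def Word : Type _ := Σ n : ℕ, 𝒢.wordSet n

instance : TopologicalSpace 𝒢.Word :=
  inferInstanceAs (TopologicalSpace (Σ n : ℕ, 𝒢.wordSet n))

variable {𝒢} in
/-- The letters of a word. -/
def Word.letters (w : 𝒢.Word) : List G := List.ofFn w.2.1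

variable {𝒢} in
/-- The source of a word is the source of its last letter. -/
def Word.src (w : 𝒢.Word) : M := 𝒢.src (w.2.1 (Fin.last _))

variable {𝒢} in
/-- The target of a word is the target of its first letter. -/
def Word.tgt (w : 𝒢.Word) : M := 𝒢.tgt (w.2.1 0)

/-- The word `(g)`. -/
def single (g : G) : 𝒢.Word := ⟨0, fun _ => g, fun i => i.elim0⟩

/-- `Contracts w w'`: the word `w'` is obtained from `w` by one contraction
`(…, g, h, …) ↦ (…, g h, …)` with `(g, h) ∈ 𝒰`. -/
def Contracts (w w' : 𝒢.Word) : Prop :=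
  ∃ (a b : List G) (g h : G), (g, h) ∈ 𝒢.mulDom ∧
    w.letters = a ++ g :: h :: b ∧ w'.letters = a ++ 𝒢.mul g h :: b

/-- The partial order on words: `WordLE w' w` when `w` is reached from `w'` by expansions, that
is, `w'` from `w` by contractions. -/
def WordLE (w' w : 𝒢.Word) : Prop :=
  Relation.ReflTransGen 𝒢.Contracts w w'

/-- The associative completion `𝒜𝒞(G)`: the quotient of `W(G)` by the equivalence relation
generated by contractions (`Quot` is the quotient by the generated equivalence relation), with the
quotient topology. -/
def AC : Type _ := Quot 𝒢.Contracts

instance : TopologicalSpace 𝒢.AC :=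
  inferInstanceAs (TopologicalSpace (Quot 𝒢.Contracts))

/-- The class of a word in `𝒜𝒞(G)`. -/
def toAC (w : 𝒢.Word) : 𝒢.AC := Quot.mk _ w

/-- The completion map `G → 𝒜𝒞(G)`. -/
def completion (g : G) : 𝒢.AC := 𝒢.toAC (𝒢.single g)

/-- An element is inversional if it can be written as a well-defined product of invertible
elements. -/
def IsInversionalElement (g : G) : Prop :=
  ∃ w : 𝒢.Word, (∀ a ∈ w.letters, a ∈ 𝒢.invDom) ∧ 𝒢.WordLE (𝒢.single g) w

def IsInversional : Prop := ∀ g, 𝒢.IsInversionalElement g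

/-! ### Associators -/

/-- `Assoc(G)`: the arrows `g` with `s g = t g = x` for which some word can be evaluated both to
the unit at `x` and to `g`. -/
def Assoc : Set G :=
  {g | 𝒢.src g = 𝒢.tgt g ∧ ∃ w : 𝒢.Word,
    𝒢.WordLE (𝒢.single (𝒢.unit (𝒢.src g))) w ∧ 𝒢.WordLE (𝒢.single g) w}

/-- There is an open neighbourhood of the units which contains no associators but the units. -/
def HasUniformlyDiscreteAssociators : Prop :=
  ∃ U : Set G, IsOpen U ∧ Set.range 𝒢.unit ⊆ U ∧ U ∩ 𝒢.Assoc = Set.range 𝒢.unit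

/-! ### Smooth quotient structures on the associative completion -/

/-- The tangent space at `w` of the iterated fibre product of all well-formed words of length
`n + 1`. -/
def wordTangent (n : ℕ) (w : Fin (n + 1) → G) : Set (Fin (n + 1) → E) :=
  {v | ∀ i : Fin n,
    (mfderiv 𝓘(ℝ, E) 𝓘(ℝ, F) 𝒢.src (w i.castSucc) (v i.castSucc) : F) =
      (mfderiv 𝓘(ℝ, E) 𝓘(ℝ, F) 𝒢.tgt (w i.succ) (v i.succ) : F)}

open Classical in
/-- The restriction of the projection `W(G) → 𝒜𝒞(G)` to the words of length `n + 1`, as a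
function on all tuples (with an irrelevant value outside `wordSet n`). -/
def proj (n : ℕ) (w : Fin (n + 1) → G) : 𝒢.AC :=
  if h : w ∈ 𝒢.wordSet n then 𝒢.toAC ⟨n, w, h⟩ else 𝒢.completion (w 0)

/-- A smooth structure on `𝒜𝒞(G)` as a quotient of `W(G)`: a smooth structure, of some dimension,
on the topological space `𝒜𝒞(G)`, for which the projection `W(G) → 𝒜𝒞(G)` is a submersion on each
component `wordSet n` of `W(G)`. -/
structure SmoothQuotient where
  dim : ℕ
  chartedSpace : ChartedSpace (EuclideanSpace ℝ (Fin dim)) 𝒢.AC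
  isManifold : IsManifold 𝓘(ℝ, EuclideanSpace ℝ (Fin dim)) ∞ 𝒢.AC
  proj_submersion : ∀ n : ℕ,
    IsSubmersionAlong (ModelWithCorners.pi fun _ : Fin (n + 1) => 𝓘(ℝ, E))
      𝓘(ℝ, EuclideanSpace ℝ (Fin dim)) (𝒢.proj n) (𝒢.wordSet n) (𝒢.wordTangent n)

/-- `𝒜𝒞(G)` is smooth. -/
def ACIsSmooth : Prop := Nonempty 𝒢.SmoothQuotient

end Basic

section Quotient

variable {E F G M : Type*}
  [NormedAddCommGroup E] [NormedSpace ℝ E] [NormedAddCommGroup F] [NormedSpace ℝ F]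
  [TopologicalSpace G] [ChartedSpace E G] [TopologicalSpace M] [ChartedSpace F M]
  {𝒢 : LocalLieGroupoid E F G M}

namespace SmoothQuotient

/-- The model space of a smooth quotient structure. -/
abbrev Model (S : 𝒢.SmoothQuotient) : Type := EuclideanSpace ℝ (Fin S.dim)

/-- The space `𝒜𝒞(G)`, considered with the smooth structure `S`. -/
def Space (_S : 𝒢.SmoothQuotient) : Type _ := 𝒢.AC

instance (S : 𝒢.SmoothQuotient) : TopologicalSpace S.Space :=
  inferInstanceAs (TopologicalSpace 𝒢.AC)

instance (S : 𝒢.SmoothQuotient) : ChartedSpace S.Model S.Space := S.chartedSpace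

instance (S : 𝒢.SmoothQuotient) : IsManifold 𝓘(ℝ, S.Model) ∞ S.Space := S.isManifold

/-- The class of a word. -/
def cls (S : 𝒢.SmoothQuotient) (w : 𝒢.Word) : S.Space := 𝒢.toAC w

/-- The completion map `G → 𝒜𝒞(G)`. -/
def completion (S : 𝒢.SmoothQuotient) (g : G) : S.Space := 𝒢.completion g

/-- `ℋ` is a Lie groupoid over `M` with manifold of arrows `𝒜𝒞(G)` whose source and target are
those of words, whose units are the classes `[x]`, and whose multiplication is juxtaposition of
words. (The inversion is then determined.) -/
structure IsCompletionGroupoid (S : 𝒢.SmoothQuotient)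
    (ℋ : LocalLieGroupoid S.Model F S.Space M) : Prop where
  isLieGroupoid : ℋ.IsLieGroupoid
  src_cls : ∀ w : 𝒢.Word, ℋ.src (S.cls w) = w.src
  tgt_cls : ∀ w : 𝒢.Word, ℋ.tgt (S.cls w) = w.tgt
  unit_eq : ∀ x : M, ℋ.unit x = S.completion (𝒢.unit x)
  mul_cls : ∀ v w z : 𝒢.Word, z.letters = v.letters ++ w.letters →
    ℋ.mul (S.cls v) (S.cls w) = S.cls z

end SmoothQuotient

end Quotient

/-! ### The Lie algebroid of a right-regular local Lie groupoid -/

section Algebroid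

variable {E F G M : Type*}
  [NormedAddCommGroup E] [NormedSpace ℝ E] [NormedAddCommGroup F] [NormedSpace ℝ F]
  [TopologicalSpace G] [ChartedSpace E G] [TopologicalSpace M] [ChartedSpace F M]
  (𝒢 : LocalLieGroupoid E F G M)

/-- The fibre at `x` of the vector bundle `A = T^s_M G`. -/
abbrev algFiber (x : M) : Submodule ℝ (TangentSpace 𝓘(ℝ, E) (𝒢.unit x)) :=
  𝒢.srcKer (𝒢.unit x)

/-- The anchor `ρ = dt|_A` (note that `t (u x) = x`). -/
def anchor (x : M) (a : 𝒢.algFiber x) : TangentSpace 𝓘(ℝ, F) x :=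
  (mfderiv 𝓘(ℝ, E) 𝓘(ℝ, F) 𝒢.tgt (𝒢.unit x) a.1 : F)

/-- Smoothness on `O ⊆ M` of a section of `A`, which is a subbundle of the restriction of `TG`
to `M`. -/
def IsSmoothSectionOn [IsManifold 𝓘(ℝ, E) ∞ G] (O : Set M) (α : ∀ x, 𝒢.algFiber x) : Prop :=
  ContMDiffOn 𝓘(ℝ, F) 𝓘(ℝ, E).tangent ∞
    (fun x => (⟨𝒢.unit x, (α x).1⟩ : TangentBundle 𝓘(ℝ, E) G)) O

/-- The right-invariant vector field `g ↦ dR_g (α (t g))` extending a section `α` of `A`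
(note that `u (t g) · g = g`). -/
def rightInvariant (α : ∀ x, 𝒢.algFiber x) (g : G) : TangentSpace 𝓘(ℝ, E) g :=
  (𝒢.dRight g (𝒢.unit (𝒢.tgt g)) (α (𝒢.tgt g)).1 : E)

/-- The bracket `[α, β]` of two sections of `A`: the Lie bracket of the corresponding
right-invariant vector fields, restricted to `M`. -/
def algBracket (α β : ∀ x, 𝒢.algFiber x) (x : M) : TangentSpace 𝓘(ℝ, E) (𝒢.unit x) :=
  VectorField.mlieBracket 𝓘(ℝ, E) (𝒢.rightInvariant α) (𝒢.rightInvariant β) (𝒢.unit x)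

end Algebroid

/-- An isomorphism, over the identity of `M`, between the Lie algebroids of two right-regular local
Lie groupoids over `M`: an isomorphism of vector bundles (fibrewise linear, and identifying the
smooth local sections) which commutes with the anchors and preserves the brackets of sections. -/
structure LieAlgebroidIso {E E' F G G' M : Type*}
    [NormedAddCommGroup E] [NormedSpace ℝ E] [NormedAddCommGroup E'] [NormedSpace ℝ E']
    [NormedAddCommGroup F] [NormedSpace ℝ F]
    [TopologicalSpace G] [ChartedSpace E G] [IsManifold 𝓘(ℝ, E) ∞ G]
    [TopologicalSpace G'] [ChartedSpace E' G'] [IsManifold 𝓘(ℝ, E') ∞ G']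
    [TopologicalSpace M] [ChartedSpace F M]
    (𝒢 : LocalLieGroupoid E F G M) (ℋ : LocalLieGroupoid E' F G' M) where
  toEquiv : ∀ x : M, 𝒢.algFiber x ≃ₗ[ℝ] ℋ.algFiber x
  smooth_iff : ∀ O : Set M, IsOpen O → ∀ α : (∀ x, 𝒢.algFiber x),
    𝒢.IsSmoothSectionOn O α ↔ ℋ.IsSmoothSectionOn O (fun x => toEquiv x (α x))
  anchor_comp : ∀ (x : M) (a : 𝒢.algFiber x), ℋ.anchor x (toEquiv x a) = 𝒢.anchor x a
  /-- The bracket of two sections is a section, and `toEquiv` maps it to the bracket of the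
  images. -/
  map_bracket : ∀ α β : (∀ x, 𝒢.algFiber x),
    𝒢.IsSmoothSectionOn Set.univ α → 𝒢.IsSmoothSectionOn Set.univ β → ∀ x : M,
      ∃ c : 𝒢.algFiber x, c.1 = 𝒢.algBracket α β x ∧
        (toEquiv x c).1 =
          ℋ.algBracket (fun y => toEquiv y (α y)) (fun y => toEquiv y (β y)) x

end LocalLieGroupoid

end

/-! ### Topology of local groupoids: words, ladders, common expansions and countability of
associators. -/

section TopologicalPart
open Filter Relation

/-! The proof compares nearby words by means of ladders. Suppose a string of arrows `v_i` is close
to a fixed string `w_i`. One looks for arrows `k_i` close to units with `v_i k_{i+1} = k_i w_i`. If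
all `w_i` are invertible, the rungs are found from right to left as `k_i = (v_i k_{i+1}) w_i⁻¹`. In
general, inversionality expands the word to one with invertible letters, local sections of the
submersion `m` expand the nearby words along with it, and 3-associativity near units allows the
resulting ladder to be contracted again (`Inversional.exists_ladder`). For a single letter this is
right division: arrows near `g` with the same source have the form `k g` with `k` near a unit.

Right division, together with the paths to the axes, shows that equivalent words have a common
expansion (`exists_common_expansion`). Along a path from a unit to `g` on which the product with `h`
stays defined, one constructs words `e` and `e'` such that `e` contracts to `g`, `e e'` to a unit
and `e' (g h)` to `h`. Inserting `e e'` into a word therefore undoes a contraction `g h`.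
Consequently, the arrows with the class of a unit are exactly the associators.

If associators are uniformly discrete, then near the units equivalent arrows are equal: `k k'⁻¹` is
an associator close to a unit. A chart around a class represented by a word with invertible letters
consists of the classes of words `(a, b(x))`, where `b(x)` is that reference word moved to the
source `x` and `a` is an arrow near a unit (`WordChart`). The letters of `b(x)` can be cancelled, so
this parametrization is injective. Any equivalence of words extends to smooth families
(`exists_smooth_transfer`), which makes the image open, the transition maps smooth and the
projection a submersion.

Conversely, for any smooth structure as a quotient, the completion map is a submersion, since
one-letter words lift locally. Nearby arrows in a fibre differ from a given one by associators. Over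
each object these form a countable set, because a ladder separates the associators that arise by the
same recipe of contractions (`Inversional.countable_assocAt`). Hence the fibres are
zero-dimensional, the completion map is a local diffeomorphism, and local injectivity at units is
uniform discreteness.

The groupoid operations are given by words and are smooth because classes lift smoothly to words.
The completion map is an étale morphism, so it relates right-invariant vector fields and their
brackets, which gives the isomorphism of Lie algebroids. -/

/-- The topological data underlying a 3-associative local Lie groupoid; that multiplication is a
submersion is replaced by the existence of local sections of it. -/
structure TopLocalGroupoid (G M : Type*) [TopologicalSpace G] [TopologicalSpace M] where
  src : G → M
  tgt : G → M
  unit : M → G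
  mulDom : Set (G × G)
  mul : G → G → G
  invDom : Set G
  inv : G → G
  src_unit : ∀ x, src (unit x) = x
  tgt_unit : ∀ x, tgt (unit x) = x
  mulDom_open : ∃ O : Set (G × G), IsOpen O ∧ mulDom = O ∩ {p | src p.1 = tgt p.2}
  unit_right_mem : ∀ g, (g, unit (src g)) ∈ mulDom
  unit_left_mem : ∀ g, (unit (tgt g), g) ∈ mulDom
  continuousOn_mul : ContinuousOn (fun p : G × G => mul p.1 p.2) mulDom
  exists_section : ∀ g h, (g, h) ∈ mulDom → ∃ a b : G → G,
    Tendsto a (𝓝 (mul g h)) (𝓝 g) ∧ Tendsto b (𝓝 (mul g h)) (𝓝 h) ∧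
      ∀ᶠ c in 𝓝 (mul g h), (a c, b c) ∈ mulDom ∧ mul (a c) (b c) = c
  src_mul : ∀ g h, (g, h) ∈ mulDom → src (mul g h) = src h
  tgt_mul : ∀ g h, (g, h) ∈ mulDom → tgt (mul g h) = tgt g
  mul_unit : ∀ g, mul g (unit (src g)) = g
  unit_mul : ∀ g, mul (unit (tgt g)) g = g
  invDom_open : IsOpen invDom
  unit_mem_invDom : ∀ x, unit x ∈ invDom
  mem_mulDom_of_invDom : ∀ g ∈ invDom, ∀ h ∈ invDom, src g = tgt h → (g, h) ∈ mulDom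
  inv_mem_invDom : ∀ g ∈ invDom, inv g ∈ invDom
  continuousOn_inv : ContinuousOn inv invDom
  src_inv : ∀ g ∈ invDom, src (inv g) = tgt g
  tgt_inv : ∀ g ∈ invDom, tgt (inv g) = src g
  inv_mul : ∀ g ∈ invDom, mul (inv g) g = unit (src g)
  mul_inv : ∀ g ∈ invDom, mul g (inv g) = unit (tgt g)
  assoc : ∀ g h k, (g, h) ∈ mulDom → (mul g h, k) ∈ mulDom →
    (h, k) ∈ mulDom → (g, mul h k) ∈ mulDom → mul (mul g h) k = mul g (mul h k)

/-- Evaluation of a list of functions. -/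
def List.evalFun {ι α : Type*} (vs : List (ι → α)) (i : ι) : List α := vs.map fun v => v i

@[simp] theorem List.evalFun_nil {ι α : Type*} (i : ι) : ([] : List (ι → α)).evalFun i = [] := rfl

@[simp] theorem List.evalFun_cons {ι α : Type*} (v : ι → α) (vs : List (ι → α)) (i : ι) :
    (v :: vs).evalFun i = v i :: vs.evalFun i := rfl

@[simp] theorem List.evalFun_append {ι α : Type*} (vs vs' : List (ι → α)) (i : ι) :
    (vs ++ vs').evalFun i = vs.evalFun i ++ vs'.evalFun i := List.map_append

/-- Replace the entries with indices `n` and `n + 1` by their product. -/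
def List.contractAt {α : Type*} (op : α → α → α) : ℕ → List α → List α
  | 0, g :: h :: l => op g h :: l
  | n + 1, g :: l => g :: List.contractAt op n l
  | _, l => l

/-- `List.contractAt` looks only at positions and not at domains, so a single recipe of contractions
makes sense for every member of a family of words. -/
theorem List.evalFun_contractAt {ι α : Type*} (op : α → α → α) (i : ι) :
    ∀ (n : ℕ) (vs : List (ι → α)),
      (List.contractAt (fun f g j => op (f j) (g j)) n vs).evalFun i =
        List.contractAt op n (vs.evalFun i)
  | 0, [] => rfl
  | 0, [_] => rfl
  | 0, _ :: _ :: _ => rfl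
  | _ + 1, [] => rfl
  | n + 1, v :: vs => by
    simp [List.contractAt, List.evalFun_contractAt op i n vs]

namespace TopLocalGroupoid

variable {G M : Type*} [TopologicalSpace G] [TopologicalSpace M] (T : TopLocalGroupoid G M)

/-- The opposite local groupoid. -/
def op : TopLocalGroupoid G M where
  src := T.tgt
  tgt := T.src
  unit := T.unit
  mulDom := {p | (p.2, p.1) ∈ T.mulDom}
  mul g h := T.mul h g
  invDom := T.invDom
  inv := T.inv
  src_unit := T.tgt_unit
  tgt_unit := T.src_unit
  mulDom_open := by
    obtain ⟨O, hO, h⟩ := T.mulDom_open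
    refine ⟨Prod.swap ⁻¹' O, hO.preimage continuous_swap, ?_⟩
    ext p
    change (p.2, p.1) ∈ T.mulDom ↔ _
    rw [h]
    exact ⟨fun hp => ⟨hp.1, hp.2.symm⟩, fun hp => ⟨hp.1, hp.2.symm⟩⟩
  unit_right_mem := T.unit_left_mem
  unit_left_mem := T.unit_right_mem
  continuousOn_mul := T.continuousOn_mul.comp continuous_swap.continuousOn fun _ hp => hp
  exists_section := by
    intro g h hgh
    obtain ⟨a, b, ha, hb, hab⟩ := T.exists_section h g hgh
    exact ⟨b, a, hb, ha, hab⟩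
  src_mul g h hgh := T.tgt_mul h g hgh
  tgt_mul g h hgh := T.src_mul h g hgh
  mul_unit := T.unit_mul
  unit_mul := T.mul_unit
  invDom_open := T.invDom_open
  unit_mem_invDom := T.unit_mem_invDom
  mem_mulDom_of_invDom g hg h hh e := T.mem_mulDom_of_invDom h hh g hg e.symm
  inv_mem_invDom := T.inv_mem_invDom
  continuousOn_inv := T.continuousOn_inv
  src_inv := T.tgt_inv
  tgt_inv := T.src_inv
  inv_mul := T.mul_inv
  mul_inv := T.inv_mul
  assoc g h k h1 h2 h3 h4 := (T.assoc k h g h3 h4 h1 h2).symm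

variable {T}

theorem composable {g h : G} (hgh : (g, h) ∈ T.mulDom) : T.src g = T.tgt h := by
  obtain ⟨O, -, hO⟩ := T.mulDom_open
  rw [hO] at hgh
  exact hgh.2

theorem inv_unit (x : M) : T.inv (T.unit x) = T.unit x := by
  have h1 := T.inv_mul _ (T.unit_mem_invDom x)
  have h2 := T.mul_unit (T.inv (T.unit x))
  rw [T.src_inv _ (T.unit_mem_invDom x), T.tgt_unit] at h2
  rw [h2, T.src_unit] at h1
  exact h1

section Nets

variable {ι : Type*} {F : Filter ι}

theorem eventually_mem_mulDom {f g : ι → G} {a b : G} (hf : Tendsto f F (𝓝 a))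
    (hg : Tendsto g F (𝓝 b)) (hab : (a, b) ∈ T.mulDom)
    (h : ∀ᶠ i in F, T.src (f i) = T.tgt (g i)) : ∀ᶠ i in F, (f i, g i) ∈ T.mulDom := by
  obtain ⟨O, hO, e⟩ := T.mulDom_open
  rw [e] at hab ⊢
  filter_upwards [(hf.prodMk_nhds hg) (hO.mem_nhds hab.1), h] with i h1 h2 using ⟨h1, h2⟩

theorem tendsto_mul {f g : ι → G} {a b : G} (hf : Tendsto f F (𝓝 a))
    (hg : Tendsto g F (𝓝 b)) (hab : (a, b) ∈ T.mulDom)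
    (h : ∀ᶠ i in F, T.src (f i) = T.tgt (g i)) :
    Tendsto (fun i => T.mul (f i) (g i)) F (𝓝 (T.mul a b)) := by
  have h1 : Tendsto (fun p : G × G => T.mul p.1 p.2) (𝓝[T.mulDom] (a, b)) (𝓝 (T.mul a b)) :=
    T.continuousOn_mul (a, b) hab
  exact h1.comp (tendsto_nhdsWithin_iff.2
    ⟨hf.prodMk_nhds hg, T.eventually_mem_mulDom hf hg hab h⟩)

/-- Only the limit triple has to satisfy the four domain conditions. Since 𝒰 is open in the fibre
product, nearby composable triples inherit them, and 3-associativity applies. -/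
theorem eventually_assoc {f g h : ι → G} {a b c : G} (hf : Tendsto f F (𝓝 a))
    (hg : Tendsto g F (𝓝 b)) (hh : Tendsto h F (𝓝 c)) (hab : (a, b) ∈ T.mulDom)
    (hbc : (b, c) ∈ T.mulDom) (hab_c : (T.mul a b, c) ∈ T.mulDom)
    (ha_bc : (a, T.mul b c) ∈ T.mulDom)
    (h1 : ∀ᶠ i in F, T.src (f i) = T.tgt (g i)) (h2 : ∀ᶠ i in F, T.src (g i) = T.tgt (h i)) :
    ∀ᶠ i in F, (f i, g i) ∈ T.mulDom ∧ (g i, h i) ∈ T.mulDom ∧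
      (T.mul (f i) (g i), h i) ∈ T.mulDom ∧ (f i, T.mul (g i) (h i)) ∈ T.mulDom ∧
      T.mul (T.mul (f i) (g i)) (h i) = T.mul (f i) (T.mul (g i) (h i)) := by
  have e1 := T.eventually_mem_mulDom hf hg hab h1
  have e2 := T.eventually_mem_mulDom hg hh hbc h2
  have e3 := T.eventually_mem_mulDom (T.tendsto_mul hf hg hab h1) hh hab_c (by
    filter_upwards [e1, h2] with i h3 h4
    rw [T.src_mul _ _ h3, h4])
  have e4 := T.eventually_mem_mulDom hf (T.tendsto_mul hg hh hbc h2) ha_bc (by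
    filter_upwards [e2, h1] with i h3 h4
    rw [T.tgt_mul _ _ h3, h4])
  filter_upwards [e1, e2, e3, e4] with i h1 h2 h3 h4
  exact ⟨h1, h2, h3, h4, T.assoc _ _ _ h1 h3 h2 h4⟩

theorem tendsto_inv {f : ι → G} {a : G} (hf : Tendsto f F (𝓝 a)) (ha : a ∈ T.invDom) :
    Tendsto (fun i => T.inv (f i)) F (𝓝 (T.inv a)) :=
  (T.continuousOn_inv.continuousAt (T.invDom_open.mem_nhds ha)).tendsto.comp hf

end Nets

/-! ### Words as lists, and their contractions -/

variable (T)

/-- `l` is a composable string of arrows with target `y` and source `x`. -/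
def IsPath : M → List G → M → Prop
  | y, [], x => y = x
  | y, g :: l, x => T.tgt g = y ∧ IsPath (T.src g) l x

/-- One contraction. -/
inductive Red : List G → List G → Prop
  | head {g h : G} (l : List G) : (g, h) ∈ T.mulDom → Red (g :: h :: l) (T.mul g h :: l)
  | cons (g : G) {l l' : List G} : Red l l' → Red (g :: l) (g :: l')

/-- Finitely many contractions. -/
abbrev RedStar : List G → List G → Prop := ReflTransGen T.Red

/-- Every arrow is a contraction of a word with invertible letters. -/
def Inversional : Prop := ∀ g, ∃ l, (∀ a ∈ l, a ∈ T.invDom) ∧ T.RedStar l [g]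

variable {T}

@[simp] theorem isPath_nil {y x : M} : T.IsPath y [] x ↔ y = x := Iff.rfl

@[simp] theorem isPath_cons {y x : M} {g : G} {l : List G} :
    T.IsPath y (g :: l) x ↔ T.tgt g = y ∧ T.IsPath (T.src g) l x := Iff.rfl

theorem isPath_append {l l' : List G} {y x : M} :
    T.IsPath y (l ++ l') x ↔ ∃ z, T.IsPath y l z ∧ T.IsPath z l' x := by
  induction l generalizing y with
  | nil => simp
  | cons g l ih => simp [ih, and_assoc]

theorem IsPath.left_unique {l : List G} {y y' x : M} (h : T.IsPath y l x)
    (h' : T.IsPath y' l x) : y = y' := by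
  cases l with
  | nil => exact h.trans h'.symm
  | cons g l => exact h.1.symm.trans h'.1

theorem IsPath.right_unique {l : List G} {y x x' : M} (h : T.IsPath y l x)
    (h' : T.IsPath y l x') : x = x' := by
  induction l generalizing y with
  | nil => exact h.symm.trans h'
  | cons g l ih => exact ih h.2 h'.2

theorem IsPath.eq_and_eq {l : List G} (hl : l ≠ []) {y y' x x' : M} (h : T.IsPath y l x)
    (h' : T.IsPath y' l x') : y = y' ∧ x = x' := by
  cases l with
  | nil => exact absurd rfl hl
  | cons g l =>
    obtain rfl : y = y' := h.1.symm.trans h'.1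
    exact ⟨rfl, h.right_unique h'⟩

theorem Red.isPath_iff {l l' : List G} (h : T.Red l l') {y x : M} :
    T.IsPath y l x ↔ T.IsPath y l' x := by
  induction h generalizing y with
  | head l hgh =>
    simp [T.src_mul _ _ hgh, T.tgt_mul _ _ hgh, T.composable hgh]
  | cons g _ ih => simp [ih]

theorem RedStar.isPath_iff {l l' : List G} (h : T.RedStar l l') {y x : M} :
    T.IsPath y l x ↔ T.IsPath y l' x := by
  induction h with
  | refl => rfl
  | tail _ h ih => exact ih.trans h.isPath_iff

theorem Red.append_left (a : List G) {l l' : List G} (h : T.Red l l') :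
    T.Red (a ++ l) (a ++ l') := by
  induction a with
  | nil => exact h
  | cons g a ih => exact Red.cons g ih

theorem Red.append_right (b : List G) {l l' : List G} (h : T.Red l l') :
    T.Red (l ++ b) (l' ++ b) := by
  induction h with
  | head l hgh => exact Red.head (l ++ b) hgh
  | cons g _ ih => exact Red.cons g ih

theorem RedStar.append {a a' b b' : List G} (h : T.RedStar a a') (h' : T.RedStar b b') :
    T.RedStar (a ++ b) (a' ++ b') :=
  (h.lift (· ++ b) fun _ _ => Red.append_right b).trans
    (h'.lift (a' ++ ·) fun _ _ => Red.append_left a')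

theorem RedStar.refl (l : List G) : T.RedStar l l := ReflTransGen.refl

theorem RedStar.mk {g h : G} (hgh : (g, h) ∈ T.mulDom) : T.RedStar [g, h] [T.mul g h] :=
  ReflTransGen.single (Red.head [] hgh)

theorem Red.ne_nil_iff {l l' : List G} (h : T.Red l l') : l ≠ [] ↔ l' ≠ [] := by
  cases h <;> simp

theorem eqvGen_isPath_iff {l l' : List G} (h : EqvGen T.Red l l') {y x : M} :
    T.IsPath y l x ↔ T.IsPath y l' x := by
  induction h with
  | rel _ _ h => exact h.isPath_iff
  | refl => rfl
  | symm _ _ _ ih => exact ih.symm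
  | trans _ _ _ _ _ ih₁ ih₂ => exact ih₁.trans ih₂

theorem eqvGen_append_left (a : List G) {l l' : List G} (h : EqvGen T.Red l l') :
    EqvGen T.Red (a ++ l) (a ++ l') := by
  induction h with
  | rel _ _ h => exact .rel _ _ (h.append_left a)
  | refl => exact .refl _
  | symm _ _ _ ih => exact ih.symm
  | trans _ _ _ _ _ ih₁ ih₂ => exact ih₁.trans _ _ _ ih₂

theorem eqvGen_append_right (b : List G) {l l' : List G} (h : EqvGen T.Red l l') :
    EqvGen T.Red (l ++ b) (l' ++ b) := by
  induction h with
  | rel _ _ h => exact .rel _ _ (h.append_right b)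
  | refl => exact .refl _
  | symm _ _ _ ih => exact ih.symm
  | trans _ _ _ _ _ ih₁ ih₂ => exact ih₁.trans _ _ _ ih₂

theorem eqvGen_append {a a' b b' : List G} (h : EqvGen T.Red a a') (h' : EqvGen T.Red b b') :
    EqvGen T.Red (a ++ b) (a' ++ b') :=
  (eqvGen_append_right b h).trans _ _ _ (eqvGen_append_left a' h')

theorem RedStar.eqvGen {l l' : List G} (h : T.RedStar l l') : EqvGen T.Red l l' := by
  induction h with
  | refl => exact .refl _
  | tail _ h ih => exact ih.trans _ _ _ (.rel _ _ h)

theorem Red.exists_eq {l l' : List G} (h : T.Red l l') :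
    ∃ a b g h, (g, h) ∈ T.mulDom ∧ l = a ++ g :: h :: b ∧ l' = a ++ T.mul g h :: b := by
  induction h with
  | head l hgh => exact ⟨[], l, _, _, hgh, rfl, rfl⟩
  | cons g _ ih =>
    obtain ⟨a, b, g', h', hg, rfl, rfl⟩ := ih
    exact ⟨g :: a, b, g', h', hg, rfl, rfl⟩

theorem Red.mk (a b : List G) {g h : G} (hgh : (g, h) ∈ T.mulDom) :
    T.Red (a ++ g :: h :: b) (a ++ T.mul g h :: b) :=
  Red.append_left a (Red.head b hgh)

theorem op_red {l l' : List G} (h : T.op.Red l l') : T.Red l.reverse l'.reverse := by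
  obtain ⟨a, b, g, k, hgk, rfl, rfl⟩ := h.exists_eq
  have := Red.mk (T := T) b.reverse a.reverse hgk
  simpa [TopLocalGroupoid.op] using this

theorem op_redStar {l l' : List G} (h : T.op.RedStar l l') : T.RedStar l.reverse l'.reverse :=
  h.lift _ fun _ _ => op_red

theorem Red.op {l l' : List G} (h : T.Red l l') : T.op.Red l.reverse l'.reverse :=
  op_red (T := T.op) h

theorem Inversional.op (hT : T.Inversional) : T.op.Inversional := by
  intro g
  obtain ⟨l, hl, h⟩ := hT g
  refine ⟨l.reverse, fun a ha => hl a (by simpa using ha), ?_⟩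
  exact h.lift _ fun _ _ => Red.op

theorem Inversional.exists_redStar (hT : T.Inversional) (l : List G) :
    ∃ w, (∀ a ∈ w, a ∈ T.invDom) ∧ T.RedStar w l := by
  induction l with
  | nil => exact ⟨[], by simp, ReflTransGen.refl⟩
  | cons g l ih =>
    obtain ⟨w, hw, h⟩ := ih
    obtain ⟨w', hw', h'⟩ := hT g
    refine ⟨w' ++ w, ?_, h'.append h⟩
    intro a ha
    rcases List.mem_append.1 ha with ha | ha
    exacts [hw' a ha, hw a ha]

/-- Each letter of a contracted word comes from a block of consecutive letters, so every cut of the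
result lifts to a cut of the original word. -/
theorem Red.exists_split {l A B : List G} (h : T.Red l (A ++ B)) :
    ∃ A' B', l = A' ++ B' ∧ T.RedStar A' A ∧ T.RedStar B' B := by
  induction A generalizing l with
  | nil => exact ⟨[], l, rfl, ReflTransGen.refl, ReflTransGen.single h⟩
  | cons a A ih =>
    cases h with
    | head _ hgh =>
      exact ⟨_ :: _ :: A, B, rfl, ReflTransGen.single (Red.head A hgh), ReflTransGen.refl⟩
    | cons _ h =>
      obtain ⟨A', B', rfl, h1, h2⟩ := ih h
      exact ⟨a :: A', B', rfl, h1.lift (a :: ·) fun _ _ => Red.cons a, h2⟩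

theorem RedStar.exists_split {l A B : List G} (h : T.RedStar l (A ++ B)) :
    ∃ A' B', l = A' ++ B' ∧ T.RedStar A' A ∧ T.RedStar B' B := by
  induction h using ReflTransGen.head_induction_on with
  | refl => exact ⟨A, B, rfl, ReflTransGen.refl, ReflTransGen.refl⟩
  | head h _ ih =>
    obtain ⟨A', B', rfl, h1, h2⟩ := ih
    obtain ⟨A'', B'', rfl, h3, h4⟩ := h.exists_split
    exact ⟨A'', B'', rfl, h3.trans h1, h4.trans h2⟩

/-! ### Ladders -/

variable (T) in
/-- A commutative ladder `v_i k_{i+1} = k_i w_i`, depending on a parameter in `ι`, whose rungs `k_i`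
are close to units, between a string `vs` close to `ws` and the constant string `ws`. -/
inductive Ladder {ι : Type*} (F : Filter ι) :
    (ι → G) → List (ι → G) → List G → (ι → G) → Prop
  | nil (k : ι → G) : Ladder F k [] [] k
  | cons {k k' k'' v : ι → G} {g : G} {vs : List (ι → G)} {ws : List G} :
      Tendsto v F (𝓝 g) → Tendsto k F (𝓝 (T.unit (T.tgt g))) →
      Tendsto k' F (𝓝 (T.unit (T.src g))) →
      (∀ᶠ i in F, (v i, k' i) ∈ T.mulDom ∧ (k i, g) ∈ T.mulDom ∧
        T.mul (v i) (k' i) = T.mul (k i) g) →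
      Ladder F k' vs ws k'' → Ladder F k (v :: vs) (g :: ws) k''

section Ladder

variable {ι : Type*} {F : Filter ι}

/-- `(v₁ v₂) k₂ = v₁ (v₂ k₂) = v₁ (k₁ h) = (v₁ k₁) h = (k₀ g) h = k₀ (g h)`. The three
reassociations take place near the triples `(g, h, 1)`, `(g, 1, h)` and `(1, g, h)`, where all
domain conditions hold. -/
theorem Ladder.contract {k k'' v₁ v₂ f : ι → G} {g h : G} {vs : List (ι → G)} {ws : List G}
    (hl : T.Ladder F k (v₁ :: v₂ :: vs) (g :: h :: ws) k'') (hgh : (g, h) ∈ T.mulDom)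
    (hv : ∀ᶠ i in F, T.src (v₁ i) = T.tgt (v₂ i))
    (hf : ∀ᶠ i in F, f i = T.mul (v₁ i) (v₂ i)) :
    T.Ladder F k (f :: vs) (T.mul g h :: ws) k'' := by
  have hsgh := T.composable hgh
  obtain _ | ⟨hv₁, hk₀, hk₁, e₁, _ | ⟨hv₂, -, hk₂, e₂, hl⟩⟩ := hl
  have hvv := T.tendsto_mul hv₁ hv₂ hgh hv
  refine Ladder.cons (hvv.congr' (hf.mono fun i hi => hi.symm)) ?_ ?_ ?_ hl
  · rwa [T.tgt_mul _ _ hgh]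
  · rwa [T.src_mul _ _ hgh]
  · have a₁ := T.eventually_assoc hv₁ hv₂ hk₂ hgh (T.unit_right_mem h)
      (by rw [← T.src_mul _ _ hgh]; exact T.unit_right_mem _)
      (by rwa [T.mul_unit]) hv (e₂.mono fun i hi => T.composable hi.1)
    have a₂ := T.eventually_assoc hv₁ hk₁ (tendsto_const_nhds (x := h)) (T.unit_right_mem g)
      (by rw [hsgh]; exact T.unit_left_mem h) (by rwa [T.mul_unit])
      (by rwa [hsgh, T.unit_mul]) (e₁.mono fun i hi => T.composable hi.1)
      (e₂.mono fun i hi => T.composable hi.2.1)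
    have a₃ := T.eventually_assoc hk₀ (tendsto_const_nhds (x := g)) (tendsto_const_nhds (x := h))
      (T.unit_left_mem g) hgh (by rwa [T.unit_mul])
      (by rw [← T.tgt_mul _ _ hgh]; exact T.unit_left_mem _)
      (e₁.mono fun i hi => T.composable hi.2.1) (Eventually.of_forall fun _ => hsgh)
    filter_upwards [a₁, a₂, a₃, e₁, e₂, hf] with i a₁ a₂ a₃ e₁ e₂ hf
    rw [hf]
    refine ⟨a₁.2.2.1, a₃.2.2.2.1, ?_⟩
    rw [a₁.2.2.2.2, e₂.2.2, ← a₂.2.2.2.2, e₁.2.2, a₃.2.2.2.2]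

/-- A local section of multiplication expands the whole nearby family in the same way as its limit,
and `Ladder.contract` brings ladders back down. It is therefore enough to find ladders after an
expansion. -/
theorem Red.exists_lift {ws₁ ws : List G} (h : T.Red ws₁ ws) {vs : List (ι → G)}
    (hvs : List.Forall₂ (fun v g => Tendsto v F (𝓝 g)) vs ws) {y x : ι → M}
    (hp : ∀ᶠ i in F, T.IsPath (y i) (vs.evalFun i) (x i)) :
    ∃ vs₁ : List (ι → G), List.Forall₂ (fun v g => Tendsto v F (𝓝 g)) vs₁ ws₁ ∧
      (∀ᶠ i in F, T.IsPath (y i) (vs₁.evalFun i) (x i)) ∧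
      ∀ k kn, T.Ladder F k vs₁ ws₁ kn → T.Ladder F k vs ws kn := by
  induction h generalizing vs y with
  | @head g h l hgh =>
    obtain _ | ⟨hf, hvs⟩ := hvs
    rename_i f vs
    obtain ⟨a, b, ha, hb, hab⟩ := T.exists_section g h hgh
    have hab' := hf.eventually hab
    refine ⟨(a ∘ f) :: (b ∘ f) :: vs, .cons (ha.comp hf) (.cons (hb.comp hf) hvs), ?_, ?_⟩
    · filter_upwards [hab', hp] with i h1 h2
      have hs := T.src_mul _ _ h1.1
      have ht := T.tgt_mul _ _ h1.1
      rw [h1.2] at hs ht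
      simp only [List.evalFun_cons, isPath_cons, Function.comp_apply] at h2 ⊢
      refine ⟨ht ▸ h2.1, (T.composable h1.1).symm, hs ▸ h2.2⟩
    · intro k kn hl
      refine hl.contract hgh ?_ ?_
      · exact hab'.mono fun i hi => T.composable hi.1
      · exact hab'.mono fun i hi => hi.2.symm
  | cons g _ ih =>
    obtain _ | ⟨hf, hvs⟩ := hvs
    rename_i f vs
    obtain ⟨vs₁, h1, h2, h3⟩ := ih hvs (y := fun i => T.src (f i)) (hp.mono fun i hi => hi.2)
    refine ⟨f :: vs₁, .cons hf h1, ?_, ?_⟩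
    · filter_upwards [h2, hp] with i h2 hp using ⟨hp.1, h2⟩
    · intro k kn hl
      obtain _ | ⟨h4, h5, h6, h7, h8⟩ := hl
      exact Ladder.cons h4 h5 h6 h7 (h3 _ _ h8)

/-- Reading from the right, each rung is solved for as `(v k₁) g⁻¹`, which tends to `g g⁻¹`, a unit.
-/
theorem exists_ladder_of_invertible {ws : List G} (hws : ∀ a ∈ ws, a ∈ T.invDom)
    {vs : List (ι → G)} (hvs : List.Forall₂ (fun v g => Tendsto v F (𝓝 g)) vs ws) {y x : M}
    (hp : T.IsPath y ws x) {kn : ι → G} (hkn : Tendsto kn F (𝓝 (T.unit x)))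
    (hx : ∀ᶠ i in F, T.src (kn i) = x) {y' : ι → M}
    (hpv : ∀ᶠ i in F, T.IsPath (y' i) (vs.evalFun i) (T.tgt (kn i))) :
    ∃ k, T.Ladder F k vs ws kn ∧ Tendsto k F (𝓝 (T.unit y)) ∧
      ∀ᶠ i in F, T.src (k i) = y ∧ T.tgt (k i) = y' i := by
  induction hvs generalizing y y' with
  | nil =>
    obtain rfl : y = x := hp
    exact ⟨kn, .nil _, hkn, by filter_upwards [hx, hpv] with i h1 h2 using ⟨h1, h2.symm⟩⟩
  | @cons v g vs ws hv hvs ih =>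
    obtain ⟨rfl, hp⟩ := hp
    have hg : g ∈ T.invDom := hws g (by simp)
    obtain ⟨k₁, hl, hk₁, e⟩ := ih (fun a ha => hws a (by simp [ha])) hp
      (y' := fun i => T.src (v i)) (hpv.mono fun i hi => hi.2)
    have hgi : (g, T.inv g) ∈ T.mulDom :=
      T.mem_mulDom_of_invDom _ hg _ (T.inv_mem_invDom _ hg) (T.tgt_inv _ hg).symm
    have hig : (T.inv g, g) ∈ T.mulDom :=
      T.mem_mulDom_of_invDom _ (T.inv_mem_invDom _ hg) _ hg (T.src_inv _ hg)
    have e₁ := T.eventually_mem_mulDom hv hk₁ (T.unit_right_mem g) (e.mono fun i hi => hi.2.symm)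
    have hvk := T.tendsto_mul hv hk₁ (T.unit_right_mem g) (e.mono fun i hi => hi.2.symm)
    rw [T.mul_unit] at hvk
    have hs : ∀ᶠ i in F, T.src (T.mul (v i) (k₁ i)) = T.tgt (T.inv g) := by
      filter_upwards [e₁, e] with i h1 h2
      rw [T.src_mul _ _ h1, h2.1, T.tgt_inv _ hg]
    have a := T.eventually_assoc hvk (tendsto_const_nhds (x := T.inv g))
      (tendsto_const_nhds (x := g)) hgi hig
      (by rw [T.mul_inv _ hg]; exact T.unit_left_mem g)
      (by rw [T.inv_mul _ hg]; exact T.unit_right_mem g) hs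
      (Eventually.of_forall fun _ => T.src_inv _ hg)
    have hk := T.tendsto_mul hvk (tendsto_const_nhds (x := T.inv g)) hgi hs
    rw [T.mul_inv _ hg] at hk
    refine ⟨_, .cons hv hk hk₁ ?_ hl, hk, ?_⟩
    · filter_upwards [a, e₁, e] with i a h1 h2
      refine ⟨h1, a.2.2.1, ?_⟩
      rw [a.2.2.2.2, T.inv_mul _ hg]
      have := T.mul_unit (T.mul (v i) (k₁ i))
      rw [T.src_mul _ _ h1, h2.1] at this
      exact this.symm
    · filter_upwards [a, e₁, hpv] with i a h1 h2
      rw [T.src_mul _ _ a.1, T.tgt_mul _ _ a.1, T.tgt_mul _ _ h1, T.src_inv _ hg]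
      exact ⟨rfl, h2.1⟩

theorem RedStar.exists_lift {ws₁ ws : List G} (h : T.RedStar ws₁ ws) {vs : List (ι → G)}
    (hvs : List.Forall₂ (fun v g => Tendsto v F (𝓝 g)) vs ws) {y x : ι → M}
    (hp : ∀ᶠ i in F, T.IsPath (y i) (vs.evalFun i) (x i)) :
    ∃ vs₁ : List (ι → G), List.Forall₂ (fun v g => Tendsto v F (𝓝 g)) vs₁ ws₁ ∧
      (∀ᶠ i in F, T.IsPath (y i) (vs₁.evalFun i) (x i)) ∧
      ∀ k kn, T.Ladder F k vs₁ ws₁ kn → T.Ladder F k vs ws kn := by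
  induction h using ReflTransGen.head_induction_on with
  | refl => exact ⟨vs, hvs, hp, fun _ _ h => h⟩
  | head h _ ih =>
    obtain ⟨vs₁, h1, h2, h3⟩ := ih
    obtain ⟨vs₂, h4, h5, h6⟩ := h.exists_lift h1 h2
    exact ⟨vs₂, h4, h5, fun k kn hl => h3 _ _ (h6 _ _ hl)⟩

/-- The rungs exist over an expansion with invertible letters, and contracting the ladder does not
change its two outer rungs. -/
theorem Inversional.exists_ladder (hT : T.Inversional) {ws : List G}
    {vs : List (ι → G)} (hvs : List.Forall₂ (fun v g => Tendsto v F (𝓝 g)) vs ws) {y x : M}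
    (hp : T.IsPath y ws x) {kn : ι → G} (hkn : Tendsto kn F (𝓝 (T.unit x)))
    (hx : ∀ᶠ i in F, T.src (kn i) = x) {y' : ι → M}
    (hpv : ∀ᶠ i in F, T.IsPath (y' i) (vs.evalFun i) (T.tgt (kn i))) :
    ∃ k, T.Ladder F k vs ws kn ∧ Tendsto k F (𝓝 (T.unit y)) ∧
      ∀ᶠ i in F, T.src (k i) = y ∧ T.tgt (k i) = y' i := by
  obtain ⟨w, hw, h⟩ := hT.exists_redStar ws
  obtain ⟨vs₁, h1, h2, h3⟩ := RedStar.exists_lift h hvs hpv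
  obtain ⟨k, h4, h5⟩ := exists_ladder_of_invertible hw h1 (h.isPath_iff.2 hp) hkn hx h2
  exact ⟨k, h3 _ _ h4, h5⟩

/-- Right division: an arrow `f` close to `g`, with the same source, is `k g` with `k` close to a
unit. -/
theorem Inversional.exists_right_div (hT : T.Inversional) {f : ι → G} {g : G}
    (hf : Tendsto f F (𝓝 g)) (hs : ∀ᶠ i in F, T.src (f i) = T.src g) :
    ∃ k : ι → G, Tendsto k F (𝓝 (T.unit (T.tgt g))) ∧
      ∀ᶠ i in F, (k i, g) ∈ T.mulDom ∧ T.mul (k i) g = f i := by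
  -- With the constant unit as its last rung, a ladder over one letter reads `f · 1 = k · g`.
  obtain ⟨k, h1, h2, h3⟩ := hT.exists_ladder (ws := [g]) (vs := [f]) (.cons hf .nil)
    (y := T.tgt g) (x := T.src g) ⟨rfl, rfl⟩ (kn := fun _ => T.unit (T.src g))
    tendsto_const_nhds (Eventually.of_forall fun _ => T.src_unit _)
    (y' := fun i => T.tgt (f i))
    (by filter_upwards [hs] with i hi; simp [hi, T.tgt_unit])
  obtain _ | ⟨-, -, -, e, h⟩ := h1
  cases h
  refine ⟨k, h2, ?_⟩
  filter_upwards [e, hs] with i hi hs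
  refine ⟨hi.2.1, ?_⟩
  rw [← hi.2.2, ← hs, T.mul_unit]

/-! ### Common expansions -/

variable (T) in
/-- The arrows `g` for which `h` is obtained from `g h` by left multiplication by a word `e'`
which is inverse to a word `e` representing `g`. -/
def IsUnwindable (h g : G) : Prop :=
  ∃ e e' : List G, T.RedStar e [g] ∧ T.RedStar (e' ++ [T.mul g h]) [h] ∧
    T.RedStar (e ++ e') [T.unit (T.tgt g)]

/-- Passing from `g` to `k g` prepends `k` to `e` and appends its right inverse `l` to `e'`. Then
`e' l (g' h)` reduces through `e' (g h)` to `h`, and `k e e' l` reduces through `k l` to a unit. -/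
theorem IsUnwindable.step {h g g' k l : G} (hg : T.IsUnwindable h g) (h1 : (k, g) ∈ T.mulDom)
    (h2 : T.mul k g = g') (h3 : (k, l) ∈ T.mulDom) (h4 : T.mul k l = T.unit (T.tgt g'))
    (h5 : (l, T.mul g' h) ∈ T.mulDom) (h6 : T.mul l (T.mul g' h) = T.mul g h) :
    T.IsUnwindable h g' := by
  obtain ⟨e, e', a, b, c⟩ := hg
  refine ⟨k :: e, e' ++ [l], ?_, ?_, ?_⟩
  · have := (RedStar.refl ([k])).append a
    rw [← h2]
    exact this.trans (RedStar.mk h1)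
  · have := (RedStar.refl (e')).append (RedStar.mk h5)
    rw [h6] at this
    simpa using this.trans b
  · have h7 := ((RedStar.refl ([k])).append c).append (RedStar.refl ([l]))
    have h8 : T.RedStar [k, T.unit (T.tgt g)] [k] := by
      have := RedStar.mk (T.unit_right_mem k)
      rwa [T.mul_unit, T.composable h1] at this
    have h9 := h8.append (RedStar.refl ([l]))
    rw [← h4]
    simpa using (h7.trans h9).trans (RedStar.mk h3)

/-- By right division `γ τ = k (γ τ₀)` for `τ` near `τ₀`, with `k` close to a unit and hence
invertible. Stepping by `k` and by `k⁻¹` shows that unwindability is locally constant along the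
path, and it holds trivially at the unit where the path starts. -/
theorem Inversional.isUnwindable (hT : T.Inversional) {g h : G}
    (γ : Path (T.unit (T.tgt h)) g) (hγ : ∀ τ, (γ τ, h) ∈ T.mulDom) : T.IsUnwindable h g := by
  have hloc : IsLocallyConstant fun τ => T.IsUnwindable h (γ τ) := by
    rw [IsLocallyConstant.iff_eventually_eq]
    intro τ₀
    have hf : Tendsto γ (𝓝 τ₀) (𝓝 (γ τ₀)) := γ.continuous.continuousAt
    have hs : ∀ τ, T.src (γ τ) = T.tgt h := fun τ => T.composable (hγ τ)
    obtain ⟨k, hk, e⟩ := hT.exists_right_div hf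
      (Eventually.of_forall fun τ => (hs τ).trans (hs τ₀).symm)
    set x := T.tgt (γ τ₀) with hx
    have hl : Tendsto (fun τ => T.inv (k τ)) (𝓝 τ₀) (𝓝 (T.unit x)) := by
      have := T.tendsto_inv hk (T.unit_mem_invDom x)
      rwa [inv_unit] at this
    have hkd : ∀ᶠ τ in 𝓝 τ₀, k τ ∈ T.invDom :=
      hk (T.invDom_open.mem_nhds (T.unit_mem_invDom x))
    have hux : (T.unit x, T.unit x) ∈ T.mulDom := by
      have := T.unit_left_mem (T.unit x); rwa [T.tgt_unit] at this
    have huu : T.mul (T.unit x) (T.unit x) = T.unit x := by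
      have := T.mul_unit (T.unit x); rwa [T.src_unit] at this
    have hug : T.mul (T.unit x) (γ τ₀) = γ τ₀ := T.unit_mul _
    have hugm : (T.unit x, γ τ₀) ∈ T.mulDom := T.unit_left_mem _
    have hc : T.tgt (T.mul (γ τ₀) h) = x := T.tgt_mul _ _ (hγ τ₀)
    have hucm : (T.unit x, T.mul (γ τ₀) h) ∈ T.mulDom := by
      have := T.unit_left_mem (T.mul (γ τ₀) h); rwa [hc] at this
    have huc : T.mul (T.unit x) (T.mul (γ τ₀) h) = T.mul (γ τ₀) h := by
      have := T.unit_mul (T.mul (γ τ₀) h); rwa [hc] at this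
    have hsk : ∀ᶠ τ in 𝓝 τ₀, T.src (k τ) = x := e.mono fun τ h => T.composable h.1
    have hslk : ∀ᶠ τ in 𝓝 τ₀, T.src (T.inv (k τ)) = T.tgt (k τ) :=
      hkd.mono fun τ h => T.src_inv _ h
    have a₁ := T.eventually_assoc hk (tendsto_const_nhds (x := γ τ₀))
      (tendsto_const_nhds (x := h)) hugm (hγ τ₀) (by rw [hug]; exact hγ τ₀) hucm
      (e.mono fun τ h => T.composable h.1) (Eventually.of_forall fun _ => hs τ₀)
    have a₂ := T.eventually_assoc hl hk (tendsto_const_nhds (x := T.mul (γ τ₀) h)) hux hucm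
      (by rwa [huu]) (by rwa [huc]) hslk (by rwa [hc])
    have a₃ := T.eventually_assoc hl hk (tendsto_const_nhds (x := γ τ₀)) hux hugm
      (by rwa [huu]) (by rwa [hug]) hslk (by rwa [← hx])
    filter_upwards [a₁, a₂, a₃, e, hkd, hsk] with τ a₁ a₂ a₃ e hkd hsk
    have h1 : T.mul (k τ) (T.mul (γ τ₀) h) = T.mul (γ τ) h := by rw [← a₁.2.2.2.2, e.2]
    have hkl : (k τ, T.inv (k τ)) ∈ T.mulDom :=
      T.mem_mulDom_of_invDom _ hkd _ (T.inv_mem_invDom _ hkd) (T.tgt_inv _ hkd).symm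
    have htk : T.tgt (k τ) = T.tgt (γ τ) := by rw [← T.tgt_mul _ _ e.1, e.2]
    -- From `τ` to `τ₀` the step is by the inverse of `k τ`; from `τ₀` to `τ` it is by `k τ`.
    refine propext ⟨fun hp => ?_, fun hp => ?_⟩
    · refine hp.step (k := T.inv (k τ)) (l := k τ) (e.2 ▸ a₃.2.2.2.1) ?_ a₂.1 ?_ a₁.2.2.2.1 h1
      · rw [← e.2, ← a₃.2.2.2.2, T.inv_mul _ hkd, hsk, hug]
      · rw [T.inv_mul _ hkd, hsk]
    · refine hp.step e.1 e.2 hkl (by rw [T.mul_inv _ hkd, htk]) (h1 ▸ a₂.2.2.2.1) ?_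
      rw [← h1, ← a₂.2.2.2.2, T.inv_mul _ hkd, hsk, huc]
  have h0 : T.IsUnwindable h (γ 0) := by
    rw [γ.source]
    refine ⟨[T.unit (T.tgt h)], [T.unit (T.tgt h)], ReflTransGen.refl, ?_, ?_⟩
    · have := RedStar.mk (T.unit_left_mem h)
      rw [T.unit_mul]
      rwa [T.unit_mul] at this
    · have := RedStar.mk (T.unit_left_mem (T.unit (T.tgt h)))
      rw [T.unit_mul] at this
      simpa [T.tgt_unit] using this
  have := hloc.apply_eq_of_preconnectedSpace 0 1
  simp only [γ.target] at this
  rw [← this]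
  exact h0

variable (T) in
/-- Products are connected to the axes. -/
def ConnectedToAxes : Prop :=
  ∀ g h, (g, h) ∈ T.mulDom →
    (∃ γ : Path (T.unit (T.tgt h)) g, ∀ τ, (γ τ, h) ∈ T.mulDom) ∨
    (∃ γ : Path (T.unit (T.src g)) h, ∀ τ, (g, γ τ) ∈ T.mulDom)

/-- Let `w₂ = P Q R` with `Q` contracting to `g h`. In the case of a path to `g`, the common
expansion is `P e e' Q R`. Contracting `e` to `g` and `e' Q` to `h` gives `w`, whereas contracting
`e e'` to a unit and absorbing it into `Q` gives `w₂`. -/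
theorem Red.exists_common_expansion (hT : T.Inversional) (hA : T.ConnectedToAxes)
    {w w₀ w₂ : List G} (hr : T.Red w w₀) (h₂ : T.RedStar w₂ w₀) :
    ∃ w₃, T.RedStar w₃ w ∧ T.RedStar w₃ w₂ := by
  obtain ⟨p, q, g, h, hgh, rfl, rfl⟩ := hr.exists_eq
  obtain ⟨P, QR, rfl, hP, hQR⟩ := RedStar.exists_split h₂
  obtain ⟨Q, R, rfl, hQ, hR⟩ := RedStar.exists_split (A := [T.mul g h]) (B := q) hQR
  have hpath : T.IsPath (T.tgt g) Q (T.src h) := by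
    rw [RedStar.isPath_iff hQ]
    simp [T.tgt_mul _ _ hgh, T.src_mul _ _ hgh]
  rcases hA g h hgh with ⟨γ, hγ⟩ | ⟨γ, hγ⟩
  · obtain ⟨e, e', h1, h2, h3⟩ := hT.isUnwindable γ hγ
    refine ⟨P ++ (e ++ ((e' ++ Q) ++ R)), ?_, ?_⟩
    · exact hP.append (h1.append (RedStar.append
        (((RedStar.refl (e')).append hQ).trans h2) hR))
    · refine (RedStar.refl (P)).append ?_
      have h4 : T.RedStar ((e ++ e') ++ Q) Q := by
        refine (h3.append (RedStar.refl (Q))).trans ?_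
        -- `Q` is nonempty because it contracts to the single letter `g h`, so there is a first
        -- letter to absorb the unit.
        cases Q with
        | nil =>
          exfalso
          rcases ReflTransGen.cases_head hQ with h | ⟨c, h, -⟩
          · cases h
          · cases h
        | cons c Q =>
          have := Red.head (T := T) Q (T.unit_left_mem c)
          rw [T.unit_mul, hpath.1] at this
          exact ReflTransGen.single this
      simpa using h4.append (RedStar.refl (R))
  -- A path to `h` is a path of the first kind in the opposite groupoid. Reversing all words puts
  -- the unwinding pair to the right of `Q`.
  · obtain ⟨e, e', h1, h2, h3⟩ := hT.op.isUnwindable (T := T.op) (g := h) (h := g) γ hγ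
    replace h1 := op_redStar h1
    replace h2 := op_redStar h2
    replace h3 := op_redStar h3
    simp only [List.reverse_append, List.reverse_cons, List.reverse_nil, List.nil_append] at h1 h2 h3
    refine ⟨P ++ (((Q ++ e'.reverse) ++ e.reverse) ++ R), ?_, ?_⟩
    · have := (hQ.append (RedStar.refl (e'.reverse))).trans h2
      simpa using hP.append ((RedStar.append this h1).append hR)
    · refine (RedStar.refl (P)).append (RedStar.append ?_ ReflTransGen.refl)
      have := (RedStar.refl (Q)).append h3
      rw [List.append_assoc]
      refine this.trans ?_
      rcases List.eq_nil_or_concat Q with rfl | ⟨Q, c, rfl⟩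
      · exfalso
        rcases ReflTransGen.cases_head hQ with h | ⟨c, h, -⟩
        · cases h
        · cases h
      · have hc : T.src c = T.src h := by
          obtain ⟨z, -, hz⟩ := isPath_append.1 (List.concat_eq_append ▸ hpath)
          exact hz.2
        have := Red.mk (T := T) Q [] (T.unit_right_mem c)
        rw [T.mul_unit, hc] at this
        exact ReflTransGen.single (by simpa [TopLocalGroupoid.op] using this)

theorem RedStar.exists_common_expansion (hT : T.Inversional) (hA : T.ConnectedToAxes)
    {w w₀ w₂ : List G} (h : T.RedStar w w₀) (h₂ : T.RedStar w₂ w₀) :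
    ∃ w₃, T.RedStar w₃ w ∧ T.RedStar w₃ w₂ := by
  induction h using ReflTransGen.head_induction_on with
  | refl => exact ⟨w₂, h₂, ReflTransGen.refl⟩
  | head h _ ih =>
    obtain ⟨w₃, h3, h4⟩ := ih
    obtain ⟨w₄, h5, h6⟩ := Red.exists_common_expansion hT hA h h3
    exact ⟨w₄, h5, h6.trans h4⟩

/-- Equivalent words have a common expansion. -/
theorem exists_common_expansion (hT : T.Inversional) (hA : T.ConnectedToAxes) {w w' : List G}
    (h : EqvGen T.Red w w') : ∃ w₃, T.RedStar w₃ w ∧ T.RedStar w₃ w' := by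
  induction h with
  | rel _ _ h => exact ⟨_, ReflTransGen.refl, ReflTransGen.single h⟩
  | refl => exact ⟨_, ReflTransGen.refl, ReflTransGen.refl⟩
  | symm _ _ _ ih => exact ih.imp fun _ h => h.symm
  | trans _ _ _ _ _ ih₁ ih₂ =>
    obtain ⟨a, h1, h2⟩ := ih₁
    obtain ⟨b, h3, h4⟩ := ih₂
    obtain ⟨c, h5, h6⟩ := RedStar.exists_common_expansion hT hA h2 h3
    exact ⟨c, h5.trans h1, h6.trans h4⟩

/-! ### Associators form a countable set over each object -/

/-- The position `n` is chosen before the ladder, so the same contraction is performed on all words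
of every nearby family. -/
theorem Red.exists_contractAt {ws ws' : List G} (h : T.Red ws ws') :
    ∃ n, ws' = List.contractAt T.mul n ws ∧ ∀ {ι : Type _} {F : Filter ι} {vs : List (ι → G)}
      {k kn : ι → G} {y x : ι → M}, T.Ladder F k vs ws kn →
      (∀ᶠ i in F, T.IsPath (y i) (vs.evalFun i) (x i)) →
      T.Ladder F k (List.contractAt (fun f g i => T.mul (f i) (g i)) n vs) ws' kn ∧
      ∀ᶠ i in F, T.IsPath (y i)
        ((List.contractAt (fun f g i => T.mul (f i) (g i)) n vs).evalFun i) (x i) := by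
  induction h with
  | @head g h l hgh =>
    refine ⟨0, rfl, ?_⟩
    intro ι F vs k kn y x hl hp
    obtain _ | ⟨h1, h2, h3, h4, _ | ⟨h5, h6, h7, h8, h9⟩⟩ := id hl
    have hv := hp.mono fun i hi => hi.2.1.symm
    refine ⟨hl.contract hgh hv (Eventually.of_forall fun _ => rfl), ?_⟩
    filter_upwards [hp, T.eventually_mem_mulDom h1 h5 hgh hv] with i hi hm
    simp only [List.contractAt, List.evalFun_cons, isPath_cons, T.src_mul _ _ hm,
      T.tgt_mul _ _ hm]
    exact ⟨hi.1, hi.2.2⟩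
  | cons g _ ih =>
    obtain ⟨n, rfl, ih⟩ := ih
    refine ⟨n + 1, rfl, ?_⟩
    intro ι F vs k kn y x hl hp
    obtain _ | ⟨h1, h2, h3, h4, h5⟩ := hl
    rename_i k' v vs
    obtain ⟨h6, h7⟩ := ih (y := fun i => T.src (v i)) h5 (hp.mono fun i hi => hi.2)
    refine ⟨.cons h1 h2 h3 h4 h6, ?_⟩
    filter_upwards [hp, h7] with i hp h7 using ⟨hp.1, h7⟩

theorem RedStar.exists_contractAt {ws ws' : List G} (h : T.RedStar ws ws') :
    ∃ p : List ℕ, ws' = p.foldl (fun l n => List.contractAt T.mul n l) ws ∧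
      ∀ {ι : Type _} {F : Filter ι} {vs : List (ι → G)}
      {k kn : ι → G} {y x : ι → M}, T.Ladder F k vs ws kn →
      (∀ᶠ i in F, T.IsPath (y i) (vs.evalFun i) (x i)) →
      ∃ vs' : List (ι → G), T.Ladder F k vs' ws' kn ∧
        (∀ i, vs'.evalFun i = p.foldl (fun l n => List.contractAt T.mul n l) (vs.evalFun i)) := by
  suffices ∃ p : List ℕ, ws' = p.foldl (fun l n => List.contractAt T.mul n l) ws ∧
      ∀ {ι : Type _} {F : Filter ι} {vs : List (ι → G)}
      {k kn : ι → G} {y x : ι → M}, T.Ladder F k vs ws kn →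
      (∀ᶠ i in F, T.IsPath (y i) (vs.evalFun i) (x i)) →
      ∃ vs' : List (ι → G), T.Ladder F k vs' ws' kn ∧
        (∀ᶠ i in F, T.IsPath (y i) (vs'.evalFun i) (x i)) ∧
        (∀ i, vs'.evalFun i = p.foldl (fun l n => List.contractAt T.mul n l) (vs.evalFun i)) by
    obtain ⟨p, h1, h2⟩ := this
    refine ⟨p, h1, ?_⟩
    intro ι F vs k kn y x hl hp
    obtain ⟨vs', h3, -, h4⟩ := h2 hl hp
    exact ⟨vs', h3, h4⟩
  induction h with
  | refl => exact ⟨[], rfl, fun hl hp => ⟨_, hl, hp, fun _ => rfl⟩⟩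
  | tail _ h ih =>
    obtain ⟨p, rfl, h2⟩ := ih
    obtain ⟨n, rfl, h3⟩ := h.exists_contractAt
    refine ⟨p ++ [n], by simp, ?_⟩
    intro ι F vs k kn y x hl hp
    obtain ⟨vs', h4, h5, h6⟩ := h2 hl hp
    obtain ⟨h7, h8⟩ := h3 h4 h5
    exact ⟨_, h7, h8, fun i => by simp [List.evalFun_contractAt, h6]⟩

variable (T) in
/-- The arrows `g` with source and target `x` which are values of a word that can also be
contracted to the unit at `x`. -/
def AssocAt (x : M) : Set G :=
  {g | T.src g = x ∧ T.tgt g = x ∧ ∃ w, T.RedStar w [T.unit x] ∧ T.RedStar w [g]}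

/-- An associator is recorded by a word and two recipes contracting it to the unit and to the
associator. There are countably many choices for the length and the recipes. Once these are fixed,
the associators form a discrete space for the topology given by their words in a finite power of
`G`, and that topology is second countable. -/
theorem Inversional.countable_assocAt [SecondCountableTopology G] (hT : T.Inversional) (x : M) :
    (T.AssocAt x).Countable := by
  choose! w hw₁ hw₂ using fun (g : G) (hg : g ∈ T.AssocAt x) => hg.2.2
  choose! p₁ hp₁ hl₁ using fun (g : G) (hg : g ∈ T.AssocAt x) => (hw₁ g hg).exists_contractAt
  choose! p₂ hp₂ hl₂ using fun (g : G) (hg : g ∈ T.AssocAt x) => (hw₂ g hg).exists_contractAt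
  let A : List ℕ × List ℕ × ℕ → Set G := fun c =>
    {g | g ∈ T.AssocAt x ∧ (p₁ g, p₂ g, (w g).length) = c}
  have hA : T.AssocAt x ⊆ ⋃ c, A c := fun g hg => Set.mem_iUnion.2 ⟨_, hg, rfl⟩
  refine (Set.countable_iUnion fun c => ?_).mono hA
  obtain ⟨c₁, c₂, n⟩ := c
  have hlen : ∀ g : A (c₁, c₂, n), (w g).length = n := fun g => by
    have := g.2.2; simp only [Prod.mk.injEq] at this; exact this.2.2
  have hc₁ : ∀ g : A (c₁, c₂, n), p₁ g = c₁ := fun g => by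
    have := g.2.2; simp only [Prod.mk.injEq] at this; exact this.1
  have hc₂ : ∀ g : A (c₁, c₂, n), p₂ g = c₂ := fun g => by
    have := g.2.2; simp only [Prod.mk.injEq] at this; exact this.2.1
  let W : A (c₁, c₂, n) → Fin n → G := fun g j => (w g).get (j.cast (hlen g).symm)
  have hW : ∀ g, List.ofFn (W g) = w g := fun g => by
    apply List.ext_get
    · simp [hlen]
    · intro m h1 h2; simp [W]
  -- The topology comes from the witnessing words rather than from `G`: closeness of associators
  -- alone would not make their words close.
  let _ : TopologicalSpace (A (c₁, c₂, n)) := TopologicalSpace.induced W inferInstance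
  have hWi : Topology.IsInducing W := ⟨rfl⟩
  have := hWi.secondCountableTopology
  suffices DiscreteTopology (A (c₁, c₂, n)) from
    Set.countable_coe_iff.1 (TopologicalSpace.separableSpace_iff_countable.1 inferInstance)
  refine discreteTopology_iff_singleton_mem_nhds.2 fun g₀ => ?_
  have hg₀ := g₀.2.1
  let vs : List (A (c₁, c₂, n) → G) := List.ofFn fun j g => W g j
  have hvs : ∀ g, vs.evalFun g = w g := fun g => by
    rw [← hW]; simp only [vs, List.evalFun, List.map_ofFn]; rfl
  have hpath : ∀ g : A (c₁, c₂, n), T.IsPath x (w g) x := fun g => by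
    rw [RedStar.isPath_iff (hw₁ g g.2.1)]; simp [T.tgt_unit, T.src_unit]
  have hF : List.Forall₂ (fun v g => Tendsto v (𝓝 g₀) (𝓝 g)) vs (w g₀) := by
    rw [← hW, List.forall₂_iff_get]
    refine ⟨by simp [vs], fun i h1 h2 => ?_⟩
    simp only [vs, List.get_ofFn]
    exact ((continuous_apply _).comp hWi.continuous).continuousAt
  have hpv : ∀ᶠ g in 𝓝 g₀, T.IsPath x (vs.evalFun g) (T.tgt (T.unit x)) :=
    Eventually.of_forall fun g => by rw [hvs, T.tgt_unit]; exact hpath g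
  obtain ⟨k, hl, -, -⟩ := hT.exists_ladder hF (hpath g₀) (kn := fun _ => T.unit x)
    tendsto_const_nhds (Eventually.of_forall fun _ => T.src_unit x) (y' := fun _ => x) hpv
  -- One ladder, with last rung the unit, is contracted in two ways. By the first recipe it reads `1
  -- · 1 = k · 1`, so `k` is a unit. By the second it reads `g · 1 = k · g₀`, so `g = g₀`.
  obtain ⟨vs₁, l₁, e₁⟩ := hl₁ g₀ hg₀ hl (y := fun _ => x) hpv
  obtain ⟨vs₂, l₂, e₂⟩ := hl₂ g₀ hg₀ hl (y := fun _ => x) hpv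
  obtain _ | ⟨-, -, -, e₃, h⟩ := l₁
  cases h
  obtain _ | ⟨-, -, -, e₄, h⟩ := l₂
  cases h
  filter_upwards [e₃, e₄] with g e₃ e₄
  have f₁ := e₁ g
  have f₂ := e₂ g
  rw [hvs, (hc₁ g₀).trans (hc₁ g).symm, ← hp₁ g g.2.1] at f₁
  rw [hvs, (hc₂ g₀).trans (hc₂ g).symm, ← hp₂ g g.2.1] at f₂
  simp only [List.evalFun_cons, List.evalFun_nil, List.cons.injEq, and_true] at f₁ f₂
  obtain ⟨-, e₅, e₆⟩ := e₃
  obtain ⟨-, -, e₇⟩ := e₄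
  have hk : T.src (k g) = x := by rw [T.composable e₅, T.tgt_unit]
  have hku : T.mul (k g) (T.unit x) = k g := by have := T.mul_unit (k g); rwa [hk] at this
  have huu : T.mul (T.unit x) (T.unit x) = T.unit x := by
    have := T.mul_unit (T.unit x); rwa [T.src_unit] at this
  rw [hku, f₁, huu] at e₆
  have h8 := T.mul_unit (g : G)
  rw [g.2.1.1] at h8
  have h9 := T.unit_mul (g₀ : G)
  rw [g₀.2.1.2.1] at h9
  rw [← e₆, f₂, h8, h9] at e₇
  exact Subtype.ext e₇

end Ladder

end TopLocalGroupoid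

end TopologicalPart

/-! ### Submersions, through maps that are smooth near a point, and finite powers of a manifold. -/

section ManifoldPart
open Filter

/-! ### Maps which are smooth near a point -/

section SmoothNear

variable {E H N E' H' P E'' H'' R : Type*}
  [NormedAddCommGroup E] [NormedSpace ℝ E] [TopologicalSpace H]
  [NormedAddCommGroup E'] [NormedSpace ℝ E'] [TopologicalSpace H']
  [NormedAddCommGroup E''] [NormedSpace ℝ E''] [TopologicalSpace H'']
  [TopologicalSpace N] [ChartedSpace H N] [TopologicalSpace P] [ChartedSpace H' P]
  [TopologicalSpace R] [ChartedSpace H'' R]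
  {I : ModelWithCorners ℝ E H} {I' : ModelWithCorners ℝ E' H'} {I'' : ModelWithCorners ℝ E'' H''}

/-- `f` is smooth in a neighbourhood of `p`. -/
def SmoothNear (I : ModelWithCorners ℝ E H) (I' : ModelWithCorners ℝ E' H') (f : N → P) (p : N) :
    Prop :=
  ∀ᶠ q in 𝓝 p, ContMDiffAt I I' ∞ f q

theorem SmoothNear.contMDiffAt {f : N → P} {p : N} (h : SmoothNear I I' f p) :
    ContMDiffAt I I' ∞ f p := h.self_of_nhds

theorem SmoothNear.mdifferentiableAt {f : N → P} {p : N} (h : SmoothNear I I' f p) :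
    MDifferentiableAt I I' f p := h.contMDiffAt.mdifferentiableAt (by simp)

theorem SmoothNear.tendsto {f : N → P} {p : N} (h : SmoothNear I I' f p) :
    Tendsto f (𝓝 p) (𝓝 (f p)) := h.contMDiffAt.continuousAt

theorem ContMDiff.smoothNear {f : N → P} (h : ContMDiff I I' ∞ f) (p : N) :
    SmoothNear I I' f p := Eventually.of_forall fun q => h q

theorem ContMDiffOn.smoothNear {f : N → P} {s : Set N} {p : N} (h : ContMDiffOn I I' ∞ f s)
    (hs : s ∈ 𝓝 p) : SmoothNear I I' f p := by
  filter_upwards [eventually_mem_nhds_iff.2 hs] with q hq using h.contMDiffAt hq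

theorem SmoothNear.comp {g : P → R} {f : N → P} {p : N} (hg : SmoothNear I' I'' g (f p))
    (hf : SmoothNear I I' f p) : SmoothNear I I'' (fun q => g (f q)) p := by
  filter_upwards [hf, hf.tendsto.eventually hg] with q h1 h2 using h2.comp q h1

theorem SmoothNear.comp_of_eq {g : P → R} {f : N → P} {p : N} {r : P}
    (hg : SmoothNear I' I'' g r) (hf : SmoothNear I I' f p) (h : f p = r) :
    SmoothNear I I'' (fun q => g (f q)) p := by
  subst h; exact hg.comp hf

theorem SmoothNear.congr {f g : N → P} {p : N} (hf : SmoothNear I I' f p)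
    (h : ∀ᶠ q in 𝓝 p, g q = f q) : SmoothNear I I' g p := by
  filter_upwards [hf, h.eventually_nhds] with q h1 h2 using h1.congr_of_eventuallyEq h2

theorem SmoothNear.prodMk {f : N → P} {g : N → R} {p : N} (hf : SmoothNear I I' f p)
    (hg : SmoothNear I I'' g p) : SmoothNear I (I'.prod I'') (fun q => (f q, g q)) p := by
  filter_upwards [hf, hg] with q h1 h2 using h1.prodMk h2

theorem smoothNear_const (c : P) (p : N) : SmoothNear I I' (fun _ => c) p :=
  contMDiff_const.smoothNear p

theorem smoothNear_id (p : N) : SmoothNear I I (fun q => q) p :=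
  contMDiff_id.smoothNear p

theorem SmoothNear.eventually {f : N → P} {p : N} (h : SmoothNear I I' f p) :
    ∀ᶠ q in 𝓝 p, SmoothNear I I' f q := h.eventually_nhds

/-- The chain rule for `f ∘ r`, where `f` is differentiable along a set into which `r` maps. -/
theorem mfderiv_comp_of_eventually_mem {f : N → P} {S : Set N} {r : R → N} {q : R} {x : N}
    (hf : MDifferentiableWithinAt I I' f S x) (hr : MDifferentiableAt I'' I r q) (hx : r q = x)
    (hS : ∀ᶠ q' in 𝓝 q, r q' ∈ S) (ζ : E'') :
    (mfderiv I'' I' (fun q' => f (r q')) q ζ : E') =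
      (mfderivWithin I I' f S x (mfderiv I'' I r q ζ : E) : E') := by
  subst hx
  have h := hf.hasMFDerivWithinAt.comp q (hr.hasMFDerivAt.hasMFDerivWithinAt (s := r ⁻¹' S))
    (fun _ h => h)
  exact congrArg (fun L : E'' →L[ℝ] E' => L ζ) (h.hasMFDerivAt hS).mfderiv

/-- A map with a differentiable right inverse near `f p` has surjective differential at `p`. -/
theorem surjective_mfderiv_of_section {f : N → P} {σ : P → N} {p : N}
    (hf : MDifferentiableAt I I' f p) {m : P} (hσ : MDifferentiableAt I' I σ m) (hp : σ m = p)
    (h : ∀ᶠ m' in 𝓝 m, f (σ m') = m') : Function.Surjective (mfderiv I I' f p) := by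
  subst hp
  have h1 : HasMFDerivAt I' I' (f ∘ σ) m ((mfderiv I I' f (σ m)).comp (mfderiv I' I σ m)) :=
    hf.hasMFDerivAt.comp m hσ.hasMFDerivAt
  have h2 : HasMFDerivAt I' I' (f ∘ σ) m (ContinuousLinearMap.id ℝ (TangentSpace I' m)) :=
    (hasMFDerivAt_id m).congr_of_eventuallyEq h
  have h3 := hasMFDerivAt_unique h1 h2
  intro ζ
  exact ⟨mfderiv I' I σ m ζ, congrArg (fun L : E' →L[ℝ] E' => L ζ) h3⟩

/-- Near a point where its differential is onto, a map looks like a projection. -/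
theorem SmoothNear.exists_adapted_chart [FiniteDimensional ℝ E] [FiniteDimensional ℝ E']
    [I.Boundaryless] [I'.Boundaryless] [IsManifold I ∞ N] [IsManifold I' ∞ P]
    {f : N → P} {p : N} (hf : SmoothNear I I' f p)
    (hs : Function.Surjective (mfderiv I I' f p)) :
    ∃ (K : Submodule ℝ E) (κ : N → K) (ψ : P × K → N),
      Module.finrank ℝ E' + Module.finrank ℝ K = Module.finrank ℝ E ∧
      SmoothNear I 𝓘(ℝ, K) κ p ∧ SmoothNear (I'.prod 𝓘(ℝ, K)) I ψ (f p, κ p) ∧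
      (∀ᶠ z in 𝓝 (f p, κ p), f (ψ z) = z.1 ∧ κ (ψ z) = z.2) ∧
      ∀ᶠ q in 𝓝 p, ψ (f q, κ q) = q := by
  set φ := extChartAt I p with hφ
  set φ' := extChartAt I' (f p) with hφ'
  set F : E → E' := fun x => φ' (f (φ.symm x)) with hF
  have hφs : SmoothNear I 𝓘(ℝ, E) φ p :=
    (contMDiffOn_extChartAt (I := I) (x := p)).smoothNear (chart_source_mem_nhds H p)
  have hφ's : SmoothNear I' 𝓘(ℝ, E') φ' (f p) :=
    (contMDiffOn_extChartAt (I := I') (x := f p)).smoothNear (chart_source_mem_nhds H' (f p))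
  have hφi : SmoothNear 𝓘(ℝ, E) I φ.symm (φ p) :=
    (contMDiffOn_extChartAt_symm (I := I) p).smoothNear (extChartAt_target_mem_nhds p)
  have hpp : φ.symm (φ p) = p := extChartAt_to_inv p
  have hFs : SmoothNear 𝓘(ℝ, E) 𝓘(ℝ, E') F (φ p) :=
    hφ's.comp_of_eq (hf.comp_of_eq hφi hpp) (by rw [hpp])
  set A : E →L[ℝ] E' := fderiv ℝ F (φ p) with hA
  have hAs : Function.Surjective A := by
    have h1 : mfderiv I I' f p = A := by
      rw [hf.mdifferentiableAt.mfderiv, I.range_eq_univ, fderivWithin_univ]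
      rfl
    rwa [h1] at hs
  have hAr : A.range = ⊤ := LinearMap.range_eq_top.2 hAs
  -- A projection onto the kernel of the differential `A` completes `F` to a map `Θ = (F, π)` with
  -- invertible differential `(A, π)`, to which the inverse function theorem applies.
  obtain ⟨π, hπ⟩ := Submodule.ClosedComplemented.of_finiteDimensional (𝕜 := ℝ) A.ker
  have hdim : Module.finrank ℝ E' + Module.finrank ℝ A.ker = Module.finrank ℝ E := by
    rw [← LinearMap.finrank_range_add_finrank_ker (A : E →ₗ[ℝ] E')]
    congr 1
    exact (finrank_top ℝ E' ▸ congrArg (fun S : Submodule ℝ E' => Module.finrank ℝ S) hAr.symm :)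
  have hbij : Function.Bijective (A.prod π) := by
    have hinj : Function.Injective (A.prod π) := by
      rw [injective_iff_map_eq_zero]
      intro x hx
      have hx1 : A x = 0 := congrArg Prod.fst hx
      have hx2 : π x = 0 := congrArg Prod.snd hx
      have := hπ ⟨x, hx1⟩
      rw [hx2] at this
      exact (congrArg Subtype.val this).symm
    refine ⟨hinj, ?_⟩
    exact (LinearMap.injective_iff_surjective_of_finrank_eq_finrank
      (f := (A.prod π : E →ₗ[ℝ] E' × A.ker)) (by rw [Module.finrank_prod, hdim])).1 hinj
  let L : E ≃L[ℝ] E' × A.ker :=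
    (LinearEquiv.ofBijective (A.prod π : E →ₗ[ℝ] E' × A.ker) hbij).toContinuousLinearEquiv
  have hLe : (L : E →L[ℝ] E' × A.ker) = A.prod π := by ext x <;> rfl
  set Θ : E → E' × A.ker := fun x => (F x, π x) with hΘ
  have hΘs : ∀ᶠ x in 𝓝 (φ p), ContDiffAt ℝ ∞ Θ x := by
    filter_upwards [hFs] with x hx
    exact hx.contDiffAt.prodMk π.contDiff.contDiffAt
  have hΘd : HasFDerivAt Θ (L : E →L[ℝ] E' × A.ker) (φ p) := by
    rw [hLe]
    exact ((hFs.contMDiffAt.contDiffAt.differentiableAt (by simp)).hasFDerivAt).prodMk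
      π.hasFDerivAt
  set e := hΘs.self_of_nhds.toOpenPartialHomeomorph Θ hΘd (by simp) with he
  have hex : ∀ x, e x = Θ x := fun x => rfl
  have hsrc : φ p ∈ e.source :=
    hΘs.self_of_nhds.mem_toOpenPartialHomeomorph_source hΘd (by simp)
  -- Smoothness of the inverse at a point requires an invertible differential there. Invertibility
  -- is an open condition, so the inverse is smooth on a whole neighbourhood of `Θ (φ p)`.
  have hinv : ∀ᶠ x in 𝓝 (φ p), ∃ L' : E ≃L[ℝ] E' × A.ker,
      HasFDerivAt Θ (L' : E →L[ℝ] E' × A.ker) x := by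
    have hc : ContinuousAt (fderiv ℝ Θ) (φ p) :=
      (hΘs.self_of_nhds.fderiv_right (m := 0) (by simp)).continuousAt
    have h1 := hc.tendsto.eventually (p := fun T => T ∈ Set.range
      ((↑) : (E ≃L[ℝ] E' × A.ker) → E →L[ℝ] E' × A.ker)) (by
        rw [hΘd.fderiv]; exact L.nhds)
    filter_upwards [h1, hΘs] with x ⟨L', hL'⟩ hx
    exact ⟨L', hL' ▸ (hx.differentiableAt (by simp)).hasFDerivAt⟩
  have hes : SmoothNear 𝓘(ℝ, E' × A.ker) 𝓘(ℝ, E) e.symm (Θ (φ p)) := by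
    have h1 : Tendsto e.symm (𝓝 (e (φ p))) (𝓝 (φ p)) := e.tendsto_symm hsrc
    filter_upwards [h1.eventually hinv, h1.eventually hΘs,
      e.open_target.mem_nhds (e.map_source hsrc)] with z ⟨L', hL'⟩ h2 h3
    exact (e.contDiffAt_symm h3 hL' h2).contMDiffAt
  have hesp : e.symm (Θ (φ p)) = φ p := e.left_inv hsrc
  have hΘp : Θ (φ p) = (φ' (f p), π (φ p)) := by simp only [hΘ, hF, hpp]
  refine ⟨A.ker, fun q => π (φ q), fun z => φ.symm (e.symm (φ' z.1, z.2)), hdim, ?_, ?_, ?_, ?_⟩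
  · exact SmoothNear.comp (g := π) (π.contMDiff.smoothNear _) hφs
  · have h1 : SmoothNear (I'.prod 𝓘(ℝ, A.ker)) 𝓘(ℝ, E' × A.ker)
        (fun z : P × A.ker => (φ' z.1, z.2)) (f p, π (φ p)) := by
      have h2 : SmoothNear (I'.prod 𝓘(ℝ, A.ker)) 𝓘(ℝ, E') (fun z : P × A.ker => φ' z.1)
          (f p, π (φ p)) := SmoothNear.comp (g := φ') (f := Prod.fst) hφ's
            (contMDiff_fst.smoothNear _)
      filter_upwards [h2] with z hz using hz.prodMk_space contMDiffAt_snd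
    exact hφi.comp_of_eq (hes.comp_of_eq h1 hΘp.symm) (by rw [← hΘp, hesp])
  · have h1 : Tendsto (fun z : P × A.ker => (φ' z.1, z.2)) (𝓝 (f p, π (φ p)))
        (𝓝 (Θ (φ p))) := by
      rw [hΘp]
      exact (hφ's.tendsto.comp (continuous_fst.tendsto (f p, π (φ p)))).prodMk_nhds (continuous_snd.tendsto (f p, π (φ p)))
    have h2 : Tendsto e.symm (𝓝 (Θ (φ p))) (𝓝 (φ p)) := e.tendsto_symm hsrc
    have h3 : Tendsto (fun x => f (φ.symm x)) (𝓝 (φ p)) (𝓝 (f p)) := by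
      have := hf.tendsto.comp (hpp ▸ hφi.tendsto)
      exact this
    have h4 : ∀ᶠ z : P × A.ker in 𝓝 (f p, π (φ p)), z.1 ∈ φ'.source :=
      continuousAt_fst.tendsto.eventually (extChartAt_source_mem_nhds (I := I') (f p))
    filter_upwards [h1.eventually (e.open_target.mem_nhds (e.map_source hsrc)),
      (h2.comp h1).eventually (extChartAt_target_mem_nhds (I := I) p),
      (h3.comp (h2.comp h1)).eventually (extChartAt_source_mem_nhds (I := I') (f p)), h4]
      with z h5 h6 h7 h8
    have h9 : Θ (e.symm (φ' z.1, z.2)) = (φ' z.1, z.2) := e.right_inv h5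
    refine ⟨φ'.injOn h7 h8 (congrArg Prod.fst h9), ?_⟩
    have h10 : φ (φ.symm (e.symm (φ' z.1, z.2))) = e.symm (φ' z.1, z.2) := φ.right_inv h6
    rw [h10]
    exact congrArg Prod.snd h9
  · have h1 : ∀ᶠ q in 𝓝 p, φ q ∈ e.source :=
      hφs.tendsto.eventually (e.open_source.mem_nhds hsrc)
    filter_upwards [h1, extChartAt_source_mem_nhds (I := I) p] with q h2 h3
    have h4 : (φ' (f q), π (φ q)) = e (φ q) := by
      rw [hex, hΘ]
      simp only [hF, φ.left_inv h3]
    rw [h4, e.left_inv h2, φ.left_inv h3]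

/-- Local sections of submersions. -/
theorem SmoothNear.exists_section [FiniteDimensional ℝ E] [FiniteDimensional ℝ E']
    [I.Boundaryless] [I'.Boundaryless] [IsManifold I ∞ N] [IsManifold I' ∞ P]
    {f : N → P} {p : N} (hf : SmoothNear I I' f p)
    (hs : Function.Surjective (mfderiv I I' f p)) :
    ∃ σ : P → N, SmoothNear I' I σ (f p) ∧ σ (f p) = p ∧ ∀ᶠ m in 𝓝 (f p), f (σ m) = m := by
  obtain ⟨K, κ, ψ, -, -, hψ, h1, h2⟩ := hf.exists_adapted_chart hs
  refine ⟨fun m => ψ (m, κ p), ?_, h2.self_of_nhds, ?_⟩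
  · exact SmoothNear.comp (g := ψ) (f := fun m => (m, κ p)) hψ
      ((smoothNear_id _).prodMk (smoothNear_const _ _))
  · have : Tendsto (fun m => (m, κ p)) (𝓝 (f p)) (𝓝 (f p, κ p)) :=
      tendsto_id.prodMk_nhds tendsto_const_nhds
    exact (this.eventually h1).mono fun m hm => hm.1

/-- Local smooth retractions onto the fibres of a submersion. -/
theorem SmoothNear.exists_fiber_retraction [FiniteDimensional ℝ E] [FiniteDimensional ℝ E']
    [I.Boundaryless] [I'.Boundaryless] [IsManifold I ∞ N] [IsManifold I' ∞ P]
    {f : N → P} {p : N} (hf : SmoothNear I I' f p)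
    (hs : Function.Surjective (mfderiv I I' f p)) :
    ∃ ρ : P × N → N, SmoothNear (I'.prod I) I ρ (f p, p) ∧
      (∀ᶠ z in 𝓝 (f p, p), f (ρ z) = z.1) ∧ ∀ᶠ q in 𝓝 p, ρ (f q, q) = q := by
  obtain ⟨K, κ, ψ, -, hκ, hψ, h1, h2⟩ := hf.exists_adapted_chart hs
  have h3 : SmoothNear (I'.prod I) (I'.prod 𝓘(ℝ, K)) (fun z : P × N => (z.1, κ z.2)) (f p, p) :=
    (contMDiff_fst.smoothNear _).prodMk
      (SmoothNear.comp (g := κ) (f := Prod.snd) hκ (contMDiff_snd.smoothNear _))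
  exact ⟨fun z => ψ (z.1, κ z.2), SmoothNear.comp (g := ψ) hψ h3,
    (h3.tendsto.eventually h1).mono fun m hm => hm.1, h2⟩

end SmoothNear

/-! ### Finite powers of a manifold -/

section Pi

variable {E G : Type*} [NormedAddCommGroup E] [NormedSpace ℝ E] [TopologicalSpace G]
  [ChartedSpace E G] {n : ℕ}
  {E' H' P : Type*} [NormedAddCommGroup E'] [NormedSpace ℝ E'] [TopologicalSpace H']
  [TopologicalSpace P] [ChartedSpace H' P] {I' : ModelWithCorners ℝ E' H'}

instance boundaryless_pi :
    (ModelWithCorners.pi fun _ : Fin n => 𝓘(ℝ, E)).Boundaryless :=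
  ⟨by
    refine Set.eq_univ_of_forall fun x => ⟨x, ?_⟩
    rfl⟩

theorem contMDiffAt_pi_mk {f : P → Fin n → G} {p : P}
    (hf : ∀ i, ContMDiffAt I' 𝓘(ℝ, E) ∞ (fun q => f q i) p) :
    ContMDiffAt I' (ModelWithCorners.pi fun _ : Fin n => 𝓘(ℝ, E)) ∞ f p := by
  rw [contMDiffAt_iff]
  refine ⟨continuousAt_pi.2 fun i => (hf i).continuousAt, ?_⟩
  rw [contDiffWithinAt_pi]
  exact fun i => (contMDiffAt_iff.1 (hf i)).2

theorem writtenInExtChartAt_eval (w : Fin n → G) (i : Fin n) :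
    ∀ᶠ v in 𝓝 (extChartAt (ModelWithCorners.pi fun _ : Fin n => 𝓘(ℝ, E)) w w),
      writtenInExtChartAt (ModelWithCorners.pi fun _ : Fin n => 𝓘(ℝ, E)) 𝓘(ℝ, E) w
        (fun q => q i) v = v i := by
  have h : ∀ᶠ x in 𝓝 (extChartAt 𝓘(ℝ, E) (w i) (w i)), x ∈ (extChartAt 𝓘(ℝ, E) (w i)).target :=
    extChartAt_target_mem_nhds (w i)
  have h' : Tendsto (fun v : Fin n → E => v i)
      (𝓝 (extChartAt (ModelWithCorners.pi fun _ : Fin n => 𝓘(ℝ, E)) w w))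
      (𝓝 (extChartAt 𝓘(ℝ, E) (w i) (w i))) := (continuous_apply i).continuousAt
  filter_upwards [h'.eventually h] with v hv
  exact (extChartAt 𝓘(ℝ, E) (w i)).right_inv hv

theorem hasMFDerivAt_eval (w : Fin n → G) (i : Fin n) :
    HasMFDerivAt (ModelWithCorners.pi fun _ : Fin n => 𝓘(ℝ, E)) 𝓘(ℝ, E)
      (fun q : Fin n → G => q i) w (ContinuousLinearMap.proj (R := ℝ) (φ := fun _ => E) i) := by
  refine ⟨(continuous_apply i).continuousAt, ?_⟩
  refine HasFDerivWithinAt.congr_of_eventuallyEq (f := fun v : Fin n → E => v i)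
    (hasFDerivWithinAt_apply (𝕜 := ℝ) i _ _) ?_ ?_
  · exact nhdsWithin_le_nhds (writtenInExtChartAt_eval w i)
  · exact (writtenInExtChartAt_eval w i).self_of_nhds

theorem contMDiff_eval (i : Fin n) :
    ContMDiff (ModelWithCorners.pi fun _ : Fin n => 𝓘(ℝ, E)) 𝓘(ℝ, E) ∞
      (fun q : Fin n → G => q i) := by
  intro w
  rw [contMDiffAt_iff]
  refine ⟨(continuous_apply i).continuousAt, ?_⟩
  refine ContDiffWithinAt.congr_of_eventuallyEq (f := fun v : Fin n → E => v i)
    (contDiff_apply ℝ E i).contDiffWithinAt ?_ ?_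
  · exact nhdsWithin_le_nhds (writtenInExtChartAt_eval w i)
  · exact (writtenInExtChartAt_eval w i).self_of_nhds

theorem mfderiv_pi_apply {f : P → Fin n → G} {p : P}
    (hf : MDifferentiableAt I' (ModelWithCorners.pi fun _ : Fin n => 𝓘(ℝ, E)) f p)
    (i : Fin n) (ζ : TangentSpace I' p) :
    (mfderiv I' (ModelWithCorners.pi fun _ : Fin n => 𝓘(ℝ, E)) f p ζ : Fin n → E) i =
      (mfderiv I' 𝓘(ℝ, E) (fun q => f q i) p ζ : E) := by
  have h := (hasMFDerivAt_eval (E := E) (f p) i).comp p hf.hasMFDerivAt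
  have h' := h.mfderiv
  exact (congrArg (fun L : E' →L[ℝ] E => L ζ) h').symm

instance isManifold_pi [IsManifold 𝓘(ℝ, E) ∞ G] :
    IsManifold (ModelWithCorners.pi fun _ : Fin n => 𝓘(ℝ, E)) ∞ (Fin n → G) := by
  apply isManifold_of_contDiffOn
  rintro _ _ ⟨e, he, rfl⟩ ⟨e', he', rfl⟩
  rw [contDiffOn_pi]
  intro i
  have hc := StructureGroupoid.compatible (contDiffGroupoid ∞ 𝓘(ℝ, E)) (he i trivial)
    (he' i trivial)
  obtain ⟨h, -⟩ := hc
  have h' : ContDiffOn ℝ ∞ (𝓘(ℝ, E) ∘ ((e i).symm ≫ₕ e' i) ∘ 𝓘(ℝ, E).symm)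
    (𝓘(ℝ, E).symm ⁻¹' ((e i).symm ≫ₕ e' i).source ∩ Set.range 𝓘(ℝ, E)) := h
  refine h'.comp (contDiff_apply ℝ E i).contDiffOn ?_
  intro v hv
  refine ⟨⟨hv.1.1 i trivial, hv.1.2 i trivial⟩, ?_⟩
  simp

end Pi

end ManifoldPart

/-! ### Smooth sections of multiplication, and classes of words represented by lists. -/

section LocalLieGroupoidPart
set_option linter.unusedSectionVars false
open Filter Relation

namespace LocalLieGroupoid

section Words

variable {E F G M : Type*}
  [NormedAddCommGroup E] [NormedSpace ℝ E] [NormedAddCommGroup F] [NormedSpace ℝ F]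
  [TopologicalSpace G] [ChartedSpace E G] [TopologicalSpace M] [ChartedSpace F M]
  {𝒢 : LocalLieGroupoid E F G M}

theorem composable {g h : G} (hgh : (g, h) ∈ 𝒢.mulDom) : 𝒢.src g = 𝒢.tgt h := by
  obtain ⟨O, -, hO⟩ := 𝒢.mulDom_open
  rw [hO] at hgh
  exact hgh.2

section Fiberwise

variable {EQ HQ Q : Type*} [NormedAddCommGroup EQ] [NormedSpace ℝ EQ] [TopologicalSpace HQ]
  [TopologicalSpace Q] [ChartedSpace HQ Q] {I : ModelWithCorners ℝ EQ HQ} {q₀ : Q}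

theorem smoothNear_src {f : Q → G} (hf : SmoothNear I 𝓘(ℝ, E) f q₀) :
    SmoothNear I 𝓘(ℝ, F) (fun q => 𝒢.src (f q)) q₀ :=
  SmoothNear.comp (g := 𝒢.src) (𝒢.src_smooth.smoothNear _) hf

theorem smoothNear_tgt {f : Q → G} (hf : SmoothNear I 𝓘(ℝ, E) f q₀) :
    SmoothNear I 𝓘(ℝ, F) (fun q => 𝒢.tgt (f q)) q₀ :=
  SmoothNear.comp (g := 𝒢.tgt) (𝒢.tgt_smooth.smoothNear _) hf

theorem smoothNear_unit {f : Q → M} (hf : SmoothNear I 𝓘(ℝ, F) f q₀) :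
    SmoothNear I 𝓘(ℝ, E) (fun q => 𝒢.unit (f q)) q₀ :=
  SmoothNear.comp (g := 𝒢.unit) (𝒢.unit_smooth.smoothNear _) hf

theorem smoothNear_inv {f : Q → G} (hf : SmoothNear I 𝓘(ℝ, E) f q₀) (h : f q₀ ∈ 𝒢.invDom) :
    SmoothNear I 𝓘(ℝ, E) (fun q => 𝒢.inv (f q)) q₀ :=
  SmoothNear.comp (g := 𝒢.inv) (𝒢.inv_smooth.smoothNear (𝒢.invDom_open.mem_nhds h)) hf

theorem eventually_mem_mulDom {f g : Q → G} (hf : SmoothNear I 𝓘(ℝ, E) f q₀)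
    (hg : SmoothNear I 𝓘(ℝ, E) g q₀) (h₀ : (f q₀, g q₀) ∈ 𝒢.mulDom)
    (h : ∀ᶠ q in 𝓝 q₀, 𝒢.src (f q) = 𝒢.tgt (g q)) :
    ∀ᶠ q in 𝓝 q₀, (f q, g q) ∈ 𝒢.mulDom := by
  obtain ⟨O, hO, e⟩ := 𝒢.mulDom_open
  rw [e] at h₀ ⊢
  filter_upwards [(hf.tendsto.prodMk_nhds hg.tendsto) (hO.mem_nhds h₀.1), h] with i h1 h2
    using ⟨h1, h2⟩

/-- Multiplication is smooth only along 𝒰, which need not be open in `G × G`. Composability for all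
nearby parameters keeps the pair inside 𝒰, and smoothness along 𝒰 is then enough. -/
theorem smoothNear_mul {f g : Q → G} (hf : SmoothNear I 𝓘(ℝ, E) f q₀)
    (hg : SmoothNear I 𝓘(ℝ, E) g q₀) (h₀ : (f q₀, g q₀) ∈ 𝒢.mulDom)
    (h : ∀ᶠ q in 𝓝 q₀, 𝒢.src (f q) = 𝒢.tgt (g q)) :
    SmoothNear I 𝓘(ℝ, E) (fun q => 𝒢.mul (f q) (g q)) q₀ := by
  filter_upwards [hf, hg, (𝒢.eventually_mem_mulDom hf hg h₀ h).eventually_nhds] with q h1 h2 h3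
  have h4 := 𝒢.mul_submersion.1 (f q, g q) h3.self_of_nhds
  have h5 := ContMDiffWithinAt.comp q h4
    ((h1.prodMk h2).contMDiffWithinAt (s := {q | (f q, g q) ∈ 𝒢.mulDom})) (fun _ h => h)
  exact h5.contMDiffAt h3

variable [FiniteDimensional ℝ E] [FiniteDimensional ℝ F]
  [IsManifold 𝓘(ℝ, E) ∞ G] [IsManifold 𝓘(ℝ, F) ∞ M]

/-- Adjusting the source of a family of arrows. -/
theorem exists_src_adjustment (f : Q → G) (a : Q → M) (hf : SmoothNear I 𝓘(ℝ, E) f q₀)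
    (ha : SmoothNear I 𝓘(ℝ, F) a q₀) (h₀ : 𝒢.src (f q₀) = a q₀) :
    ∃ f' : Q → G, SmoothNear I 𝓘(ℝ, E) f' q₀ ∧ (∀ᶠ q in 𝓝 q₀, 𝒢.src (f' q) = a q) ∧
      (∀ᶠ q in 𝓝 q₀, 𝒢.src (f q) = a q → f' q = f q) ∧ ∀ ζ : TangentSpace I q₀,
        (mfderiv I 𝓘(ℝ, F) (fun q => 𝒢.src (f q)) q₀ ζ : F) = mfderiv I 𝓘(ℝ, F) a q₀ ζ →
        (mfderiv I 𝓘(ℝ, E) f' q₀ ζ : E) = mfderiv I 𝓘(ℝ, E) f q₀ ζ := by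
  obtain ⟨ρ, hρ, h1, h2⟩ := (𝒢.src_smooth.smoothNear (f q₀)).exists_fiber_retraction
    (𝒢.src_submersion (f q₀))
  have hs := smoothNear_src (𝒢 := 𝒢) hf
  have haf := ha.prodMk hf
  have hsf := hs.prodMk hf
  have h3 : ∀ᶠ q in 𝓝 q₀, ρ (𝒢.src (f q), f q) = f q := hf.tendsto.eventually h2
  have he : (a q₀, f q₀) = (𝒢.src (f q₀), f q₀) := by rw [h₀]
  refine ⟨fun q => ρ (a q, f q), hρ.comp_of_eq haf he, ?_, ?_, ?_⟩
  · have := haf.tendsto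
    rw [he] at this
    exact this.eventually h1
  · filter_upwards [h3] with q hq hq'
    rw [← hq', hq]
  -- Differentiating `ρ (a, f)` and the identity `f = ρ (src f, f)` gives the values of `dρ` on `(da
  -- ζ, df ζ)` and on `(d(src f) ζ, df ζ)`, and by `hζ` these two vectors coincide.
  · intro ζ hζ
    have e1 : HasMFDerivAt I 𝓘(ℝ, E) (fun q => ρ (a q, f q)) q₀
        ((mfderiv (𝓘(ℝ, F).prod 𝓘(ℝ, E)) 𝓘(ℝ, E) ρ (a q₀, f q₀)).comp
          ((mfderiv I 𝓘(ℝ, F) a q₀).prod (mfderiv I 𝓘(ℝ, E) f q₀))) :=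
      HasMFDerivAt.comp q₀ (by rw [he]; exact hρ.mdifferentiableAt.hasMFDerivAt)
        (ha.mdifferentiableAt.hasMFDerivAt.prodMk hf.mdifferentiableAt.hasMFDerivAt)
    have e2 : HasMFDerivAt I 𝓘(ℝ, E) f q₀
        ((mfderiv (𝓘(ℝ, F).prod 𝓘(ℝ, E)) 𝓘(ℝ, E) ρ (𝒢.src (f q₀), f q₀)).comp
          ((mfderiv I 𝓘(ℝ, F) (fun q => 𝒢.src (f q)) q₀).prod (mfderiv I 𝓘(ℝ, E) f q₀))) :=
      (HasMFDerivAt.comp q₀ (hρ.mdifferentiableAt.hasMFDerivAt)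
        (hs.mdifferentiableAt.hasMFDerivAt.prodMk
          hf.mdifferentiableAt.hasMFDerivAt)).congr_of_eventuallyEq
        (h3.mono fun q hq => hq.symm)
    have e3 := congrArg (fun L : EQ →L[ℝ] E => L ζ) e1.mfderiv
    have e4 := congrArg (fun L : EQ →L[ℝ] E => L ζ) e2.mfderiv
    refine e3.trans (Eq.trans ?_ e4.symm)
    change mfderiv (𝓘(ℝ, F).prod 𝓘(ℝ, E)) 𝓘(ℝ, E) ρ (a q₀, f q₀)
      (mfderiv I 𝓘(ℝ, F) a q₀ ζ, mfderiv I 𝓘(ℝ, E) f q₀ ζ) =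
      mfderiv (𝓘(ℝ, F).prod 𝓘(ℝ, E)) 𝓘(ℝ, E) ρ (𝒢.src (f q₀), f q₀)
      (mfderiv I 𝓘(ℝ, F) (fun q => 𝒢.src (f q)) q₀ ζ, mfderiv I 𝓘(ℝ, E) f q₀ ζ)
    have key : ∀ {m m' : M} (_ : m = m') {v v' : F} (_ : v = v') (w : E),
        (mfderiv (𝓘(ℝ, F).prod 𝓘(ℝ, E)) 𝓘(ℝ, E) ρ (m, f q₀) ((v, w) : F × E) : E) =
          mfderiv (𝓘(ℝ, F).prod 𝓘(ℝ, E)) 𝓘(ℝ, E) ρ (m', f q₀) ((v', w) : F × E) := by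
      rintro _ _ rfl _ _ rfl _; rfl
    exact key h₀.symm hζ.symm _

/-- Local smooth sections of multiplication. -/
theorem exists_mul_section {g h : G} (hgh : (g, h) ∈ 𝒢.mulDom) :
    ∃ a b : G → G, SmoothNear 𝓘(ℝ, E) 𝓘(ℝ, E) a (𝒢.mul g h) ∧
      SmoothNear 𝓘(ℝ, E) 𝓘(ℝ, E) b (𝒢.mul g h) ∧ a (𝒢.mul g h) = g ∧ b (𝒢.mul g h) = h ∧
      ∀ᶠ c in 𝓝 (𝒢.mul g h), (a c, b c) ∈ 𝒢.mulDom ∧ 𝒢.mul (a c) (b c) = c := by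
  have hfst : SmoothNear (𝓘(ℝ, E).prod 𝓘(ℝ, E)) 𝓘(ℝ, E) (Prod.fst : G × G → G) (g, h) :=
    contMDiff_fst.smoothNear _
  have hsnd : SmoothNear (𝓘(ℝ, E).prod 𝓘(ℝ, E)) 𝓘(ℝ, E) (Prod.snd : G × G → G) (g, h) :=
    contMDiff_snd.smoothNear _
  have hc := composable hgh
  -- Adjusting the source of the first factor extends multiplication to a neighbourhood in `G × G`.
  -- The adjustment is invisible to first order on vectors tangent to the fibre product, so the
  -- differential remains onto.
  obtain ⟨r, hr, h1, h2, h3⟩ := exists_src_adjustment (𝒢 := 𝒢) (Prod.fst : G × G → G)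
    (fun p => 𝒢.tgt p.2) hfst (smoothNear_tgt hsnd) hc
  have hr₀ : r (g, h) = g := h2.self_of_nhds hc
  have hm₀ : (r (g, h), h) ∈ 𝒢.mulDom := by rwa [hr₀]
  have hmem := 𝒢.eventually_mem_mulDom hr hsnd hm₀ h1
  have hf := 𝒢.smoothNear_mul hr hsnd hm₀ h1
  have hsurj : Function.Surjective (mfderiv (𝓘(ℝ, E).prod 𝓘(ℝ, E)) 𝓘(ℝ, E)
      (fun p : G × G => 𝒢.mul (r p) p.2) (g, h)) := by
    intro ζ
    have hS := 𝒢.mul_submersion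
    obtain ⟨v, hv, e⟩ := hS.2 (g, h) hgh ζ
    refine ⟨v, ?_⟩
    have hch := mfderiv_comp_of_eventually_mem (r := fun p : G × G => (r p, p.2)) (x := (g, h))
      ((hS.1 _ hgh).mdifferentiableWithinAt (by simp))
      (hr.prodMk hsnd).mdifferentiableAt (by rw [hr₀]) hmem v
    refine hch.trans (Eq.trans ?_ e)
    have e1 : (mfderiv (𝓘(ℝ, E).prod 𝓘(ℝ, E)) 𝓘(ℝ, E) r (g, h) v : E) = v.1 := by
      refine (h3 v ?_).trans ?_
      · refine Eq.trans ?_ (hv.trans ?_)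
        · exact congrArg (fun L : E × E →L[ℝ] F => L v) ((𝒢.src_smooth.mdifferentiableAt
            (by simp)).hasMFDerivAt.comp (g, h) (hasMFDerivAt_fst (x := (g, h)))).mfderiv
        · exact (congrArg (fun L : E × E →L[ℝ] F => L v) ((𝒢.tgt_smooth.mdifferentiableAt
            (by simp)).hasMFDerivAt.comp (g, h) (hasMFDerivAt_snd (x := (g, h)))).mfderiv).symm
      · exact congrArg (fun L : E × E →L[ℝ] E => L v) (hasMFDerivAt_fst (x := (g, h))).mfderiv
    have e2 : (mfderiv (𝓘(ℝ, E).prod 𝓘(ℝ, E)) (𝓘(ℝ, E).prod 𝓘(ℝ, E))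
        (fun p : G × G => (r p, p.2)) (g, h) v : E × E) = v := by
      have := (hr.mdifferentiableAt.hasMFDerivAt.prodMk (hasMFDerivAt_snd (x := (g, h)))).mfderiv
      refine (congrArg (fun L : E × E →L[ℝ] E × E => L v) this).trans ?_
      exact Prod.ext e1 rfl
    rw [e2]
  obtain ⟨σ, hσ, hσ₀, e⟩ := hf.exists_section hsurj
  simp only [hr₀] at hσ hσ₀ e
  refine ⟨fun c => r (σ c), fun c => (σ c).2, hr.comp_of_eq hσ hσ₀, hsnd.comp_of_eq hσ hσ₀,
    by simp only [hσ₀, hr₀], by simp only [hσ₀], ?_⟩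
  have ht := hσ.tendsto
  rw [hσ₀] at ht
  filter_upwards [e, ht.eventually hmem] with c h4 h5 using ⟨h5, h4⟩

/-! ### The underlying topological local groupoid -/

variable (𝒢) in
/-- The topological local groupoid underlying a 3-associative local Lie groupoid. -/
@[simps]
def toTop (hA : 𝒢.IsThreeAssociative) : TopLocalGroupoid G M where
  src := 𝒢.src
  tgt := 𝒢.tgt
  unit := 𝒢.unit
  mulDom := 𝒢.mulDom
  mul := 𝒢.mul
  invDom := 𝒢.invDom
  inv := 𝒢.inv
  src_unit := 𝒢.src_unit
  tgt_unit := 𝒢.tgt_unit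
  mulDom_open := 𝒢.mulDom_open
  unit_right_mem := 𝒢.mem_mulDom_unit_right
  unit_left_mem := 𝒢.mem_mulDom_unit_left
  continuousOn_mul := 𝒢.mul_submersion.1.continuousOn
  exists_section := by
    intro g h hgh
    obtain ⟨a, b, ha, hb, ha₀, hb₀, e⟩ := 𝒢.exists_mul_section hgh
    exact ⟨a, b, by simpa [ha₀] using ha.tendsto, by simpa [hb₀] using hb.tendsto, e⟩
  src_mul := 𝒢.src_mul
  tgt_mul := 𝒢.tgt_mul
  mul_unit := 𝒢.mul_unit
  unit_mul := 𝒢.unit_mul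
  invDom_open := 𝒢.invDom_open
  unit_mem_invDom := 𝒢.unit_mem_invDom
  mem_mulDom_of_invDom := 𝒢.mem_mulDom_of_invDom
  inv_mem_invDom := 𝒢.inv_mem_invDom
  continuousOn_inv := 𝒢.inv_smooth.continuousOn
  src_inv := 𝒢.src_inv
  tgt_inv := 𝒢.tgt_inv
  inv_mul := 𝒢.inv_mul
  mul_inv := 𝒢.mul_inv
  assoc := hA

variable {hA : 𝒢.IsThreeAssociative}

theorem mem_wordSet_iff {n : ℕ} (w : Fin (n + 1) → G) :
    w ∈ 𝒢.wordSet n ↔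
      (𝒢.toTop hA).IsPath (𝒢.tgt (w 0)) (List.ofFn w) (𝒢.src (w (Fin.last n))) := by
  induction n with
  | zero => simp [wordSet]
  | succ n ih =>
    replace ih := ih (fun i : Fin (n + 1) => w i.succ)
    have h1 : w ∈ 𝒢.wordSet (n + 1) ↔ 𝒢.src (w 0) = 𝒢.tgt (w 1) ∧
        (fun i : Fin (n + 1) => w i.succ) ∈ 𝒢.wordSet n := by
      simp only [wordSet, Set.mem_ofPred_eq, Fin.forall_fin_succ (n := n)]
      rfl
    rw [h1, ih, List.ofFn_succ (f := w)]
    simp only [TopLocalGroupoid.isPath_cons, toTop_tgt, toTop_src, true_and, Fin.succ_last]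
    constructor
    · rintro ⟨e, h⟩
      rw [e]; exact h
    · intro h
      have e : 𝒢.src (w 0) = 𝒢.tgt (w 1) := by
        rw [List.ofFn_succ] at h
        exact h.1.symm
      refine ⟨e, ?_⟩
      rw [e] at h; exact h

theorem Word.isPath (w : 𝒢.Word) : (𝒢.toTop hA).IsPath w.tgt w.letters w.src :=
  (mem_wordSet_iff w.2.1).1 w.2.2

theorem Word.letters_ne_nil (w : 𝒢.Word) : w.letters ≠ [] := by
  simp [Word.letters, List.ofFn_succ]

theorem exists_word {l : List G} (hl : l ≠ []) {y x : M} (h : (𝒢.toTop hA).IsPath y l x) :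
    ∃ w : 𝒢.Word, w.letters = l := by
  cases l with
  | nil => exact absurd rfl hl
  | cons g l =>
    have e : List.ofFn (fun i : Fin (l.length + 1) => (g :: l).get i) = g :: l :=
      List.ofFn_get (g :: l)
    refine ⟨⟨l.length, fun i => (g :: l).get i, ?_⟩, e⟩
    rw [mem_wordSet_iff (hA := hA), e]
    have hy : y = 𝒢.tgt g := h.1.symm
    subst hy
    have h2 : ∀ (l : List G) (g : G) (y : M), (𝒢.toTop hA).IsPath y (g :: l) x →
        𝒢.src ((g :: l).get (Fin.last l.length)) = x := by
      intro l
      induction l with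
      | nil => intro g y h; exact h.2
      | cons g' l ih => intro g y h; exact ih g' _ h.2
    rw [h2 _ _ _ h]
    exact h

theorem Word.ext_letters {w w' : 𝒢.Word} (h : w.letters = w'.letters) : w = w' := by
  obtain ⟨n, w, hw⟩ := w
  obtain ⟨n', w', hw'⟩ := w'
  have hn : n = n' := by simpa [Word.letters] using congrArg List.length h
  subst hn
  have : w = w' := List.ofFn_injective h
  subst this
  rfl

theorem letters_single (g : G) : (𝒢.single g).letters = [g] := by
  simp [Word.letters, single]

theorem contracts_iff {w w' : 𝒢.Word} :
    𝒢.Contracts w w' ↔ (𝒢.toTop hA).Red w.letters w'.letters := by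
  constructor
  · rintro ⟨a, b, g, h, hgh, e, e'⟩
    rw [e, e']
    exact TopLocalGroupoid.Red.mk (T := 𝒢.toTop hA) a b hgh
  · intro h
    obtain ⟨a, b, g, h, hgh, e, e'⟩ := h.exists_eq
    exact ⟨a, b, g, h, hgh, e, e'⟩

variable (𝒢) in
/-- The word with letters `l` represents the class `a`. -/
def Rep (l : List G) (a : 𝒢.AC) : Prop := ∃ w : 𝒢.Word, w.letters = l ∧ 𝒢.toAC w = a

theorem Rep.ne_nil {l : List G} {a : 𝒢.AC} (h : 𝒢.Rep l a) : l ≠ [] := by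
  obtain ⟨w, rfl, -⟩ := h
  exact w.letters_ne_nil

theorem exists_rep (a : 𝒢.AC) : ∃ l, 𝒢.Rep l a := by
  obtain ⟨w, rfl⟩ := Quot.exists_rep a
  exact ⟨_, w, rfl, rfl⟩

theorem exists_rep_of_isPath {l : List G} (hl : l ≠ []) {y x : M}
    (h : (𝒢.toTop hA).IsPath y l x) : ∃ a, 𝒢.Rep l a := by
  obtain ⟨w, hw⟩ := exists_word hl h
  exact ⟨_, w, hw, rfl⟩

theorem Rep.eq {l : List G} {a a' : 𝒢.AC} (h : 𝒢.Rep l a) (h' : 𝒢.Rep l a') : a = a' := by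
  obtain ⟨w, rfl, rfl⟩ := h
  obtain ⟨w', e, rfl⟩ := h'
  rw [Word.ext_letters e]

theorem rep_completion (g : G) : 𝒢.Rep [g] (𝒢.completion g) := ⟨_, letters_single g, rfl⟩

theorem rep_iff_of_red {l l' : List G} (h : (𝒢.toTop hA).Red l l') (a : 𝒢.AC) :
    𝒢.Rep l a ↔ 𝒢.Rep l' a := by
  constructor
  · rintro ⟨w, rfl, rfl⟩
    obtain ⟨w', rfl⟩ := exists_word (h.ne_nil_iff.1 w.letters_ne_nil)
      (h.isPath_iff.1 w.isPath)
    exact ⟨w', rfl, (Quot.sound (contracts_iff.2 h)).symm⟩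
  · rintro ⟨w, rfl, rfl⟩
    obtain ⟨w', rfl⟩ := exists_word (h.ne_nil_iff.2 w.letters_ne_nil)
      (h.isPath_iff.2 w.isPath)
    exact ⟨w', rfl, Quot.sound (contracts_iff.2 h)⟩

theorem rep_iff_of_eqvGen {l l' : List G} (h : EqvGen (𝒢.toTop hA).Red l l') (a : 𝒢.AC) :
    𝒢.Rep l a ↔ 𝒢.Rep l' a := by
  induction h with
  | rel _ _ h => exact rep_iff_of_red h a
  | refl => rfl
  | symm _ _ _ ih => exact ih.symm
  | trans _ _ _ _ _ ih₁ ih₂ => exact ih₁.trans ih₂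

theorem toAC_eq_iff {w w' : 𝒢.Word} :
    𝒢.toAC w = 𝒢.toAC w' ↔ EqvGen (𝒢.toTop hA).Red w.letters w'.letters := by
  constructor
  · intro h
    have h' : EqvGen 𝒢.Contracts w w' := Quot.eqvGen_exact h
    clear h
    induction h' with
    | rel _ _ h => exact .rel _ _ (contracts_iff.1 h)
    | refl => exact .refl _
    | symm _ _ _ ih => exact ih.symm
    | trans _ _ _ _ _ ih₁ ih₂ => exact ih₁.trans _ _ _ ih₂
  · intro h
    exact ((rep_iff_of_eqvGen h _).1 ⟨w, rfl, rfl⟩).eq ⟨w', rfl, rfl⟩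

theorem Rep.eq_iff {l l' : List G} {a a' : 𝒢.AC} (h : 𝒢.Rep l a) (h' : 𝒢.Rep l' a') :
    a = a' ↔ EqvGen (𝒢.toTop hA).Red l l' := by
  obtain ⟨w, rfl, rfl⟩ := h
  obtain ⟨w', rfl, rfl⟩ := h'
  exact toAC_eq_iff

theorem word_src_tgt_eq (hA : 𝒢.IsThreeAssociative) {w w' : 𝒢.Word}
    (h : 𝒢.Contracts w w') : w.tgt = w'.tgt ∧ w.src = w'.src :=
  ((contracts_iff (hA := hA).1 h).isPath_iff.1 w.isPath).eq_and_eq w'.letters_ne_nil w'.isPath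

/-- The source of a class of words. -/
def AC.src (hA : 𝒢.IsThreeAssociative) : 𝒢.AC → M :=
  Quot.lift Word.src fun _ _ h => (word_src_tgt_eq hA h).2

/-- The target of a class of words. -/
def AC.tgt (hA : 𝒢.IsThreeAssociative) : 𝒢.AC → M :=
  Quot.lift Word.tgt fun _ _ h => (word_src_tgt_eq hA h).1

theorem Rep.isPath {l : List G} {a : 𝒢.AC} (h : 𝒢.Rep l a) :
    (𝒢.toTop hA).IsPath (AC.tgt hA a) l (AC.src hA a) := by
  obtain ⟨w, rfl, rfl⟩ := h
  exact w.isPath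

theorem Rep.src_eq {l : List G} {a : 𝒢.AC} (h : 𝒢.Rep l a) {y x : M}
    (h' : (𝒢.toTop hA).IsPath y l x) : AC.src hA a = x :=
  (h.isPath.eq_and_eq h.ne_nil h').2

theorem Rep.tgt_eq {l : List G} {a : 𝒢.AC} (h : 𝒢.Rep l a) {y x : M}
    (h' : (𝒢.toTop hA).IsPath y l x) : AC.tgt hA a = y :=
  (h.isPath.eq_and_eq h.ne_nil h').1

theorem Rep.exists_append {l l' : List G} {a a' : 𝒢.AC} (h : 𝒢.Rep l a) (h' : 𝒢.Rep l' a')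
    (e : AC.src hA a = AC.tgt hA a') : ∃ c, 𝒢.Rep (l ++ l') c := by
  refine exists_rep_of_isPath (hA := hA) (x := AC.src hA a') (by simp [h.ne_nil])
    (TopLocalGroupoid.isPath_append.2 ⟨_, h.isPath, ?_⟩)
  rw [e]
  exact h'.isPath

theorem redStar_of_wordLE {w w' : 𝒢.Word} (h : 𝒢.WordLE w' w) :
    (𝒢.toTop hA).RedStar w.letters w'.letters :=
  ReflTransGen.lift (p := (𝒢.toTop hA).Red) Word.letters (fun _ _ h => contracts_iff.1 h) _ _ h

theorem wordLE_of_redStar {l l' : List G} (h : (𝒢.toTop hA).RedStar l l') {w' : 𝒢.Word}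
    (hw' : w'.letters = l') : ∃ w : 𝒢.Word, w.letters = l ∧ 𝒢.WordLE w' w := by
  induction h using ReflTransGen.head_induction_on with
  | refl => exact ⟨w', hw', ReflTransGen.refl⟩
  | head h _ ih =>
    obtain ⟨w, rfl, hw⟩ := ih
    obtain ⟨w₁, rfl⟩ := exists_word (h.ne_nil_iff.2 w.letters_ne_nil)
      (h.isPath_iff.2 w.isPath)
    exact ⟨w₁, rfl, ReflTransGen.head (contracts_iff.2 h) hw⟩

theorem IsInversional.toTop (h : 𝒢.IsInversional) : (𝒢.toTop hA).Inversional := by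
  intro g
  obtain ⟨w, hw, hle⟩ := h g
  refine ⟨w.letters, hw, ?_⟩
  simpa [letters_single] using redStar_of_wordLE (hA := hA) hle

theorem HasProductsConnectedToAxes.toTop (h : 𝒢.HasProductsConnectedToAxes) :
    (𝒢.toTop hA).ConnectedToAxes := h

theorem mem_assoc_iff {g : G} : g ∈ 𝒢.Assoc ↔ 𝒢.src g = 𝒢.tgt g ∧
    ∃ l, (𝒢.toTop hA).RedStar l [𝒢.unit (𝒢.src g)] ∧ (𝒢.toTop hA).RedStar l [g] := by
  refine and_congr_right fun hg => ⟨?_, ?_⟩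
  · rintro ⟨w, h1, h2⟩
    refine ⟨w.letters, ?_, ?_⟩
    · simpa [letters_single] using redStar_of_wordLE (hA := hA) h1
    · simpa [letters_single] using redStar_of_wordLE (hA := hA) h2
  · rintro ⟨l, h1, h2⟩
    obtain ⟨w, rfl, hw⟩ := wordLE_of_redStar h1 (letters_single _)
    obtain ⟨w', e, hw'⟩ := wordLE_of_redStar h2 (letters_single _)
    exact ⟨w, hw, Word.ext_letters e ▸ hw'⟩

/-- Arrows of `G` with the same class as a unit are associators. -/
theorem mem_assoc_of_completion_eq (hI : 𝒢.IsInversional) (hC : 𝒢.HasProductsConnectedToAxes)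
    (hA : 𝒢.IsThreeAssociative) {g : G} {x : M} (h : 𝒢.completion g = 𝒢.completion (𝒢.unit x)) :
    𝒢.src g = x ∧ 𝒢.tgt g = x ∧ ∃ l, (𝒢.toTop hA).RedStar l [𝒢.unit x] ∧
      (𝒢.toTop hA).RedStar l [g] := by
  have h1 := ((rep_completion g).eq_iff (hA := hA) (rep_completion _)).1 h
  have h2 := (TopLocalGroupoid.eqvGen_isPath_iff h1 (y := 𝒢.tgt g) (x := 𝒢.src g)).1 ⟨rfl, rfl⟩
  simp only [TopLocalGroupoid.isPath_cons, TopLocalGroupoid.isPath_nil, toTop_tgt, toTop_src,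
    𝒢.src_unit, 𝒢.tgt_unit] at h2
  -- Equal classes give only a zigzag of contractions; an associator requires one word that
  -- contracts to both ends.
  obtain ⟨l, h3, h4⟩ := TopLocalGroupoid.exists_common_expansion hI.toTop hC.toTop h1
  exact ⟨h2.2.symm, h2.1.symm, l, h4, h3⟩

end Fiberwise

end Words

end LocalLieGroupoid

end LocalLieGroupoidPart

/-! ### Smooth families of words and their equivalences. -/

section PlotPart
set_option linter.unusedSectionVars false
open Filter Relation

namespace LocalLieGroupoid

section Plots

variable {E F G M : Type*}
  [NormedAddCommGroup E] [NormedSpace ℝ E] [NormedAddCommGroup F] [NormedSpace ℝ F]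
  [TopologicalSpace G] [ChartedSpace E G] [TopologicalSpace M] [ChartedSpace F M]
  {𝒢 : LocalLieGroupoid E F G M}
  [FiniteDimensional ℝ E] [FiniteDimensional ℝ F]
  [IsManifold 𝓘(ℝ, E) ∞ G] [IsManifold 𝓘(ℝ, F) ∞ M] {hA : 𝒢.IsThreeAssociative}
  {EQ HQ Q : Type*} [NormedAddCommGroup EQ] [NormedSpace ℝ EQ] [TopologicalSpace HQ]
  [TopologicalSpace Q] [ChartedSpace HQ Q] {I : ModelWithCorners ℝ EQ HQ} {q₀ : Q}

/-- A contraction of the value at `q₀` of a smooth family of words extends to the family. -/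
theorem exists_smooth_contraction {l l' : List G} (h : (𝒢.toTop hA).Red l l')
    {vs : List (Q → G)} (hvs : ∀ v ∈ vs, SmoothNear I 𝓘(ℝ, E) v q₀) {y x : Q → M}
    (hp : ∀ᶠ q in 𝓝 q₀, (𝒢.toTop hA).IsPath (y q) (vs.evalFun q) (x q))
    (he : vs.evalFun q₀ = l) :
    ∃ vs' : List (Q → G), (∀ v ∈ vs', SmoothNear I 𝓘(ℝ, E) v q₀) ∧ vs'.evalFun q₀ = l' ∧
      ∀ᶠ q in 𝓝 q₀, (𝒢.toTop hA).Red (vs.evalFun q) (vs'.evalFun q) := by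
  induction h generalizing vs y with
  | @head g h l hgh =>
    obtain _ | ⟨v₁, _ | ⟨v₂, vs⟩⟩ := vs
    · simp at he
    · simp at he
    simp only [List.evalFun_cons, List.cons.injEq] at he
    obtain ⟨rfl, rfl, rfl⟩ := he
    have h₁ := hvs v₁ (by simp)
    have h₂ := hvs v₂ (by simp)
    have hc : ∀ᶠ q in 𝓝 q₀, 𝒢.src (v₁ q) = 𝒢.tgt (v₂ q) := hp.mono fun q hq => hq.2.1.symm
    refine ⟨(fun q => 𝒢.mul (v₁ q) (v₂ q)) :: vs, ?_, rfl, ?_⟩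
    · intro v hv
      rcases List.mem_cons.1 hv with rfl | hv
      · exact 𝒢.smoothNear_mul h₁ h₂ hgh hc
      · exact hvs v (by simp [hv])
    · filter_upwards [𝒢.eventually_mem_mulDom h₁ h₂ hgh hc] with q hq
      exact TopLocalGroupoid.Red.head (T := 𝒢.toTop hA) _ hq
  | cons g _ ih =>
    obtain _ | ⟨v, vs⟩ := vs
    · simp at he
    simp only [List.evalFun_cons, List.cons.injEq] at he
    obtain ⟨rfl, he⟩ := he
    obtain ⟨vs', h1, h2, h3⟩ := ih (vs := vs) (fun v hv => hvs v (by simp [hv]))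
      (y := fun q => 𝒢.src (v q)) (hp.mono fun q hq => hq.2) he
    refine ⟨v :: vs', ?_, by simp [h2], h3.mono fun q hq => hq.cons _⟩
    intro v' hv'
    rcases List.mem_cons.1 hv' with rfl | hv'
    exacts [hvs _ (by simp), h1 _ hv']

/-- An expansion of the value at `q₀` of a smooth family of words extends to the family. -/
theorem exists_smooth_expansion {l l' : List G} (h : (𝒢.toTop hA).Red l l')
    {vs' : List (Q → G)} (hvs' : ∀ v ∈ vs', SmoothNear I 𝓘(ℝ, E) v q₀)
    (he : vs'.evalFun q₀ = l') :
    ∃ vs : List (Q → G), (∀ v ∈ vs, SmoothNear I 𝓘(ℝ, E) v q₀) ∧ vs.evalFun q₀ = l ∧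
      ∀ᶠ q in 𝓝 q₀, (𝒢.toTop hA).Red (vs.evalFun q) (vs'.evalFun q) := by
  induction h generalizing vs' with
  | @head g h l hgh =>
    obtain _ | ⟨v, vs⟩ := vs'
    · simp at he
    simp only [List.evalFun_cons, List.cons.injEq] at he
    obtain ⟨hv, rfl⟩ := he
    obtain ⟨a, b, ha, hb, ha₀, hb₀, e⟩ := exists_mul_section (𝒢 := 𝒢) hgh
    have hvs := hvs' v (by simp)
    refine ⟨(fun q => a (v q)) :: (fun q => b (v q)) :: vs, ?_, ?_, ?_⟩
    · intro v' hv'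
      simp only [List.mem_cons] at hv'
      rcases hv' with rfl | rfl | hv'
      · exact ha.comp_of_eq hvs hv
      · exact hb.comp_of_eq hvs hv
      · exact hvs' v' (by simp [hv'])
    · simp only [List.evalFun_cons, hv]
      exact congrArg₂ List.cons ha₀ (congrArg₂ List.cons hb₀ rfl)
    · have ht := hvs.tendsto
      rw [hv] at ht
      filter_upwards [ht.eventually e] with q hq
      have := TopLocalGroupoid.Red.head (T := 𝒢.toTop hA) (vs.evalFun q) hq.1
      simp only [toTop_mul, hq.2] at this
      exact this
  | cons g _ ih =>
    obtain _ | ⟨v, vs⟩ := vs'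
    · simp at he
    simp only [List.evalFun_cons, List.cons.injEq] at he
    obtain ⟨rfl, he⟩ := he
    obtain ⟨vs', h1, h2, h3⟩ := ih (fun v hv => hvs' v (by simp [hv])) he
    refine ⟨v :: vs', ?_, by simp [h2], h3.mono fun q hq => hq.cons _⟩
    intro v' hv'
    rcases List.mem_cons.1 hv' with rfl | hv'
    exacts [hvs' _ (by simp), h1 _ hv']

/-- If the value at `q₀` of a smooth family of words is equivalent to a word `l'`, then the family
is equivalent to a smooth family with value `l'` at `q₀`. -/
theorem exists_smooth_transfer {l l' : List G} (h : EqvGen (𝒢.toTop hA).Red l l')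
    {vs : List (Q → G)} (hvs : ∀ v ∈ vs, SmoothNear I 𝓘(ℝ, E) v q₀) {y x : Q → M}
    (hp : ∀ᶠ q in 𝓝 q₀, (𝒢.toTop hA).IsPath (y q) (vs.evalFun q) (x q))
    (he : vs.evalFun q₀ = l) :
    ∃ vs' : List (Q → G), (∀ v ∈ vs', SmoothNear I 𝓘(ℝ, E) v q₀) ∧ vs'.evalFun q₀ = l' ∧
      ∀ᶠ q in 𝓝 q₀, EqvGen (𝒢.toTop hA).Red (vs.evalFun q) (vs'.evalFun q) := by
  let P : List G → List G → Prop := fun l l' => ∀ vs : List (Q → G),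
    (∀ v ∈ vs, SmoothNear I 𝓘(ℝ, E) v q₀) →
    (∀ᶠ q in 𝓝 q₀, (𝒢.toTop hA).IsPath (y q) (vs.evalFun q) (x q)) → vs.evalFun q₀ = l →
    ∃ vs' : List (Q → G), (∀ v ∈ vs', SmoothNear I 𝓘(ℝ, E) v q₀) ∧ vs'.evalFun q₀ = l' ∧
      ∀ᶠ q in 𝓝 q₀, EqvGen (𝒢.toTop hA).Red (vs.evalFun q) (vs'.evalFun q)
  have htrans : ∀ {a b c}, P a b → P b c → P a c := by
    intro a b c hab hbc vs h1 h2 h3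
    obtain ⟨vs', h4, h5, h6⟩ := hab vs h1 h2 h3
    obtain ⟨vs'', h7, h8, h9⟩ := hbc vs' h4 (by
      filter_upwards [h2, h6] with q h2 h6 using (TopLocalGroupoid.eqvGen_isPath_iff h6).1 h2) h5
    exact ⟨vs'', h7, h8, by filter_upwards [h6, h9] with q h6 h9 using h6.trans _ _ _ h9⟩
  -- Both directions are proved together because the generated relation is symmetric: contractions
  -- extend since the domain is open, expansions by local sections of multiplication.
  suffices P l l' ∧ P l' l from this.1 vs hvs hp he
  clear hvs hp he
  induction h with
  | rel _ _ h =>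
    refine ⟨fun vs h1 h2 h3 => ?_, fun vs h1 h2 h3 => ?_⟩
    · obtain ⟨vs', h4, h5, h6⟩ := exists_smooth_contraction h h1 h2 h3
      exact ⟨vs', h4, h5, h6.mono fun q hq => .rel _ _ hq⟩
    · obtain ⟨vs', h4, h5, h6⟩ := exists_smooth_expansion h h1 h3
      exact ⟨vs', h4, h5, h6.mono fun q hq => (EqvGen.rel _ _ hq).symm⟩
  | refl =>
    exact ⟨fun vs h1 h2 h3 => ⟨vs, h1, h3, Eventually.of_forall fun q => .refl _⟩,
      fun vs h1 h2 h3 => ⟨vs, h1, h3, Eventually.of_forall fun q => .refl _⟩⟩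
  | symm _ _ _ ih => exact ih.symm
  | trans _ _ _ _ _ ih₁ ih₂ => exact ⟨htrans ih₁.1 ih₂.1, htrans ih₂.2 ih₁.2⟩

variable (𝒢) in
/-- The derivatives of a family of strings of arrows in the direction `ζ` are composable, from
`θ` to `η`. -/
def IsTangentPath (I : ModelWithCorners ℝ EQ HQ) (q₀ : Q) (ζ : EQ) : F → List (Q → G) → F → Prop
  | η, [], θ => η = θ
  | η, f :: fs, θ => (mfderiv I 𝓘(ℝ, F) (fun q => 𝒢.tgt (f q)) q₀ ζ : F) = η ∧
      IsTangentPath I q₀ ζ (mfderiv I 𝓘(ℝ, F) (fun q => 𝒢.src (f q)) q₀ ζ : F) fs θ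

/-- A smooth family of strings of arrows which is composable at `q₀` can be corrected to a family
of composable strings. -/
theorem exists_path_correction (fs : List (Q → G)) (hfs : ∀ f ∈ fs, SmoothNear I 𝓘(ℝ, E) f q₀)
    {b : Q → M} (hb : SmoothNear I 𝓘(ℝ, F) b q₀) {y : M}
    (hp : (𝒢.toTop hA).IsPath y (fs.evalFun q₀) (b q₀)) :
    ∃ (fs' : List (Q → G)) (a : Q → M), (∀ f ∈ fs', SmoothNear I 𝓘(ℝ, E) f q₀) ∧
      SmoothNear I 𝓘(ℝ, F) a q₀ ∧ fs'.evalFun q₀ = fs.evalFun q₀ ∧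
      (∀ᶠ q in 𝓝 q₀, (𝒢.toTop hA).IsPath (a q) (fs'.evalFun q) (b q)) ∧
      (∀ᶠ q in 𝓝 q₀, ∀ z, (𝒢.toTop hA).IsPath z (fs.evalFun q) (b q) →
        fs'.evalFun q = fs.evalFun q) ∧
      ∀ (ζ : EQ) (η : F), 𝒢.IsTangentPath I q₀ ζ η fs (mfderiv I 𝓘(ℝ, F) b q₀ ζ : F) →
        (mfderiv I 𝓘(ℝ, F) a q₀ ζ : F) = η ∧ List.Forall₂ (fun f' f =>
          (mfderiv I 𝓘(ℝ, E) f' q₀ ζ : E) = (mfderiv I 𝓘(ℝ, E) f q₀ ζ : E)) fs' fs := by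
  induction fs generalizing y with
  | nil =>
    exact ⟨[], b, by simp, hb, rfl, Eventually.of_forall fun q => rfl,
      Eventually.of_forall fun q _ _ => rfl, fun ζ η h => ⟨Eq.symm h, .nil⟩⟩
  | cons f fs ih =>
    obtain ⟨fs', a, h1, ha, h2, h3, h4, h5⟩ := ih (fun f hf => hfs f (by simp [hf])) hp.2
    have hf := hfs f (by simp)
    have h₀ : 𝒢.src (f q₀) = a q₀ := by
      have := h3.self_of_nhds
      rw [h2] at this
      exact hp.2.left_unique this
    -- The tail has already been corrected, and the target of the corrected tail is prescribed as
    -- the new source of the head.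
    obtain ⟨f', hf', e1, e2, e3⟩ := exists_src_adjustment (𝒢 := 𝒢) f a hf ha h₀
    have hf'₀ : f' q₀ = f q₀ := e2.self_of_nhds h₀
    refine ⟨f' :: fs', fun q => 𝒢.tgt (f' q), ?_, smoothNear_tgt hf', by simp [h2, hf'₀], ?_, ?_, ?_⟩
    · intro g hg
      rcases List.mem_cons.1 hg with rfl | hg
      exacts [hf', h1 g hg]
    · filter_upwards [h3, e1] with q h3 e1
      exact ⟨rfl, by rw [toTop_src, e1]; exact h3⟩
    · filter_upwards [h3, h4, e2] with q h3 h4 e2 z hz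
      have h6 := h4 _ hz.2
      rw [h6] at h3
      simp only [List.evalFun_cons, h6, e2 (hz.2.left_unique h3)]
    · intro ζ η h
      obtain ⟨h6, h7⟩ := h5 ζ _ h.2
      have h8 := e3 ζ h6.symm
      refine ⟨?_, .cons h8 h7⟩
      rw [← h.1]
      have c : ∀ {k : Q → G}, SmoothNear I 𝓘(ℝ, E) k q₀ →
          (mfderiv I 𝓘(ℝ, F) (fun q => 𝒢.tgt (k q)) q₀ ζ : F) =
            (mfderiv 𝓘(ℝ, E) 𝓘(ℝ, F) 𝒢.tgt (k q₀) (mfderiv I 𝓘(ℝ, E) k q₀ ζ : E) : F) := by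
        intro k hk
        exact congrArg (fun L : EQ →L[ℝ] F => L ζ) ((𝒢.tgt_smooth.mdifferentiableAt
          (by simp)).hasMFDerivAt.comp q₀ hk.mdifferentiableAt.hasMFDerivAt).mfderiv
      rw [c hf', c hf, h8, hf'₀]

/-- Two smooth families of words with the same value at `q₀`, all of whose letters are invertible,
differ by a family of arrows close to a unit. -/
theorem exists_smooth_quotient {vs bs : List (Q → G)}
    (hvs : ∀ v ∈ vs, SmoothNear I 𝓘(ℝ, E) v q₀) (hbs : ∀ v ∈ bs, SmoothNear I 𝓘(ℝ, E) v q₀)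
    (he : vs.evalFun q₀ = bs.evalFun q₀) (hinv : ∀ g ∈ bs.evalFun q₀, g ∈ 𝒢.invDom)
    {kn : Q → G} (hkn : SmoothNear I 𝓘(ℝ, E) kn q₀) (hkn₀ : kn q₀ = 𝒢.unit (𝒢.src (kn q₀)))
    {y z : Q → M}
    (hp : ∀ᶠ q in 𝓝 q₀, (𝒢.toTop hA).IsPath (y q) (vs.evalFun q) (𝒢.tgt (kn q)))
    (hp' : ∀ᶠ q in 𝓝 q₀, (𝒢.toTop hA).IsPath (z q) (bs.evalFun q) (𝒢.src (kn q))) :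
    ∃ k : Q → G, SmoothNear I 𝓘(ℝ, E) k q₀ ∧ k q₀ = 𝒢.unit (y q₀) ∧
      ∀ᶠ q in 𝓝 q₀, 𝒢.src (k q) = z q ∧ 𝒢.tgt (k q) = y q ∧
        EqvGen (𝒢.toTop hA).Red (vs.evalFun q ++ [kn q]) (k q :: bs.evalFun q) := by
  induction vs generalizing bs y z with
  | nil =>
    obtain _ | ⟨b, bs⟩ := bs
    swap
    · simp at he
    refine ⟨kn, hkn, ?_, ?_⟩
    · have h1 : y q₀ = 𝒢.tgt (kn q₀) := hp.self_of_nhds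
      rw [h1, hkn₀, 𝒢.tgt_unit]
    · filter_upwards [hp, hp'] with q h1 h2
      exact ⟨Eq.symm h2, Eq.symm h1, .refl _⟩
  | cons v vs ih =>
    obtain _ | ⟨b, bs⟩ := bs
    · simp at he
    simp only [List.evalFun_cons, List.cons.injEq] at he
    obtain ⟨hvb, he⟩ := he
    have hg : b q₀ ∈ 𝒢.invDom := hinv _ (by simp)
    have hv := hvs v (by simp)
    have hb := hbs b (by simp)
    obtain ⟨k₁, hk₁, hk₁₀, e⟩ := ih (bs := bs) (y := fun q => 𝒢.src (v q))
      (z := fun q => 𝒢.src (b q)) (fun v hv => hvs v (by simp [hv]))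
      (fun v hv => hbs v (by simp [hv])) he (fun g hg => hinv g (by simp [hg]))
      (hp.mono fun q hq => hq.2) (hp'.mono fun q hq => hq.2)
    have hm₀ : (v q₀, k₁ q₀) ∈ 𝒢.mulDom := by
      rw [hk₁₀]; exact 𝒢.mem_mulDom_unit_right _
    have hc : ∀ᶠ q in 𝓝 q₀, 𝒢.src (v q) = 𝒢.tgt (k₁ q) := e.mono fun q hq => hq.2.1.symm
    have hvk := 𝒢.smoothNear_mul hv hk₁ hm₀ hc
    have e₁ := 𝒢.eventually_mem_mulDom hv hk₁ hm₀ hc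
    have hvk₀ : 𝒢.mul (v q₀) (k₁ q₀) = b q₀ := by rw [hk₁₀, 𝒢.mul_unit, hvb]
    have hi := smoothNear_inv hb hg
    have hbd : ∀ᶠ q in 𝓝 q₀, b q ∈ 𝒢.invDom := hb.tendsto (𝒢.invDom_open.mem_nhds hg)
    have hgi : (b q₀, 𝒢.inv (b q₀)) ∈ 𝒢.mulDom :=
      𝒢.mem_mulDom_of_invDom _ hg _ (𝒢.inv_mem_invDom _ hg) (𝒢.tgt_inv _ hg).symm
    have hig : (𝒢.inv (b q₀), b q₀) ∈ 𝒢.mulDom :=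
      𝒢.mem_mulDom_of_invDom _ (𝒢.inv_mem_invDom _ hg) _ hg (𝒢.src_inv _ hg)
    have hs : ∀ᶠ q in 𝓝 q₀, 𝒢.src (𝒢.mul (v q) (k₁ q)) = 𝒢.tgt (𝒢.inv (b q)) := by
      filter_upwards [e₁, e, hbd] with q h1 h2 h3
      rw [𝒢.src_mul _ _ h1, h2.1, 𝒢.tgt_inv _ h3]
    -- As in a ladder the new rung is `(v k₁) b⁻¹`, but now the reference letter `b` also varies
    -- with the parameter.
    have hk := 𝒢.smoothNear_mul hvk hi (by rwa [hvk₀]) hs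
    have a := (𝒢.toTop hA).eventually_assoc (f := fun q => 𝒢.mul (v q) (k₁ q))
      (g := fun q => 𝒢.inv (b q)) (h := b) (a := b q₀) (b := 𝒢.inv (b q₀)) (c := b q₀)
      (by have := hvk.tendsto; rwa [hvk₀] at this) hi.tendsto hb.tendsto hgi hig
      (by simp only [toTop_mul, 𝒢.mul_inv _ hg]; exact 𝒢.mem_mulDom_unit_left _)
      (by simp only [toTop_mul, 𝒢.inv_mul _ hg]; exact 𝒢.mem_mulDom_unit_right _) hs
      (hbd.mono fun q hq => 𝒢.src_inv _ hq)
    refine ⟨_, hk, ?_, ?_⟩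
    · rw [hvk₀, 𝒢.mul_inv _ hg, ← hvb]
      exact congrArg _ hp.self_of_nhds.1
    · filter_upwards [a, e, e₁, hbd, hp, hp'] with q a e e₁ hbd hp hp'
      obtain ⟨a₁, a₂, a₃, a₄, a₅⟩ := a
      simp only [toTop_mul, toTop_mulDom] at a₁ a₂ a₃ a₄ a₅
      have hkb : 𝒢.mul (𝒢.mul (𝒢.mul (v q) (k₁ q)) (𝒢.inv (b q))) (b q) =
          𝒢.mul (v q) (k₁ q) := by
        rw [a₅, 𝒢.inv_mul _ hbd, ← e.1, ← 𝒢.src_mul _ _ e₁, 𝒢.mul_unit]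
      refine ⟨?_, ?_, ?_⟩
      · rw [𝒢.src_mul _ _ a₁, 𝒢.src_inv _ hbd]; exact hp'.1
      · rw [𝒢.tgt_mul _ _ a₁, 𝒢.tgt_mul _ _ e₁]; exact hp.1
      · have r₁ := TopLocalGroupoid.eqvGen_append_left [v q] e.2.2
        have r₂ : EqvGen (𝒢.toTop hA).Red (v q :: k₁ q :: bs.evalFun q)
            (𝒢.mul (v q) (k₁ q) :: bs.evalFun q) :=
          .rel _ _ (TopLocalGroupoid.Red.head (T := 𝒢.toTop hA) _ e₁)
        have r₃ := EqvGen.rel _ _ (TopLocalGroupoid.Red.head (T := 𝒢.toTop hA)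
          (bs.evalFun q) a₃)
        simp only [toTop_mul, hkb] at r₃
        exact (r₁.trans _ _ _ r₂).trans _ _ _ r₃.symm

end Plots

end LocalLieGroupoid

end PlotPart

/-! ### Charts of the completion built from words. -/

section WordChartPart
set_option linter.unusedSectionVars false
open Filter Relation

namespace TopLocalGroupoid

variable {G M : Type*} [TopologicalSpace G] [TopologicalSpace M] {T : TopLocalGroupoid G M}

theorem eqvGen_unit_left {l : List G} (hl : l ≠ []) {y x : M} (h : T.IsPath y l x) :
    EqvGen T.Red (T.unit y :: l) l := by
  cases l with
  | nil => exact absurd rfl hl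
  | cons g l =>
    have := Red.head (T := T) l (T.unit_left_mem g)
    rw [T.unit_mul, h.1] at this
    exact .rel _ _ this

theorem eqvGen_unit_right {l : List G} (hl : l ≠ []) {y x : M} (h : T.IsPath y l x) :
    EqvGen T.Red (l ++ [T.unit x]) l := by
  rcases List.eq_nil_or_concat l with rfl | ⟨l, g, rfl⟩
  · exact absurd rfl hl
  · rw [List.concat_eq_append] at h ⊢
    obtain ⟨z, -, -, hz⟩ := isPath_append.1 h
    have := Red.mk (T := T) l [] (T.unit_right_mem g)
    rw [T.mul_unit] at this
    rw [← (hz : T.src g = x), List.append_assoc]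
    exact .rel _ _ this

theorem eqvGen_mul_inv {g : G} (hg : g ∈ T.invDom) :
    EqvGen T.Red [g, T.inv g] [T.unit (T.tgt g)] := by
  have := RedStar.mk (T.mem_mulDom_of_invDom _ hg _ (T.inv_mem_invDom _ hg) (T.tgt_inv _ hg).symm)
  rw [T.mul_inv _ hg] at this
  exact RedStar.eqvGen this

theorem eqvGen_inv_mul {g : G} (hg : g ∈ T.invDom) :
    EqvGen T.Red [T.inv g, g] [T.unit (T.src g)] := by
  have := RedStar.mk (T.mem_mulDom_of_invDom _ (T.inv_mem_invDom _ hg) _ hg (T.src_inv _ hg))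
  rw [T.inv_mul _ hg] at this
  exact RedStar.eqvGen this

/-- Right cancellation of invertible letters. -/
theorem eqvGen_cancel_right {l : List G} (hl : ∀ g ∈ l, g ∈ T.invDom) {a a' : List G}
    (ha : a ≠ []) (ha' : a' ≠ []) {y y' z x : M} (hp : T.IsPath y a z) (hp' : T.IsPath y' a' z)
    (hpl : T.IsPath z l x) (h : EqvGen T.Red (a ++ l) (a' ++ l)) : EqvGen T.Red a a' := by
  induction l generalizing a a' z with
  | nil => simpa using h
  | cons g l ih =>
    obtain ⟨rfl, hpl⟩ := hpl
    have hg := hl g (by simp)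
    have h1 : EqvGen T.Red (a ++ [g]) (a' ++ [g]) := by
      refine ih (fun g' hg' => hl g' (by simp [hg'])) (by simp) (by simp)
        (isPath_append.2 ⟨_, hp, rfl, rfl⟩) (isPath_append.2 ⟨_, hp', rfl, rfl⟩) hpl ?_
      simpa using h
    have h2 := eqvGen_append_right [T.inv g] h1
    simp only [List.append_assoc] at h2
    have h3 : ∀ {b : List G} {y : M}, b ≠ [] → T.IsPath y b (T.tgt g) →
        EqvGen T.Red (b ++ ([g] ++ [T.inv g])) b := fun hb hpb =>
      (eqvGen_append_left _ (eqvGen_mul_inv hg)).trans _ _ _ (eqvGen_unit_right hb hpb)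
    exact ((h3 ha hp).symm.trans _ _ _ h2).trans _ _ _ (h3 ha' hp')

end TopLocalGroupoid

/-- The projections to 𝒜𝒞(G) are defined on tuples, whereas the arguments letter by letter use lists
of functions; this passes from the latter to the former. -/
theorem List.exists_ofFn_evalFun {Q G : Type*} {n : ℕ} (vs : List (Q → G)) (h : vs.length = n) :
    ∃ r : Q → Fin n → G, (∀ q, List.ofFn (r q) = vs.evalFun q) ∧
      ∀ i, (fun q => r q i) ∈ vs := by
  refine ⟨fun q i => vs.get (i.cast h.symm) q, fun q => ?_, fun i => List.get_mem _ _⟩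
  apply List.ext_get
  · simp [List.evalFun, h]
  · intro m h1 h2
    simp [List.evalFun]

namespace LocalLieGroupoid

variable {E F G M : Type*}
  [NormedAddCommGroup E] [NormedSpace ℝ E] [NormedAddCommGroup F] [NormedSpace ℝ F]
  [TopologicalSpace G] [ChartedSpace E G] [TopologicalSpace M] [ChartedSpace F M]
  {𝒢 : LocalLieGroupoid E F G M}
  [FiniteDimensional ℝ E] [FiniteDimensional ℝ F]
  [IsManifold 𝓘(ℝ, E) ∞ G] [IsManifold 𝓘(ℝ, F) ∞ M] {hA : 𝒢.IsThreeAssociative}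
  {EQ HQ Q : Type*} [NormedAddCommGroup EQ] [NormedSpace ℝ EQ] [TopologicalSpace HQ]
  [TopologicalSpace Q] [ChartedSpace HQ Q] {I : ModelWithCorners ℝ EQ HQ} {q₀ : Q}

theorem rep_proj {n : ℕ} {w : Fin (n + 1) → G} (hw : w ∈ 𝒢.wordSet n) :
    𝒢.Rep (List.ofFn w) (𝒢.proj n w) :=
  ⟨⟨n, w, hw⟩, rfl, by simp [proj, hw]⟩

theorem proj_eq_of_rep {n : ℕ} {w : Fin (n + 1) → G} {a : 𝒢.AC}
    (h : 𝒢.Rep (List.ofFn w) a) : w ∈ 𝒢.wordSet n ∧ 𝒢.proj n w = a := by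
  obtain ⟨⟨m, v, hv⟩, e, rfl⟩ := h
  have hn : m = n := by simpa [Word.letters] using congrArg List.length e
  subst hn
  obtain rfl : v = w := List.ofFn_injective e
  exact ⟨hv, by simp [proj, hv]⟩

theorem continuousOn_proj (n : ℕ) : ContinuousOn (𝒢.proj n) (𝒢.wordSet n) := by
  rw [continuousOn_iff_continuous_domRestrict]
  have : (𝒢.wordSet n).domRestrict (𝒢.proj n) = fun w => 𝒢.toAC ⟨n, w⟩ := by
    ext w
    exact (proj_eq_of_rep ⟨⟨n, w⟩, rfl, rfl⟩).2
  rw [this]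
  exact continuous_quot_mk.comp continuous_sigmaMk

theorem isTangentPath_ofFn {m : ℕ} (fs : Fin (m + 1) → Q → G) (ζ : EQ)
    (h : ∀ i : Fin m, (mfderiv I 𝓘(ℝ, F) (fun q => 𝒢.src (fs i.castSucc q)) q₀ ζ : F) =
      (mfderiv I 𝓘(ℝ, F) (fun q => 𝒢.tgt (fs i.succ q)) q₀ ζ : F)) :
    𝒢.IsTangentPath I q₀ ζ (mfderiv I 𝓘(ℝ, F) (fun q => 𝒢.tgt (fs 0 q)) q₀ ζ : F)
      (List.ofFn fs) (mfderiv I 𝓘(ℝ, F) (fun q => 𝒢.src (fs (Fin.last m) q)) q₀ ζ : F) := by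
  induction m with
  | zero => exact ⟨rfl, rfl⟩
  | succ m ih =>
    rw [List.ofFn_succ]
    refine ⟨rfl, ?_⟩
    have := ih (fun i => fs i.succ) fun i => h i.succ
    rw [show (mfderiv I 𝓘(ℝ, F) (fun q => 𝒢.src (fs 0 q)) q₀ ζ : F) = _ from h 0]
    exact this

theorem smoothNear_of_isPath {vs : List (Q → G)} (hne : vs ≠ [])
    (hvs : ∀ v ∈ vs, SmoothNear I 𝓘(ℝ, E) v q₀) {y x : Q → M}
    (hp : ∀ᶠ q in 𝓝 q₀, (𝒢.toTop hA).IsPath (y q) (vs.evalFun q) (x q)) :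
    SmoothNear I 𝓘(ℝ, F) y q₀ ∧ SmoothNear I 𝓘(ℝ, F) x q₀ := by
  constructor
  · obtain _ | ⟨v, vs⟩ := vs
    · exact absurd rfl hne
    · exact (smoothNear_tgt (𝒢 := 𝒢) (hvs v (by simp))).congr (hp.mono fun q hq => hq.1.symm)
  · rcases List.eq_nil_or_concat vs with rfl | ⟨vs, v, rfl⟩
    · exact absurd rfl hne
    · refine (smoothNear_src (𝒢 := 𝒢) (hvs v (by simp))).congr (hp.mono fun q hq => ?_)
      rw [List.concat_eq_append, List.evalFun_append] at hq
      obtain ⟨z, -, -, h⟩ := TopLocalGroupoid.isPath_append.1 hq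
      exact h.symm

/-- The tautological family of words near a given word, extended to nearby tuples. -/
theorem exists_tautological_family (hA : 𝒢.IsThreeAssociative) {n : ℕ} {w : Fin (n + 1) → G}
    (hw : w ∈ 𝒢.wordSet n) :
    ∃ (vs : List ((Fin (n + 1) → G) → G)) (y x : (Fin (n + 1) → G) → M),
      (∀ v ∈ vs, SmoothNear (ModelWithCorners.pi fun _ : Fin (n + 1) => 𝓘(ℝ, E)) 𝓘(ℝ, E) v w) ∧
      vs.evalFun w = List.ofFn w ∧
      (∀ᶠ q in 𝓝 w, (𝒢.toTop hA).IsPath (y q) (vs.evalFun q) (x q)) ∧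
      (∀ᶠ q in 𝓝 w, q ∈ 𝒢.wordSet n → vs.evalFun q = List.ofFn q) ∧
      ∀ v ∈ 𝒢.wordTangent n w, List.Forall₂ (fun f (e : E) => (mfderiv
        (ModelWithCorners.pi fun _ : Fin (n + 1) => 𝓘(ℝ, E)) 𝓘(ℝ, E) f w v : E) = e)
        vs (List.ofFn v) := by
  have he : ∀ q : Fin (n + 1) → G,
      (List.ofFn fun i (q : Fin (n + 1) → G) => q i).evalFun q = List.ofFn q := fun q => by
    simp [List.evalFun, List.map_ofFn, Function.comp_def]
  have hs : ∀ i : Fin (n + 1), SmoothNear (ModelWithCorners.pi fun _ : Fin (n + 1) => 𝓘(ℝ, E))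
      𝓘(ℝ, E) (fun q : Fin (n + 1) → G => q i) w := fun i => (contMDiff_eval i).smoothNear w
  obtain ⟨vs, a, h1, -, h2, h3, h4, h5⟩ := exists_path_correction (𝒢 := 𝒢) (hA := hA)
    (I := ModelWithCorners.pi fun _ : Fin (n + 1) => 𝓘(ℝ, E)) (q₀ := w)
    (List.ofFn fun i (q : Fin (n + 1) → G) => q i)
    (by
      intro f hf
      obtain ⟨i, rfl⟩ := List.mem_ofFn.1 hf
      exact hs i)
    (b := fun q => 𝒢.src (q (Fin.last n))) (smoothNear_src (𝒢 := 𝒢) (hs _)) (y := 𝒢.tgt (w 0))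
    (by rw [he]; exact (mem_wordSet_iff w).1 hw)
  refine ⟨vs, a, _, h1, h2.trans (he w), h3, ?_, fun v hv => ?_⟩
  · filter_upwards [h4] with q h4 hq
    rw [← he]
    exact h4 (𝒢.tgt (q 0)) (by rw [he]; exact (mem_wordSet_iff q).1 hq)
  · have hd := fun i : Fin (n + 1) => hasMFDerivAt_eval (E := E) w i
    have hsrc : ∀ i : Fin (n + 1), (mfderiv (ModelWithCorners.pi fun _ : Fin (n + 1) => 𝓘(ℝ, E))
        𝓘(ℝ, F) (fun q : Fin (n + 1) → G => 𝒢.src (q i)) w v : F) =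
        (mfderiv 𝓘(ℝ, E) 𝓘(ℝ, F) 𝒢.src (w i) (v i) : F) := fun i =>
      congrArg (fun L : (Fin (n + 1) → E) →L[ℝ] F => L v)
        ((𝒢.src_smooth.mdifferentiableAt (by simp)).hasMFDerivAt.comp w (hd i)).mfderiv
    have htgt : ∀ i : Fin (n + 1), (mfderiv (ModelWithCorners.pi fun _ : Fin (n + 1) => 𝓘(ℝ, E))
        𝓘(ℝ, F) (fun q : Fin (n + 1) → G => 𝒢.tgt (q i)) w v : F) =
        (mfderiv 𝓘(ℝ, E) 𝓘(ℝ, F) 𝒢.tgt (w i) (v i) : F) := fun i =>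
      congrArg (fun L : (Fin (n + 1) → E) →L[ℝ] F => L v)
        ((𝒢.tgt_smooth.mdifferentiableAt (by simp)).hasMFDerivAt.comp w (hd i)).mfderiv
    -- Vectors in `wordTangent` are infinitesimally composable, so the correction acts on them as
    -- the identity to first order.
    obtain ⟨-, h6⟩ := h5 v _ (isTangentPath_ofFn _ v fun i => by
      rw [hsrc, htgt]; exact hv i)
    have key : ∀ (D : ((Fin (n + 1) → G) → G) → E) (ev : Fin (n + 1) → (Fin (n + 1) → G) → G),
        (∀ i, D (ev i) = v i) → List.Forall₂ (fun f' f => D f' = D f) vs (List.ofFn ev) →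
        List.Forall₂ (fun f e => D f = e) vs (List.ofFn v) := by
      intro D ev h h'
      have e : List.ofFn v = (List.ofFn ev).map D := by
        rw [List.map_ofFn]
        exact congrArg List.ofFn (funext fun i => (h i).symm)
      rw [e, List.forall₂_map_right_iff]
      exact h'
    exact key _ _ (fun i => congrArg (fun L : (Fin (n + 1) → E) →L[ℝ] E => L v)
      (hd i).mfderiv) h6

variable (𝒢) in
/-- Data for a chart of `𝒜𝒞(G)`: its inverse maps `p` to the class of the word which consists of the
arrow `arrow p` and of a reference word `tail` with source `base p`. -/
structure WordChart (hA : 𝒢.IsThreeAssociative) (d : ℕ) where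
  dom : Set (EuclideanSpace ℝ (Fin d))
  isOpen_dom : IsOpen dom
  base : EuclideanSpace ℝ (Fin d) → M
  arrow : EuclideanSpace ℝ (Fin d) → G
  tail : List (M → G)
  tailTgt : M → M
  coord : G × M → EuclideanSpace ℝ (Fin d)
  smooth_base : ∀ p ∈ dom, SmoothNear 𝓘(ℝ, EuclideanSpace ℝ (Fin d)) 𝓘(ℝ, F) base p
  smooth_arrow : ∀ p ∈ dom, SmoothNear 𝓘(ℝ, EuclideanSpace ℝ (Fin d)) 𝓘(ℝ, E) arrow p
  smooth_tail : ∀ p ∈ dom, ∀ b ∈ tail, SmoothNear 𝓘(ℝ, F) 𝓘(ℝ, E) b (base p)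
  tail_path : ∀ p ∈ dom, ∀ᶠ y in 𝓝 (base p),
    (𝒢.toTop hA).IsPath (tailTgt y) (tail.evalFun y) y
  tail_inv : ∀ p ∈ dom, ∀ g ∈ tail.evalFun (base p), g ∈ 𝒢.invDom
  src_arrow : ∀ p ∈ dom, 𝒢.src (arrow p) = tailTgt (base p)
  smooth_coord : ∀ p ∈ dom, SmoothNear (𝓘(ℝ, E).prod 𝓘(ℝ, F))
    𝓘(ℝ, EuclideanSpace ℝ (Fin d)) coord (arrow p, base p)
  coord_eq : ∀ p ∈ dom, coord (arrow p, base p) = p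
  coord_inv : ∀ p ∈ dom, ∀ᶠ z in 𝓝 (arrow p, base p), 𝒢.src z.1 = tailTgt z.2 →
    arrow (coord z) = z.1 ∧ base (coord z) = z.2
  arrow_inj : ∀ p ∈ dom, ∀ p' ∈ dom, EqvGen (𝒢.toTop hA).Red [arrow p] [arrow p'] →
    arrow p = arrow p'

namespace WordChart

variable {d : ℕ} (c : 𝒢.WordChart hA d)

/-- The family of words underlying the chart. -/
def word : List (EuclideanSpace ℝ (Fin d) → G) :=
  c.arrow :: c.tail.map fun b p => b (c.base p)

theorem word_evalFun (p : EuclideanSpace ℝ (Fin d)) :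
    c.word.evalFun p = c.arrow p :: c.tail.evalFun (c.base p) := by
  simp [word, List.evalFun]

theorem smooth_word {p : EuclideanSpace ℝ (Fin d)} (hp : p ∈ c.dom) :
    ∀ v ∈ c.word, SmoothNear 𝓘(ℝ, EuclideanSpace ℝ (Fin d)) 𝓘(ℝ, E) v p := by
  intro v hv
  rcases List.mem_cons.1 hv with rfl | hv
  · exact c.smooth_arrow p hp
  · obtain ⟨b, hb, rfl⟩ := List.mem_map.1 hv
    exact (c.smooth_tail p hp b hb).comp (c.smooth_base p hp)

theorem word_path {p : EuclideanSpace ℝ (Fin d)} (hp : p ∈ c.dom) :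
    (𝒢.toTop hA).IsPath (𝒢.tgt (c.arrow p)) (c.word.evalFun p) (c.base p) := by
  rw [word_evalFun]
  refine ⟨rfl, ?_⟩
  have := (c.tail_path p hp).self_of_nhds
  rwa [← c.src_arrow p hp] at this

theorem exists_rep (c : 𝒢.WordChart hA d) :
    ∃ φ : EuclideanSpace ℝ (Fin d) → 𝒢.AC, ∀ p ∈ c.dom, 𝒢.Rep (c.word.evalFun p) (φ p) := by
  obtain ⟨r, h1, -⟩ := c.word.exists_ofFn_evalFun (n := c.tail.length + 1) (by simp [word])
  refine ⟨fun p => 𝒢.proj c.tail.length (r p), fun p hp => ?_⟩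
  rw [← h1]
  refine rep_proj ?_
  obtain ⟨a, ha⟩ := exists_rep_of_isPath (by simp [word]) (c.word_path hp)
  rw [← h1] at ha
  exact (proj_eq_of_rep ha).1

/-- The inverse of the chart. -/
noncomputable def toAC : EuclideanSpace ℝ (Fin d) → 𝒢.AC := c.exists_rep.choose

theorem rep_toAC {p : EuclideanSpace ℝ (Fin d)} (hp : p ∈ c.dom) :
    𝒢.Rep (c.word.evalFun p) (c.toAC p) := c.exists_rep.choose_spec p hp

/-- Equivalent words have the same source, hence the same tail. Its invertible letters cancel,
leaving equivalent arrows, which are equal by `arrow_inj`; then `coord` recovers the parameter. -/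
theorem injOn_toAC : Set.InjOn c.toAC c.dom := by
  intro p hp p' hp' h
  have h1 := ((c.rep_toAC hp).eq_iff (hA := hA) (c.rep_toAC hp')).1 h
  have hb : c.base p = c.base p' := by
    have := (TopLocalGroupoid.eqvGen_isPath_iff h1).1 (c.word_path hp)
    exact (this.eq_and_eq (by simp [word]) (c.word_path hp')).2
  rw [word_evalFun, word_evalFun, ← hb] at h1
  have ha := c.arrow_inj p hp p' hp' (TopLocalGroupoid.eqvGen_cancel_right (T := 𝒢.toTop hA)
    (c.tail_inv p hp) (a := [c.arrow p]) (a' := [c.arrow p']) (by simp) (by simp)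
    (y := 𝒢.tgt (c.arrow p)) (y' := 𝒢.tgt (c.arrow p')) (z := c.tailTgt (c.base p))
    ⟨rfl, c.src_arrow p hp⟩ ⟨rfl, by rw [hb]; exact c.src_arrow p' hp'⟩
    (c.tail_path p hp).self_of_nhds h1)
  rw [← c.coord_eq p hp, ← c.coord_eq p' hp', ha, hb]

/-- Coordinates of smooth families of words near a word of the form `c.word p`. -/
theorem exists_coordinates_of_eq {p : EuclideanSpace ℝ (Fin d)} (hp : p ∈ c.dom)
    {vs : List (Q → G)} (hvs : ∀ v ∈ vs, SmoothNear I 𝓘(ℝ, E) v q₀) {y x : Q → M}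
    (hpath : ∀ᶠ q in 𝓝 q₀, (𝒢.toTop hA).IsPath (y q) (vs.evalFun q) (x q))
    (he : vs.evalFun q₀ = c.word.evalFun p) :
    ∃ f : Q → EuclideanSpace ℝ (Fin d), SmoothNear I 𝓘(ℝ, EuclideanSpace ℝ (Fin d)) f q₀ ∧
      f q₀ = p ∧ ∀ᶠ q in 𝓝 q₀, EqvGen (𝒢.toTop hA).Red (vs.evalFun q) (c.word.evalFun (f q)) := by
  obtain _ | ⟨v₀, vt⟩ := vs
  · simp [word] at he
  rw [word_evalFun, List.evalFun_cons, List.cons.injEq] at he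
  obtain ⟨hv₀, he⟩ := he
  have hx : SmoothNear I 𝓘(ℝ, F) x q₀ := (smoothNear_of_isPath (by simp) hvs hpath).2
  have hx₀ : x q₀ = c.base p := by
    have h1 := hpath.self_of_nhds
    have h2 := c.word_path hp
    rw [List.evalFun_cons, hv₀, he, ← word_evalFun] at h1
    exact (h1.eq_and_eq (by simp [word]) h2).2
  have hv₀s := hvs v₀ (by simp)
  have htail : ∀ q, (c.tail.map fun b q => b (x q)).evalFun q = c.tail.evalFun (x q) := fun q => by
    simp [List.evalFun]
  have htp : ∀ᶠ q in 𝓝 q₀, (𝒢.toTop hA).IsPath (c.tailTgt (x q)) (c.tail.evalFun (x q)) (x q) := by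
    have := hx.tendsto
    rw [hx₀] at this
    exact this.eventually (c.tail_path p hp)
  -- The remaining letters differ from the reference tail over the same source by an arrow `k` near
  -- a unit. Absorbed into the first letter, it brings the family into the form `(arrow, tail)`,
  -- with coordinates computed from `(v₀ k, x)`.
  obtain ⟨k, hk, hk₀, hke⟩ := exists_smooth_quotient (𝒢 := 𝒢) (hA := hA) (vs := vt)
    (bs := c.tail.map fun b q => b (x q)) (fun v hv => hvs v (by simp [hv]))
    (by
      intro v hv
      obtain ⟨b, hb, rfl⟩ := List.mem_map.1 hv
      exact (c.smooth_tail p hp b hb).comp_of_eq hx hx₀)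
    (by rw [htail, hx₀, he]) (by rw [htail, hx₀]; exact c.tail_inv p hp)
    (kn := fun q => 𝒢.unit (x q)) (smoothNear_unit hx) (by rw [𝒢.src_unit])
    (y := fun q => 𝒢.src (v₀ q)) (z := fun q => c.tailTgt (x q))
    (by
      filter_upwards [hpath] with q hq
      rw [𝒢.tgt_unit]; exact hq.2)
    (by
      filter_upwards [htp] with q hq
      rw [𝒢.src_unit, htail]; exact hq)
  have hm₀ : (v₀ q₀, k q₀) ∈ 𝒢.mulDom := by rw [hk₀]; exact 𝒢.mem_mulDom_unit_right _
  have hc : ∀ᶠ q in 𝓝 q₀, 𝒢.src (v₀ q) = 𝒢.tgt (k q) := hke.mono fun q hq => hq.2.1.symm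
  have ha := 𝒢.smoothNear_mul hv₀s hk hm₀ hc
  have hm := 𝒢.eventually_mem_mulDom hv₀s hk hm₀ hc
  have ha₀ : 𝒢.mul (v₀ q₀) (k q₀) = c.arrow p := by rw [hk₀, 𝒢.mul_unit, hv₀]
  have hax := ha.prodMk hx
  have hax₀ : (𝒢.mul (v₀ q₀) (k q₀), x q₀) = (c.arrow p, c.base p) := by rw [ha₀, hx₀]
  refine ⟨fun q => c.coord (𝒢.mul (v₀ q) (k q), x q), (c.smooth_coord p hp).comp_of_eq hax hax₀,
    (congrArg c.coord hax₀).trans (c.coord_eq p hp), ?_⟩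
  have ht := hax.tendsto
  rw [hax₀] at ht
  filter_upwards [ht.eventually (c.coord_inv p hp), hm, hke, hpath] with q h1 h2 h3 h4
  obtain ⟨h5, h6⟩ := h1 (by rw [𝒢.src_mul _ _ h2]; exact h3.1)
  rw [word_evalFun, h5, h6]
  have r₁ := TopLocalGroupoid.eqvGen_unit_right (T := 𝒢.toTop hA)
    (l := (v₀ :: vt).evalFun q) (by simp) h4
  have r₂ := TopLocalGroupoid.eqvGen_append_left [v₀ q] h3.2.2
  rw [htail] at r₂
  have r₃ := EqvGen.rel _ _ (TopLocalGroupoid.Red.head (T := 𝒢.toTop hA)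
    (c.tail.evalFun (x q)) h2)
  exact (r₁.symm.trans _ _ _ r₂).trans _ _ _ r₃

/-- Coordinates of smooth families of words near a word with class in the domain of the chart. -/
theorem exists_coordinates {p : EuclideanSpace ℝ (Fin d)} (hp : p ∈ c.dom)
    {vs : List (Q → G)} (hvs : ∀ v ∈ vs, SmoothNear I 𝓘(ℝ, E) v q₀) {y x : Q → M}
    (hpath : ∀ᶠ q in 𝓝 q₀, (𝒢.toTop hA).IsPath (y q) (vs.evalFun q) (x q))
    (he : 𝒢.Rep (vs.evalFun q₀) (c.toAC p)) :
    ∃ f : Q → EuclideanSpace ℝ (Fin d), SmoothNear I 𝓘(ℝ, EuclideanSpace ℝ (Fin d)) f q₀ ∧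
      f q₀ = p ∧ ∀ᶠ q in 𝓝 q₀, f q ∈ c.dom ∧ 𝒢.Rep (vs.evalFun q) (c.toAC (f q)) := by
  obtain ⟨vs', h1, h2, h3⟩ := exists_smooth_transfer
    ((he.eq_iff (hA := hA) (c.rep_toAC hp)).1 rfl) hvs hpath rfl
  obtain ⟨f, hf, hf₀, h4⟩ := c.exists_coordinates_of_eq hp h1 (y := y) (x := x) (by
    filter_upwards [hpath, h3] with q h5 h6
      using (TopLocalGroupoid.eqvGen_isPath_iff h6).1 h5) h2
  refine ⟨f, hf, hf₀, ?_⟩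
  have h5 : ∀ᶠ q in 𝓝 q₀, f q ∈ c.dom :=
    hf.tendsto (c.isOpen_dom.mem_nhds (by rwa [hf₀]))
  filter_upwards [h3, h4, h5] with q h3 h4 h5
  exact ⟨h5, (rep_iff_of_eqvGen (h3.trans _ _ _ h4) _).2 (c.rep_toAC h5)⟩

theorem continuousOn_toAC : ContinuousOn c.toAC c.dom := by
  obtain ⟨r, h1, h2⟩ := c.word.exists_ofFn_evalFun (n := c.tail.length + 1) (by simp [word])
  have h3 : ∀ p ∈ c.dom, r p ∈ 𝒢.wordSet c.tail.length ∧
      𝒢.proj c.tail.length (r p) = c.toAC p := fun p hp =>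
    proj_eq_of_rep (by rw [h1]; exact c.rep_toAC hp)
  have h4 : ContinuousOn r c.dom := fun p hp => by
    refine ContinuousAt.continuousWithinAt (continuousAt_pi.2 fun i => ?_)
    exact (c.smooth_word hp _ (h2 i)).contMDiffAt.continuousAt
  exact ((continuousOn_proj _).comp h4 fun p hp => (h3 p hp).1).congr fun p hp => (h3 p hp).2.symm

theorem exists_coordinates_proj {n : ℕ} {w : Fin (n + 1) → G} (hw : w ∈ 𝒢.wordSet n)
    {p : EuclideanSpace ℝ (Fin d)} (hp : p ∈ c.dom) (h : 𝒢.proj n w = c.toAC p) :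
    ∃ f : (Fin (n + 1) → G) → EuclideanSpace ℝ (Fin d),
      SmoothNear (ModelWithCorners.pi fun _ : Fin (n + 1) => 𝓘(ℝ, E))
        𝓘(ℝ, EuclideanSpace ℝ (Fin d)) f w ∧ f w = p ∧
      ∀ᶠ q in 𝓝 w, f q ∈ c.dom ∧ (q ∈ 𝒢.wordSet n → 𝒢.proj n q = c.toAC (f q)) := by
  obtain ⟨vs, y, x, h1, h2, h3, h4, -⟩ := exists_tautological_family hA hw
  obtain ⟨f, hf, hf₀, h5⟩ := c.exists_coordinates hp h1 h3 (by rw [h2, ← h]; exact rep_proj hw)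
  refine ⟨f, hf, hf₀, ?_⟩
  filter_upwards [h4, h5] with q h4 h5
  refine ⟨h5.1, fun hq => ?_⟩
  have := h5.2
  rw [h4 hq] at this
  exact (proj_eq_of_rep this).2

/-- Openness in the quotient topology is tested on words. Words near one with class in the image
have chart coordinates that vary continuously, so these remain in `O`. -/
theorem isOpen_image_toAC {O : Set (EuclideanSpace ℝ (Fin d))} (hO : IsOpen O)
    (hOd : O ⊆ c.dom) : IsOpen (c.toAC '' O) := by
  have h1 : IsOpen (Quot.mk 𝒢.Contracts ⁻¹' (c.toAC '' O)) := by
    refine isOpen_sigma_iff.2 fun n => isOpen_iff_mem_nhds.2 ?_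
    rintro ⟨w, hw⟩ ⟨p, hp, e⟩
    obtain ⟨f, hf, hf₀, h5⟩ := c.exists_coordinates_proj hw (hOd hp)
      ((proj_eq_of_rep ⟨⟨n, w, hw⟩, rfl, e.symm⟩).2)
    have h6 : ∀ᶠ q in 𝓝 w, f q ∈ O := hf.tendsto (hO.mem_nhds (by rwa [hf₀]))
    rw [nhds_subtype_eq_comap]
    refine ⟨_, h5.and h6, ?_⟩
    rintro ⟨q, hq⟩ h7
    refine ⟨f q, h7.2, ?_⟩
    rw [← h7.1.2 hq]
    exact (proj_eq_of_rep ⟨⟨n, q, hq⟩, rfl, rfl⟩).2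
  exact h1

/-- The chart of `𝒜𝒞(G)`. -/
noncomputable def chart : OpenPartialHomeomorph 𝒢.AC (EuclideanSpace ℝ (Fin d)) :=
  (OpenPartialHomeomorph.ofContinuousOpenRestrict (c.injOn_toAC.toPartialEquiv c.toAC c.dom)
    c.continuousOn_toAC (by
      rintro O hO
      obtain ⟨O', hO', rfl⟩ := hO
      have : Set.domRestrict c.dom c.toAC '' (Subtype.val ⁻¹' O') = c.toAC '' (O' ∩ c.dom) := by
        ext a
        constructor
        · rintro ⟨⟨p, hp⟩, hp', rfl⟩
          exact ⟨p, ⟨hp', hp⟩, rfl⟩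
        · rintro ⟨p, ⟨hp', hp⟩, rfl⟩
          exact ⟨⟨p, hp⟩, hp', rfl⟩
      change IsOpen (Set.domRestrict c.dom c.toAC '' (Subtype.val ⁻¹' O'))
      rw [this]
      exact c.isOpen_image_toAC (hO'.inter c.isOpen_dom) Set.inter_subset_right)
    c.isOpen_dom).symm

theorem chart_symm_apply (p : EuclideanSpace ℝ (Fin d)) : c.chart.symm p = c.toAC p := rfl

/-- The words parametrized by `c` form a smooth family, and the coordinates of this family in `c'`
are the transition map. -/
theorem contDiffOn_transition (c c' : 𝒢.WordChart hA d) :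
    ContDiffOn ℝ ∞ (c.chart.symm ≫ₕ c'.chart) (c.chart.symm ≫ₕ c'.chart).source := by
  rintro p ⟨hp, hp'⟩
  have hp : p ∈ c.dom := hp
  have hp' : c.toAC p ∈ c'.chart.source := hp'
  set p' := c'.chart (c.toAC p) with hpp
  have hpd : p' ∈ c'.dom := c'.chart.map_source hp'
  have he : c'.toAC p' = c.toAC p := c'.chart.left_inv hp'
  obtain ⟨f, hf, hf₀, h5⟩ := c'.exists_coordinates hpd (I := 𝓘(ℝ, EuclideanSpace ℝ (Fin d)))
    (c.smooth_word hp)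
    ((c.isOpen_dom.eventually_mem hp).mono fun q hq => c.word_path hq)
    (by rw [he]; exact c.rep_toAC hp)
  refine ContDiffAt.contDiffWithinAt (ContDiffAt.congr_of_eventuallyEq
    hf.contMDiffAt.contDiffAt ?_)
  filter_upwards [h5, c.isOpen_dom.eventually_mem hp] with q hq hqd
  have h6 : c.toAC q = c'.toAC (f q) := (c.rep_toAC hqd).eq hq.2
  change c'.chart (c.toAC q) = f q
  rw [h6]
  exact c'.chart.right_inv hq.1

end WordChart

end LocalLieGroupoid

end WordChartPart

/-! ### Uniform discreteness of associators implies smoothness of the completion. -/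

section SmoothQuotientPart
set_option linter.unusedSectionVars false
open Filter Relation

namespace LocalLieGroupoid

variable {E F G M : Type*}
  [NormedAddCommGroup E] [NormedSpace ℝ E] [NormedAddCommGroup F] [NormedSpace ℝ F]
  [TopologicalSpace G] [ChartedSpace E G] [TopologicalSpace M] [ChartedSpace F M]
  {𝒢 : LocalLieGroupoid E F G M}
  [FiniteDimensional ℝ E] [FiniteDimensional ℝ F]
  [IsManifold 𝓘(ℝ, E) ∞ G] [IsManifold 𝓘(ℝ, F) ∞ M] {hA : 𝒢.IsThreeAssociative}

/-- If the associators are uniformly discrete, the completion map is injective near the units. -/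
theorem HasUniformlyDiscreteAssociators.exists_injective_nhds
    (h : 𝒢.HasUniformlyDiscreteAssociators) (hI : 𝒢.IsInversional)
    (hC : 𝒢.HasProductsConnectedToAxes) (x : M) :
    ∃ Ω ∈ 𝓝 (𝒢.unit x), ∀ k ∈ Ω, ∀ k' ∈ Ω, EqvGen (𝒢.toTop hA).Red [k] [k'] → k = k' := by
  obtain ⟨U, hU, hMU, hUA⟩ := h
  set T := 𝒢.toTop hA with hT
  have key : ∀ᶠ p in 𝓝 (𝒢.unit x) ×ˢ 𝓝 (𝒢.unit x), 𝒢.src p.1 = 𝒢.src p.2 →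
      EqvGen T.Red [p.1] [p.2] → p.1 = p.2 := by
    -- For pairs close to the unit, equality of sources is what makes `p.1 · p.2⁻¹` defined, so the
    -- limit is taken along such pairs.
    refine eventually_inf_principal (s := {p : G × G | 𝒢.src p.1 = 𝒢.src p.2})
      (p := fun p => EqvGen T.Red [p.1] [p.2] → p.1 = p.2).1 ?_
    set L := 𝓝 (𝒢.unit x) ×ˢ 𝓝 (𝒢.unit x) ⊓ 𝓟 {p : G × G | 𝒢.src p.1 = 𝒢.src p.2} with hL
    have h1 : Tendsto Prod.fst L (𝓝 (𝒢.unit x)) := tendsto_fst.mono_left inf_le_left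
    have h2 : Tendsto Prod.snd L (𝓝 (𝒢.unit x)) := tendsto_snd.mono_left inf_le_left
    have h3 : ∀ᶠ p in L, 𝒢.src p.1 = 𝒢.src p.2 := mem_inf_of_right (mem_principal_self _)
    have h4 : ∀ᶠ p in L, p.2 ∈ 𝒢.invDom :=
      h2.eventually (𝒢.invDom_open.mem_nhds (𝒢.unit_mem_invDom x))
    have h5 : Tendsto (fun p : G × G => 𝒢.inv p.2) L (𝓝 (𝒢.unit x)) := by
      have := T.tendsto_inv h2 (𝒢.unit_mem_invDom x)
      rwa [show 𝒢.unit x = T.unit x from rfl, T.inv_unit] at this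
    have huu : (𝒢.unit x, 𝒢.unit x) ∈ 𝒢.mulDom := by
      have := 𝒢.mem_mulDom_unit_right (𝒢.unit x)
      rwa [𝒢.src_unit] at this
    have hmu : 𝒢.mul (𝒢.unit x) (𝒢.unit x) = 𝒢.unit x := by
      have := 𝒢.mul_unit (𝒢.unit x)
      rwa [𝒢.src_unit] at this
    have hc : ∀ᶠ p in L, 𝒢.src p.1 = 𝒢.tgt (𝒢.inv p.2) := by
      filter_upwards [h3, h4] with p h3 h4
      rw [h3, 𝒢.tgt_inv _ h4]
    have h6 := T.eventually_assoc h1 h5 h2 huu huu (by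
        rw [show T.mul (𝒢.unit x) (𝒢.unit x) = _ from hmu]; exact huu) (by
        rw [show T.mul (𝒢.unit x) (𝒢.unit x) = _ from hmu]; exact huu) hc
      (h4.mono fun p hp => 𝒢.src_inv _ hp)
    have h7 := T.tendsto_mul h1 h5 huu hc
    rw [show T.mul (𝒢.unit x) (𝒢.unit x) = 𝒢.unit x from hmu] at h7
    have h8 := h7.eventually (hU.mem_nhds (hMU ⟨x, rfl⟩))
    filter_upwards [h3, h4, h6, h8] with p h3 h4 h6 h8 h
    obtain ⟨a₁, a₂, a₃, a₄, a₅⟩ := h6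
    have r₁ : EqvGen T.Red [p.1, 𝒢.inv p.2] [T.mul p.1 (𝒢.inv p.2)] :=
      .rel _ _ (TopLocalGroupoid.Red.head [] a₁)
    have r₂ : EqvGen T.Red [T.mul p.1 (𝒢.inv p.2)] [T.unit (T.tgt p.2)] :=
      (r₁.symm.trans _ _ _ (TopLocalGroupoid.eqvGen_append_right [𝒢.inv p.2] h)).trans _ _ _
        (TopLocalGroupoid.eqvGen_mul_inv h4)
    have r₃ : 𝒢.completion (𝒢.mul p.1 (𝒢.inv p.2)) = 𝒢.completion (𝒢.unit (𝒢.tgt p.2)) :=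
      ((rep_completion _).eq_iff (hA := hA) (rep_completion _)).2 r₂
    obtain ⟨e₁, e₂, l, e₃, e₄⟩ := mem_assoc_of_completion_eq hI hC hA r₃
    have e₅ : 𝒢.mul p.1 (𝒢.inv p.2) ∈ 𝒢.Assoc :=
      mem_assoc_iff.2 ⟨e₁.trans e₂.symm, l, by rw [e₁]; exact e₃, e₄⟩
    -- This quotient is an associator inside `U`, hence a unit. Multiplying by `p.2` on the right
    -- gives `p.1 = p.2`.
    obtain ⟨z, hz⟩ : 𝒢.mul p.1 (𝒢.inv p.2) ∈ Set.range 𝒢.unit := by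
      rw [← hUA]; exact ⟨h8, e₅⟩
    have hz' : z = 𝒢.tgt p.2 := by rw [← e₁, ← hz, 𝒢.src_unit]
    have a₆ : 𝒢.mul (𝒢.mul p.1 (𝒢.inv p.2)) p.2 = 𝒢.mul p.1 (𝒢.mul (𝒢.inv p.2) p.2) := a₅
    rw [← hz, hz', 𝒢.unit_mul, 𝒢.inv_mul _ h4, ← h3, 𝒢.mul_unit] at a₆
    exact a₆.symm
  obtain ⟨Ω, hΩ, h'⟩ := eventually_prod_self_iff (r := fun k k' => 𝒢.src k = 𝒢.src k' →
    EqvGen T.Red [k] [k'] → k = k').1 key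
  refine ⟨Ω, hΩ, fun k hk k' hk' hkk => h' k hk k' hk' ?_ hkk⟩
  exact ((TopLocalGroupoid.eqvGen_isPath_iff hkk (y := 𝒢.tgt k) (x := 𝒢.src k)).1
    ⟨rfl, rfl⟩).2.symm

/-- Charts of `𝒜𝒞(G)` exist at all points. -/
theorem WordChart.exists_mem_source (h : 𝒢.HasUniformlyDiscreteAssociators)
    (hI : 𝒢.IsInversional) (hC : 𝒢.HasProductsConnectedToAxes) (hA : 𝒢.IsThreeAssociative)
    (a : 𝒢.AC) : ∃ (c : 𝒢.WordChart hA (Module.finrank ℝ E)) (p : _), p ∈ c.dom ∧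
      c.toAC p = a := by
  obtain ⟨l₀, hl₀⟩ := LocalLieGroupoid.exists_rep a
  -- The representative is chosen with invertible letters, so that it can serve as the tail of the
  -- chart.
  obtain ⟨l, hl, hll⟩ := (hI.toTop (hA := hA)).exists_redStar l₀
  replace hl₀ : 𝒢.Rep l a := (rep_iff_of_eqvGen hll.eqvGen a).2 hl₀
  have hpath := hl₀.isPath (hA := hA)
  set x₀ := AC.src hA a with hx₀
  set y₀ := AC.tgt hA a with hy₀
  have hconst : ∀ x : M, (l.map fun g (_ : M) => g).evalFun x = l := fun x => by
    simp [List.evalFun, Function.comp_def]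
  -- Correcting the constant family `l` moves the reference word to nearby sources `x`; its target
  -- becomes `τ x`.
  obtain ⟨bs, τ, hbs, hτ, hbs₀, hτp, -, -⟩ := exists_path_correction (𝒢 := 𝒢) (hA := hA)
    (I := 𝓘(ℝ, F)) (q₀ := x₀) (l.map fun g (_ : M) => g)
    (by
      intro f hf
      obtain ⟨g, -, rfl⟩ := List.mem_map.1 hf
      exact smoothNear_const _ _) (b := fun x => x) (smoothNear_id _) (y := y₀)
    (by rw [hconst]; exact hpath)
  rw [hconst] at hbs₀
  have hτ₀ : τ x₀ = y₀ := by
    have := hτp.self_of_nhds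
    rw [hbs₀] at this
    exact this.left_unique hpath
  obtain ⟨K, κ, ψ, hdim, hκ, hψ, hψ₁, hψ₂⟩ := (𝒢.src_smooth.smoothNear
    (𝒢.unit y₀)).exists_adapted_chart (𝒢.src_submersion _)
  rw [𝒢.src_unit] at hψ hψ₁
  set d := Module.finrank ℝ E with hd
  obtain ⟨Ω, hΩ, hinj⟩ := h.exists_injective_nhds (hA := hA) hI hC y₀
  -- The chart has two parameters: the source of the tail, in `F`, and the position of the arrow in
  -- its source fibre, in `K`. Since `K` is the kernel of `ds`, the dimensions add up to that of
  -- `E`.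
  let L : (F × K) ≃L[ℝ] EuclideanSpace ℝ (Fin d) := ContinuousLinearEquiv.ofFinrankEq (by
    rw [Module.finrank_prod, hdim, finrank_euclideanSpace, Fintype.card_fin])
  let χ := extChartAt 𝓘(ℝ, F) x₀
  let base : EuclideanSpace ℝ (Fin d) → M := fun p => χ.symm (L.symm p).1
  let arrow : EuclideanSpace ℝ (Fin d) → G := fun p => ψ (τ (base p), (L.symm p).2)
  let coord : G × M → EuclideanSpace ℝ (Fin d) := fun z => L (χ z.2, κ z.1)
  let p₀ : EuclideanSpace ℝ (Fin d) := L (χ x₀, κ (𝒢.unit y₀))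
  have hχχ : χ.symm (χ x₀) = x₀ := extChartAt_to_inv x₀
  have hLp₀ : L.symm p₀ = (χ x₀, κ (𝒢.unit y₀)) := L.symm_apply_apply _
  have hbase₀ : base p₀ = x₀ := by simp only [base, hLp₀, hχχ]
  have harrow₀ : arrow p₀ = 𝒢.unit y₀ := by
    have := hψ₂.self_of_nhds
    rw [𝒢.src_unit] at this
    simp only [arrow, hbase₀, hτ₀, hLp₀, this]
  have hL1 : ContMDiff 𝓘(ℝ, EuclideanSpace ℝ (Fin d)) 𝓘(ℝ, F) ∞ fun p => (L.symm p).1 :=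
    ((ContinuousLinearMap.fst ℝ F K).contDiff.comp L.symm.contDiff).contMDiff
  have hL2 : ContMDiff 𝓘(ℝ, EuclideanSpace ℝ (Fin d)) 𝓘(ℝ, K) ∞ fun p => (L.symm p).2 :=
    ((ContinuousLinearMap.snd ℝ F K).contDiff.comp L.symm.contDiff).contMDiff
  have hχs : SmoothNear 𝓘(ℝ, F) 𝓘(ℝ, F) χ x₀ :=
    (contMDiffOn_extChartAt (I := 𝓘(ℝ, F)) (x := x₀)).smoothNear (chart_source_mem_nhds F x₀)
  have hχi : SmoothNear 𝓘(ℝ, F) 𝓘(ℝ, F) χ.symm (χ x₀) :=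
    (contMDiffOn_extChartAt_symm (I := 𝓘(ℝ, F)) x₀).smoothNear (extChartAt_target_mem_nhds x₀)
  have hbase : SmoothNear 𝓘(ℝ, EuclideanSpace ℝ (Fin d)) 𝓘(ℝ, F) base p₀ :=
    hχi.comp_of_eq (hL1.smoothNear p₀) (by rw [hLp₀])
  have hτb := hτ.comp_of_eq hbase hbase₀
  have hτL := hτb.prodMk (hL2.smoothNear p₀)
  have hτL₀ : (τ (base p₀), (L.symm p₀).2) = (y₀, κ (𝒢.unit y₀)) := by
    rw [hbase₀, hτ₀, hLp₀]
  have harrow : SmoothNear 𝓘(ℝ, EuclideanSpace ℝ (Fin d)) 𝓘(ℝ, E) arrow p₀ :=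
    hψ.comp_of_eq hτL hτL₀
  have hcoord : SmoothNear (𝓘(ℝ, E).prod 𝓘(ℝ, F)) 𝓘(ℝ, EuclideanSpace ℝ (Fin d)) coord
      (arrow p₀, base p₀) := by
    rw [harrow₀, hbase₀]
    have h1 : SmoothNear (𝓘(ℝ, E).prod 𝓘(ℝ, F)) 𝓘(ℝ, F) (fun z : G × M => χ z.2)
        (𝒢.unit y₀, x₀) := SmoothNear.comp (g := χ) (f := Prod.snd) hχs
          (contMDiff_snd.smoothNear _)
    have h2 : SmoothNear (𝓘(ℝ, E).prod 𝓘(ℝ, F)) 𝓘(ℝ, K) (fun z : G × M => κ z.1)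
        (𝒢.unit y₀, x₀) := SmoothNear.comp (g := κ) (f := Prod.fst) hκ
          (contMDiff_fst.smoothNear _)
    have h3 : SmoothNear (𝓘(ℝ, E).prod 𝓘(ℝ, F)) 𝓘(ℝ, F × K)
        (fun z : G × M => (χ z.2, κ z.1)) (𝒢.unit y₀, x₀) := by
      filter_upwards [h1, h2] with z h1 h2 using h1.prodMk_space h2
    exact SmoothNear.comp (g := L) (L.contDiff.contMDiff.smoothNear _) h3
  have hab := harrow.tendsto.prodMk_nhds hbase.tendsto
  have hbs' : ∀ᶠ x in 𝓝 x₀, ∀ b ∈ bs, SmoothNear 𝓘(ℝ, F) 𝓘(ℝ, E) b x ∧ b x ∈ 𝒢.invDom := by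
    refine (eventually_all_finite bs.finite_toSet).2 fun b hb => (hbs b hb).eventually.and ?_
    refine (hbs b hb).tendsto (𝒢.invDom_open.mem_nhds (hl _ ?_))
    rw [← hbs₀]
    exact List.mem_map.2 ⟨b, hb, rfl⟩
  have hbt := hbase.tendsto
  have hinv : ∀ᶠ z in 𝓝 (arrow p₀, base p₀), 𝒢.src z.1 = τ z.2 →
      arrow (coord z) = z.1 ∧ base (coord z) = z.2 := by
    rw [harrow₀, hbase₀]
    have h1 : ∀ᶠ z : G × M in 𝓝 (𝒢.unit y₀, x₀), z.2 ∈ χ.source :=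
      continuousAt_snd.tendsto.eventually (extChartAt_source_mem_nhds (I := 𝓘(ℝ, F)) x₀)
    have h2 : ∀ᶠ z : G × M in 𝓝 (𝒢.unit y₀, x₀), ψ (𝒢.src z.1, κ z.1) = z.1 :=
      (continuous_fst.tendsto (𝒢.unit y₀, x₀)).eventually hψ₂
    filter_upwards [h1, h2] with z h1 h2 hz
    have h3 : base (coord z) = z.2 := by
      simp only [base, coord, L.symm_apply_apply, χ.left_inv h1]
    refine ⟨?_, h3⟩
    simp only [arrow, h3, ← hz]
    simp only [coord, L.symm_apply_apply, h2]
  have e₁ := hbase.eventually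
  have e₂ := harrow.eventually
  rw [hbase₀] at hbt
  have e₃ := hbt.eventually hbs'
  have e₄ := hbt.eventually hτp.eventually_nhds
  have e₅ : ∀ᶠ p in 𝓝 p₀, 𝒢.src (arrow p) = τ (base p) ∧ κ (arrow p) = (L.symm p).2 := by
    have := hτL.tendsto
    rw [hτL₀] at this
    exact this.eventually hψ₁
  have e₆ := hab.eventually hcoord.eventually
  have e₇ : ∀ᶠ p in 𝓝 p₀, (L.symm p).1 ∈ χ.target := by
    have := (hL1.continuous.tendsto p₀)
    rw [hLp₀] at this
    exact this.eventually (extChartAt_target_mem_nhds (I := 𝓘(ℝ, F)) x₀)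
  have e₈ := hab.eventually hinv.eventually_nhds
  have e₉ : ∀ᶠ p in 𝓝 p₀, arrow p ∈ Ω := harrow.tendsto (by rwa [harrow₀])
  have eall := (((((((e₁.and e₂).and e₃).and e₄).and e₅).and e₆).and e₇).and e₈).and e₉
  -- Every condition on a chart holds near `p₀`; `D` is an open set on which all of them hold.
  obtain ⟨D, hDsub, hDo, hp₀D⟩ := _root_.mem_nhds_iff.1 eall
  let c : 𝒢.WordChart hA d :=
    { dom := D
      isOpen_dom := hDo
      base := base
      arrow := arrow
      tail := bs
      tailTgt := τ
      coord := coord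
      smooth_base := fun p hp => (hDsub hp).1.1.1.1.1.1.1.1
      smooth_arrow := fun p hp => (hDsub hp).1.1.1.1.1.1.1.2
      smooth_tail := fun p hp b hb => ((hDsub hp).1.1.1.1.1.1.2 b hb).1
      tail_path := fun p hp => (hDsub hp).1.1.1.1.1.2
      tail_inv := fun p hp g hg => by
        obtain ⟨b, hb, rfl⟩ := List.mem_map.1 hg
        exact ((hDsub hp).1.1.1.1.1.1.2 b hb).2
      src_arrow := fun p hp => (hDsub hp).1.1.1.1.2.1
      smooth_coord := fun p hp => (hDsub hp).1.1.1.2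
      coord_eq := fun p hp => by
        have h1 := (hDsub hp).1.1.1.1.2.2
        have h2 := (hDsub hp).1.1.2
        have h3 : χ (base p) = (L.symm p).1 := χ.right_inv h2
        simp only [coord, h1, h3]
        exact L.apply_symm_apply p
      coord_inv := fun p hp => (hDsub hp).1.2
      arrow_inj := fun p hp p' hp' => hinj _ (hDsub hp).2 _ (hDsub hp').2 }
  refine ⟨c, p₀, hp₀D, (c.rep_toAC hp₀D).eq ?_⟩
  have h1 : c.word.evalFun p₀ = 𝒢.unit y₀ :: l := by
    rw [c.word_evalFun, show c.arrow p₀ = _ from harrow₀, show c.base p₀ = _ from hbase₀,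
      show c.tail.evalFun x₀ = _ from hbs₀]
  rw [h1]
  exact (rep_iff_of_eqvGen (TopLocalGroupoid.eqvGen_unit_left hl₀.ne_nil hpath) a).2 hl₀

/-- The charted space structure of `𝒜𝒞(G)`. -/
@[reducible] noncomputable def acChartedSpace (h : 𝒢.HasUniformlyDiscreteAssociators)
    (hI : 𝒢.IsInversional) (hC : 𝒢.HasProductsConnectedToAxes) (hA : 𝒢.IsThreeAssociative) :
    ChartedSpace (EuclideanSpace ℝ (Fin (Module.finrank ℝ E))) 𝒢.AC where
  atlas := Set.range fun c : 𝒢.WordChart hA (Module.finrank ℝ E) => c.chart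
  chartAt a := (WordChart.exists_mem_source h hI hC hA a).choose.chart
  mem_chart_source a := by
    obtain ⟨p, hp, e⟩ := (WordChart.exists_mem_source h hI hC hA a).choose_spec
    have := (WordChart.exists_mem_source h hI hC hA a).choose.chart.map_target hp
    rwa [WordChart.chart_symm_apply, e] at this
  chart_mem_atlas a := ⟨_, rfl⟩

theorem acIsManifold (h : 𝒢.HasUniformlyDiscreteAssociators)
    (hI : 𝒢.IsInversional) (hC : 𝒢.HasProductsConnectedToAxes) (hA : 𝒢.IsThreeAssociative) :
    @IsManifold ℝ _ _ _ _ _ _ 𝓘(ℝ, EuclideanSpace ℝ (Fin (Module.finrank ℝ E))) ∞ 𝒢.AC _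
      (acChartedSpace h hI hC hA) := by
  let _ := acChartedSpace h hI hC hA
  apply isManifold_of_contDiffOn
  rintro _ _ ⟨c, rfl⟩ ⟨c', rfl⟩
  have := WordChart.contDiffOn_transition c c'
  simpa using this

theorem mem_wordTangent_mfderiv {EQ HQ Q : Type*} [NormedAddCommGroup EQ] [NormedSpace ℝ EQ]
    [TopologicalSpace HQ] [TopologicalSpace Q] [ChartedSpace HQ Q] {I : ModelWithCorners ℝ EQ HQ}
    {q₀ : Q} {n : ℕ} {r : Q → Fin (n + 1) → G}
    (hr : ∀ i, SmoothNear I 𝓘(ℝ, E) (fun q => r q i) q₀)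
    (hw : ∀ᶠ q in 𝓝 q₀, r q ∈ 𝒢.wordSet n) {w : Fin (n + 1) → G} (hrw : r q₀ = w) (η : EQ) :
    (mfderiv I (ModelWithCorners.pi fun _ : Fin (n + 1) => 𝓘(ℝ, E)) r q₀ η : Fin (n + 1) → E) ∈
      𝒢.wordTangent n w := by
  subst hrw
  intro i
  have hd : MDifferentiableAt I (ModelWithCorners.pi fun _ : Fin (n + 1) => 𝓘(ℝ, E)) r q₀ :=
    (contMDiffAt_pi_mk fun i => (hr i).contMDiffAt).mdifferentiableAt (by simp)
  have h1 := ((𝒢.src_smooth (r q₀ i.castSucc)).mdifferentiableAt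
    (by simp)).hasMFDerivAt.comp q₀ (hr i.castSucc).mdifferentiableAt.hasMFDerivAt
  have h2 := ((𝒢.tgt_smooth (r q₀ i.succ)).mdifferentiableAt
    (by simp)).hasMFDerivAt.comp q₀ (hr i.succ).mdifferentiableAt.hasMFDerivAt
  have h3 := hasMFDerivAt_unique h1 (h2.congr_of_eventuallyEq (hw.mono fun q hq => hq i))
  have h4 := congrArg (fun L : EQ →L[ℝ] F => L η) h3
  have e : ∀ i : Fin (n + 1), (mfderiv I (ModelWithCorners.pi fun _ : Fin (n + 1) => 𝓘(ℝ, E)) r q₀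
    η : Fin (n + 1) → E) i = (mfderiv I 𝓘(ℝ, E) (fun q => r q i) q₀ η : E) :=
      fun i => mfderiv_pi_apply hd i η
  rw [e, e]
  exact h4

/-- If the associators are uniformly discrete, `𝒜𝒞(G)` is smooth. -/
noncomputable def smoothQuotient (h : 𝒢.HasUniformlyDiscreteAssociators)
    (hI : 𝒢.IsInversional) (hC : 𝒢.HasProductsConnectedToAxes) (hA : 𝒢.IsThreeAssociative) :
    𝒢.SmoothQuotient where
  dim := Module.finrank ℝ E
  chartedSpace := acChartedSpace h hI hC hA
  isManifold := acIsManifold h hI hC hA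
  proj_submersion n := by
    let _ := acChartedSpace h hI hC hA
    have := acIsManifold h hI hC hA
    have hsm : ∀ c : 𝒢.WordChart hA (Module.finrank ℝ E),
        ContMDiffOn 𝓘(ℝ, EuclideanSpace ℝ (Fin (Module.finrank ℝ E))) 𝓘(ℝ, EuclideanSpace ℝ (Fin (Module.finrank ℝ E))) ∞
          c.toAC c.dom := fun c =>
      contMDiffOn_symm_of_mem_maximalAtlas (IsManifold.subset_maximalAtlas
        (show c.chart ∈ atlas (EuclideanSpace ℝ (Fin (Module.finrank ℝ E))) 𝒢.AC from ⟨c, rfl⟩))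
    have hcm : ∀ c : 𝒢.WordChart hA (Module.finrank ℝ E),
        ContMDiffOn 𝓘(ℝ, EuclideanSpace ℝ (Fin (Module.finrank ℝ E))) 𝓘(ℝ, EuclideanSpace ℝ (Fin (Module.finrank ℝ E))) ∞
          c.chart c.chart.source := fun c =>
      contMDiffOn_of_mem_maximalAtlas (IsManifold.subset_maximalAtlas
        (show c.chart ∈ atlas (EuclideanSpace ℝ (Fin (Module.finrank ℝ E))) 𝒢.AC from ⟨c, rfl⟩))
    have hsmooth : ContMDiffOn (ModelWithCorners.pi fun _ : Fin (n + 1) => 𝓘(ℝ, E))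
        𝓘(ℝ, EuclideanSpace ℝ (Fin (Module.finrank ℝ E))) ∞ (𝒢.proj n) (𝒢.wordSet n) := by
      intro w hw
      obtain ⟨c, p, hp, e⟩ := WordChart.exists_mem_source h hI hC hA (𝒢.proj n w)
      obtain ⟨f, hf, hf₀, h1⟩ := c.exists_coordinates_proj hw hp e.symm
      have h2 : ContMDiffAt (ModelWithCorners.pi fun _ : Fin (n + 1) => 𝓘(ℝ, E))
          𝓘(ℝ, EuclideanSpace ℝ (Fin (Module.finrank ℝ E))) ∞ (fun q => c.toAC (f q)) w :=
        (((hsm c).smoothNear (c.isOpen_dom.mem_nhds hp)).comp_of_eq hf hf₀).contMDiffAt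
      refine h2.contMDiffWithinAt.congr_of_eventuallyEq ?_ (by rw [hf₀, e])
      filter_upwards [mem_nhdsWithin_of_mem_nhds h1, self_mem_nhdsWithin] with q hq hqw
      exact hq.2 hqw
    refine ⟨hsmooth, fun w hw ζ => ?_⟩
    obtain ⟨c, p, hp, e⟩ := WordChart.exists_mem_source h hI hC hA (𝒢.proj n w)
    -- The family of words of the chart is transferred to an equivalent family through `w` itself.
    -- Its projection is `c.toAC`, inverted by the chart, so every tangent vector at the class is
    -- the image of a velocity of this family.
    obtain ⟨vs, h1, h2, h3⟩ := exists_smooth_transfer (hA := hA)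
      (((c.rep_toAC hp).eq_iff (rep_proj hw)).1 e) (c.smooth_word hp)
      ((c.isOpen_dom.eventually_mem hp).mono fun q hq => c.word_path hq) rfl
    obtain ⟨r, hr, hrv⟩ := vs.exists_ofFn_evalFun (n := n + 1)
      (by simpa [List.evalFun] using congrArg List.length h2)
    have hr₀ : r p = w := List.ofFn_injective ((hr p).trans h2)
    have hrs : ∀ i, SmoothNear 𝓘(ℝ, EuclideanSpace ℝ (Fin (Module.finrank ℝ E))) 𝓘(ℝ, E) (fun q => r q i) p :=
      fun i => h1 _ (hrv i)
    have h4 : ∀ᶠ q in 𝓝 p, r q ∈ 𝒢.wordSet n ∧ 𝒢.proj n (r q) = c.toAC q := by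
      filter_upwards [h3, c.isOpen_dom.eventually_mem hp] with q h3 hq
      refine proj_eq_of_rep ?_
      rw [hr]
      exact (rep_iff_of_eqvGen h3 _).1 (c.rep_toAC hq)
    have hrd : MDifferentiableAt 𝓘(ℝ, EuclideanSpace ℝ (Fin (Module.finrank ℝ E)))
        (ModelWithCorners.pi fun _ : Fin (n + 1) => 𝓘(ℝ, E)) r p :=
      (contMDiffAt_pi_mk fun i => (hrs i).contMDiffAt).mdifferentiableAt (by simp)
    have hpr : SmoothNear 𝓘(ℝ, EuclideanSpace ℝ (Fin (Module.finrank ℝ E))) 𝓘(ℝ, EuclideanSpace ℝ (Fin (Module.finrank ℝ E)))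
        (fun q => 𝒢.proj n (r q)) p :=
      ((hsm c).smoothNear (c.isOpen_dom.mem_nhds hp)).congr (h4.mono fun q hq => hq.2)
    have hsrc : 𝒢.proj n w ∈ c.chart.source := by
      rw [← e]; exact c.chart.map_target hp
    have hcw : c.chart (𝒢.proj n w) = p := by
      rw [← e]; exact c.chart.right_inv hp
    have hcs : SmoothNear 𝓘(ℝ, EuclideanSpace ℝ (Fin (Module.finrank ℝ E))) 𝓘(ℝ, EuclideanSpace ℝ (Fin (Module.finrank ℝ E)))
        c.chart (𝒢.proj n w) := (hcm c).smoothNear (c.chart.open_source.mem_nhds hsrc)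
    have hsurj := surjective_mfderiv_of_section hpr.mdifferentiableAt hcs.mdifferentiableAt hcw (by
      have := hcs.tendsto
      rw [hcw] at this
      filter_upwards [this.eventually h4, c.chart.open_source.mem_nhds hsrc] with m hm hms
      rw [hm.2]
      exact c.chart.left_inv hms)
    obtain ⟨η, hη⟩ := hsurj ζ
    refine ⟨_, mem_wordTangent_mfderiv hrs (h4.mono fun q hq => hq.1) hr₀ η, ?_⟩
    exact (mfderiv_comp_of_eventually_mem ((hsmooth w hw).mdifferentiableWithinAt (by simp)) hrd hr₀
      (h4.mono fun q hq => hq.1) η).symm.trans hη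

end LocalLieGroupoid

end SmoothQuotientPart

/-! ### The completion map is a local diffeomorphism, and smoothness implies uniform discreteness.
-/

section LocalDiffeomorphismPart
set_option linter.unusedSectionVars false
open Filter Relation

/-- A smooth map with a smooth local inverse is a local diffeomorphism. -/
theorem SmoothNear.isLocalDiffeomorphAt {E H N E' H' P : Type*}
    [NormedAddCommGroup E] [NormedSpace ℝ E] [TopologicalSpace H]
    [NormedAddCommGroup E'] [NormedSpace ℝ E'] [TopologicalSpace H']
    [TopologicalSpace N] [ChartedSpace H N] [TopologicalSpace P] [ChartedSpace H' P]
    {I : ModelWithCorners ℝ E H} {I' : ModelWithCorners ℝ E' H'} {f : N → P} {σ : P → N} {p : N}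
    (hf : SmoothNear I I' f p) (hσ : SmoothNear I' I σ (f p)) (h₁ : ∀ᶠ q in 𝓝 p, σ (f q) = q)
    (h₂ : ∀ᶠ m in 𝓝 (f p), f (σ m) = m) : IsLocalDiffeomorphAt I I' ∞ f p := by
  obtain ⟨U, hU, hUo, hpU⟩ := _root_.mem_nhds_iff.1 (hf.and h₁)
  obtain ⟨V, hV, hVo, hpV⟩ := _root_.mem_nhds_iff.1 (hσ.and h₂)
  have hfc : ContinuousOn f U := fun q hq => (hU hq).1.continuousAt.continuousWithinAt
  have hσc : ContinuousOn σ V := fun q hq => (hV hq).1.continuousAt.continuousWithinAt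
  refine ⟨{ toFun := f
            invFun := σ
            source := U ∩ f ⁻¹' V
            target := V ∩ σ ⁻¹' U
            map_source' := fun q hq => ⟨hq.2, ?_⟩
            map_target' := fun m hm => ⟨hm.2, ?_⟩
            left_inv' := fun q hq => (hU hq.1).2
            right_inv' := fun m hm => (hV hm.1).2
            open_source := hfc.isOpen_inter_preimage hUo hVo
            open_target := hσc.isOpen_inter_preimage hVo hUo
            contMDiffOn_toFun := fun q hq => (hU hq.1).1.contMDiffWithinAt
            contMDiffOn_invFun := fun m hm => (hV hm.1).1.contMDiffWithinAt },
    ⟨hpU, hpV⟩, fun _ _ => rfl⟩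
  · change σ (f q) ∈ U
    rw [(hU hq.1).2]; exact hq.1
  · change f (σ m) ∈ V
    rw [(hV hm.1).2]; exact hm.1

theorem List.Forall₂.ofFn_apply {α β : Type*} {n : ℕ} {R : α → β → Prop} {f : Fin n → α}
    {g : Fin n → β} (h : List.Forall₂ R (List.ofFn f) (List.ofFn g)) (i : Fin n) :
    R (f i) (g i) := by
  have := (List.forall₂_iff_get.1 h).2 i (by simp) (by simp)
  simpa only [List.get_eq_getElem, List.getElem_ofFn] using this

namespace LocalLieGroupoid

variable {E F G M : Type*}
  [NormedAddCommGroup E] [NormedSpace ℝ E] [NormedAddCommGroup F] [NormedSpace ℝ F]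
  [TopologicalSpace G] [ChartedSpace E G] [TopologicalSpace M] [ChartedSpace F M]
  {𝒢 : LocalLieGroupoid E F G M}

namespace SmoothQuotient

variable (S : 𝒢.SmoothQuotient)

/-- The projection from words to `𝒜𝒞(G)`. -/
noncomputable def proj (n : ℕ) : (Fin (n + 1) → G) → S.Space := 𝒢.proj n

theorem isSubmersionAlong_proj (n : ℕ) :
    IsSubmersionAlong (ModelWithCorners.pi fun _ : Fin (n + 1) => 𝓘(ℝ, E)) 𝓘(ℝ, S.Model)
      (S.proj n) (𝒢.wordSet n) (𝒢.wordTangent n) :=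
  S.proj_submersion n

variable [FiniteDimensional ℝ E] [FiniteDimensional ℝ F]
  [IsManifold 𝓘(ℝ, E) ∞ G] [IsManifold 𝓘(ℝ, F) ∞ M] {hA : 𝒢.IsThreeAssociative}
  {EQ HQ Q : Type*} [NormedAddCommGroup EQ] [NormedSpace ℝ EQ] [TopologicalSpace HQ]
  [TopologicalSpace Q] [ChartedSpace HQ Q] {I : ModelWithCorners ℝ EQ HQ} {q₀ : Q}

variable {S} in
/-- The class of a smooth family of words is a smooth function of the parameter. -/
theorem smoothNear_of_rep {vs : List (Q → G)} (hvs : ∀ v ∈ vs, SmoothNear I 𝓘(ℝ, E) v q₀)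
    {f : Q → S.Space} (hf : ∀ᶠ q in 𝓝 q₀, 𝒢.Rep (vs.evalFun q) (f q)) :
    SmoothNear I 𝓘(ℝ, S.Model) f q₀ := by
  obtain ⟨n, hn⟩ : ∃ n, vs.length = n + 1 := by
    refine Nat.exists_eq_succ_of_ne_zero fun h => ?_
    rw [List.length_eq_zero_iff] at h
    subst h
    exact hf.self_of_nhds.ne_nil rfl
  obtain ⟨r, hr, hrv⟩ := vs.exists_ofFn_evalFun hn
  have h1 : ∀ᶠ q in 𝓝 q₀, r q ∈ 𝒢.wordSet n ∧ 𝒢.proj n (r q) = f q :=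
    hf.mono fun q hq => proj_eq_of_rep (by rw [hr]; exact hq)
  have h2 : ∀ᶠ q in 𝓝 q₀, ∀ i, ContMDiffAt I 𝓘(ℝ, E) ∞ (fun q => r q i) q :=
    eventually_all.2 fun i => hvs _ (hrv i)
  filter_upwards [h1.eventually_nhds, h2] with q h1 h2
  have h3 := (S.isSubmersionAlong_proj n).1 (r q) h1.self_of_nhds.1
  have h4 := ContMDiffWithinAt.comp q h3
    ((contMDiffAt_pi_mk h2).contMDiffWithinAt (s := {q | r q ∈ 𝒢.wordSet n})) (fun _ h => h)
  refine (h4.contMDiffAt (h1.mono fun q hq => hq.1)).congr_of_eventuallyEq ?_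
  exact h1.mono fun q hq => hq.2.symm

variable {S} in
/-- Smooth local lifts from `𝒜𝒞(G)` to words. -/
theorem exists_smooth_lift (hA : 𝒢.IsThreeAssociative) {l : List G} {a₀ : S.Space}
    (hl : 𝒢.Rep l a₀) :
    ∃ vs : List (S.Space → G), (∀ v ∈ vs, SmoothNear 𝓘(ℝ, S.Model) 𝓘(ℝ, E) v a₀) ∧
      vs.evalFun a₀ = l ∧ ∀ᶠ a in 𝓝 a₀, 𝒢.Rep (vs.evalFun a) a := by
  obtain ⟨⟨n, w, hw⟩, rfl, ha⟩ := hl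
  have hl : 𝒢.Rep (List.ofFn w) a₀ := ⟨⟨n, w, hw⟩, rfl, ha⟩
  obtain ⟨ts, y, x, h1, h2, h3, -, h4⟩ := exists_tautological_family hA hw
  have hlen : ts.length = n + 1 := by
    simpa [List.evalFun] using congrArg List.length h2
  obtain ⟨g, rfl⟩ : ∃ g : Fin (n + 1) → (Fin (n + 1) → G) → G, ts = List.ofFn g := by
    refine ⟨fun i => ts.get (i.cast hlen.symm), ?_⟩
    apply List.ext_getElem
    · simp [hlen]
    · intro m h1 h2
      simp only [List.getElem_ofFn, List.get_eq_getElem, Fin.val_cast]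
  have hge : ∀ q, (List.ofFn g).evalFun q = List.ofFn fun i => g i q := fun q => by
    simp [List.evalFun, List.map_ofFn, Function.comp_def]
  have hg : ∀ i, SmoothNear (ModelWithCorners.pi fun _ : Fin (n + 1) => 𝓘(ℝ, E)) 𝓘(ℝ, E)
    (g i) w := fun i => h1 _ (List.mem_ofFn.2 ⟨i, rfl⟩)
  have hgw : (fun i => g i w) = w := List.ofFn_injective ((hge w).symm.trans h2)
  have hgS : ∀ᶠ q in 𝓝 w, (fun i => g i q) ∈ 𝒢.wordSet n := by
    filter_upwards [h3] with q h3
    obtain ⟨b, hb⟩ := exists_rep_of_isPath (by simp [List.ofFn_succ]) h3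
    rw [hge] at hb
    exact (proj_eq_of_rep hb).1
  -- Composing the projection with the correction onto composable tuples gives a map smooth on a
  -- neighbourhood in the full power of `G`. On `wordTangent` the correction is the identity to
  -- first order, so the differential remains onto.
  let f : (Fin (n + 1) → G) → S.Space := fun q => S.proj n fun i => g i q
  have hfw : f w = a₀ := by
    simp only [f, hgw]
    exact (proj_eq_of_rep hl).2
  have hfs : SmoothNear (ModelWithCorners.pi fun _ : Fin (n + 1) => 𝓘(ℝ, E)) 𝓘(ℝ, S.Model) f w := by
    refine smoothNear_of_rep h1 (hgS.mono fun q hq => ?_)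
    rw [hge]
    exact rep_proj hq
  have hgd : MDifferentiableAt (ModelWithCorners.pi fun _ : Fin (n + 1) => 𝓘(ℝ, E))
      (ModelWithCorners.pi fun _ : Fin (n + 1) => 𝓘(ℝ, E)) (fun q i => g i q) w :=
    (contMDiffAt_pi_mk fun i => (hg i).contMDiffAt).mdifferentiableAt (by simp)
  have hsurj : Function.Surjective (mfderiv (ModelWithCorners.pi fun _ : Fin (n + 1) => 𝓘(ℝ, E))
      𝓘(ℝ, S.Model) f w) := by
    intro ζ
    obtain ⟨v, hv, e⟩ := (S.isSubmersionAlong_proj n).2 w hw ζ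
    refine ⟨v, ?_⟩
    have h5 := mfderiv_comp_of_eventually_mem
      (((S.isSubmersionAlong_proj n).1 w hw).mdifferentiableWithinAt (by simp)) hgd hgw hgS v
    refine h5.trans (Eq.trans ?_ e)
    have h6 : (mfderiv (ModelWithCorners.pi fun _ : Fin (n + 1) => 𝓘(ℝ, E))
        (ModelWithCorners.pi fun _ : Fin (n + 1) => 𝓘(ℝ, E)) (fun q i => g i q) w v :
          Fin (n + 1) → E) = v := by
      funext i
      refine (mfderiv_pi_apply hgd i v).trans ?_
      exact (h4 v hv).ofFn_apply i
    rw [h6]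
  obtain ⟨σ, hσ, hσ₀, e⟩ := hfs.exists_section hsurj
  rw [hfw] at hσ hσ₀ e
  have hσe : ∀ a, ((List.ofFn g).map fun t a => t (σ a)).evalFun a =
      (List.ofFn g).evalFun (σ a) := fun a => by
    simp only [List.evalFun, List.map_map]; rfl
  refine ⟨(List.ofFn g).map fun t a => t (σ a), ?_, ?_, ?_⟩
  · intro v hv
    obtain ⟨t, ht, rfl⟩ := List.mem_map.1 hv
    exact (h1 t ht).comp_of_eq hσ hσ₀
  · rw [hσe, hσ₀, h2]
    rfl
  · have := hσ.tendsto
    rw [hσ₀] at this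
    filter_upwards [this.eventually hgS, e] with a h5 h6
    rw [hσe, hge]
    have h7 := rep_proj h5
    exact Eq.subst (motive := fun b => 𝒢.Rep (List.ofFn fun i => g i (σ a)) b) h6 h7

theorem smoothNear_completion (g : G) : SmoothNear 𝓘(ℝ, E) 𝓘(ℝ, S.Model) S.completion g :=
  smoothNear_of_rep (vs := [fun g => g]) (by
    intro v hv
    rw [List.mem_singleton] at hv
    subst hv
    exact smoothNear_id g) (Eventually.of_forall fun g => rep_completion g)

theorem contMDiff_completion : ContMDiff 𝓘(ℝ, E) 𝓘(ℝ, S.Model) ∞ S.completion :=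
  fun g => (S.smoothNear_completion g).contMDiffAt

/-- The smooth lift through a word of length one again has length one, so it is a local section of
the completion map. -/
theorem surjective_mfderiv_completion (hA : 𝒢.IsThreeAssociative) (g : G) :
    Function.Surjective (mfderiv 𝓘(ℝ, E) 𝓘(ℝ, S.Model) S.completion g) := by
  obtain ⟨vs, h1, h2, h3⟩ := exists_smooth_lift (S := S) hA (a₀ := S.completion g)
    (rep_completion g)
  obtain _ | ⟨σ, _ | ⟨_, _⟩⟩ := vs
  · simp at h2
  · have h2 : σ (S.completion g) = g := by simpa using h2
    exact surjective_mfderiv_of_section (S.smoothNear_completion g).mdifferentiableAt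
      (h1 σ (by simp)).mdifferentiableAt h2 (h3.mono fun a ha => (rep_completion _).eq ha)
  · simp at h2

/-- The completion map has smooth local inverses. -/
theorem exists_local_inverse (hA : 𝒢.IsThreeAssociative) (hI : 𝒢.IsInversional)
    (hC : 𝒢.HasProductsConnectedToAxes) (g₀ : G) :
    ∃ σ : S.Space → G, SmoothNear 𝓘(ℝ, S.Model) 𝓘(ℝ, E) σ (S.completion g₀) ∧
      (∀ᶠ a in 𝓝 (S.completion g₀), S.completion (σ a) = a) ∧
      ∀ᶠ g in 𝓝 g₀, σ (S.completion g) = g := by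
  have hT := hI.toTop (hA := hA)
  obtain ⟨K, κ, ψ, -, hκ, hψ, h1, h2⟩ := (S.smoothNear_completion g₀).exists_adapted_chart
    (S.surjective_mfderiv_completion hA g₀)
  -- `K` parametrizes the fibre of the completion map through `g₀`. That fibre is locally countable,
  -- which a nonzero real vector space is not.
  have hK : Subsingleton K := by
    by_contra hK
    rw [not_subsingleton_iff_nontrivial] at hK
    have hpt : Tendsto (fun k : K => (S.completion g₀, k)) (𝓝 (κ g₀))
        (𝓝 (S.completion g₀, κ g₀)) := tendsto_const_nhds.prodMk_nhds tendsto_id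
    set f : K → G := fun k => ψ (S.completion g₀, k) with hf
    have e₁ : ∀ᶠ k in 𝓝 (κ g₀), S.completion (f k) = S.completion g₀ ∧ κ (f k) = k :=
      hpt.eventually h1
    have hf₀ : f (κ g₀) = g₀ := h2.self_of_nhds
    have hft : Tendsto f (𝓝 (κ g₀)) (𝓝 g₀) := by
      have := hψ.tendsto.comp hpt
      rwa [show ψ (S.completion g₀, κ g₀) = g₀ from hf₀] at this
    have e₂ : ∀ᶠ k in 𝓝 (κ g₀), EqvGen (𝒢.toTop hA).Red [f k] [g₀] :=
      e₁.mono fun k hk => ((rep_completion _).eq_iff (hA := hA) (rep_completion _)).1 hk.1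
    obtain ⟨k', -, e₃⟩ := hT.exists_right_div hft (e₂.mono fun k hk =>
      ((TopLocalGroupoid.eqvGen_isPath_iff hk (y := 𝒢.tgt (f k)) (x := 𝒢.src (f k))).1
        ⟨rfl, rfl⟩).2.symm)
    -- Right division writes points of the fibre as `k' g₀`. Replacing `g₀` by a word with
    -- invertible letters allows it to be cancelled from `k' g₀ ∼ g₀`, so `k'` has the class of a
    -- unit and is an associator.
    obtain ⟨l, hl, hlg⟩ := hT g₀
    have e₄ : ∀ᶠ k in 𝓝 (κ g₀), k' k ∈ (𝒢.toTop hA).AssocAt (𝒢.tgt g₀) := by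
      filter_upwards [e₂, e₃] with k h4 h5
      have r₁ := EqvGen.rel _ _ (TopLocalGroupoid.Red.head [] h5.1)
      rw [h5.2] at r₁
      have r₂ := (TopLocalGroupoid.eqvGen_unit_left (T := 𝒢.toTop hA) (l := [g₀]) (by simp)
        (y := 𝒢.tgt g₀) (x := 𝒢.src g₀) ⟨rfl, rfl⟩).symm
      have r₃ : EqvGen (𝒢.toTop hA).Red ([k' k] ++ l) ([𝒢.unit (𝒢.tgt g₀)] ++ l) :=
        ((TopLocalGroupoid.eqvGen_append_left _ hlg.eqvGen).trans _ _ _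
          ((r₁.trans _ _ _ h4).trans _ _ _ r₂)).trans _ _ _
          (TopLocalGroupoid.eqvGen_append_left _ hlg.eqvGen).symm
      have r₄ := TopLocalGroupoid.eqvGen_cancel_right (T := 𝒢.toTop hA) hl (a := [k' k])
        (a' := [𝒢.unit (𝒢.tgt g₀)]) (by simp) (by simp)
        (y := 𝒢.tgt (k' k)) (y' := 𝒢.tgt g₀) (z := 𝒢.tgt g₀) (x := 𝒢.src g₀)
        ⟨rfl, (𝒢.toTop hA).composable h5.1⟩ ⟨𝒢.tgt_unit _, 𝒢.src_unit _⟩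
        (hlg.isPath_iff.2 ⟨rfl, rfl⟩) r₃
      exact mem_assoc_of_completion_eq hI hC hA
        (((rep_completion _).eq_iff (hA := hA) (rep_completion _)).2 r₄)
    have : SecondCountableTopology G := 𝒢.secondCountable
    have hcount := hT.countable_assocAt (𝒢.tgt g₀)
    have e₅ := (e₁.and e₃).and e₄
    -- The associator `k' k` determines the parameter, since `k = κ (f k)` and `f k` is the product
    -- of `k' k` with `g₀`. Countability of associators therefore passes to a neighbourhood in `K`.
    have hO : {k | ((S.completion (f k) = S.completion g₀ ∧ κ (f k) = k) ∧
        (k' k, g₀) ∈ (𝒢.toTop hA).mulDom ∧ (𝒢.toTop hA).mul (k' k) g₀ = f k) ∧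
        k' k ∈ (𝒢.toTop hA).AssocAt (𝒢.tgt g₀)}.Countable := by
      refine Set.MapsTo.countable_of_injOn (f := k') (fun k hk => hk.2) ?_ hcount
      intro k hk m hm hkm
      rw [← hk.1.1.2, ← hm.1.1.2, ← hk.1.2.2, ← hm.1.2.2, hkm]
    obtain ⟨k, hk, hk'⟩ := (mem_closure_iff_nhds.1 (hO.dense_compl ℝ (κ g₀))) _ e₅
    exact hk' hk
  have hpt : Tendsto (fun a : S.Space => (a, κ g₀)) (𝓝 (S.completion g₀))
      (𝓝 (S.completion g₀, κ g₀)) := tendsto_id.prodMk_nhds tendsto_const_nhds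
  refine ⟨fun a => ψ (a, κ g₀), ?_, (hpt.eventually h1).mono fun a ha => ha.1, ?_⟩
  · exact SmoothNear.comp (g := ψ) (f := fun a => (a, κ g₀)) hψ
      ((smoothNear_id _).prodMk (smoothNear_const _ _))
  · filter_upwards [h2] with g hg
    -- Since `K` is a point, the section `ψ (·, κ g₀)` is also a left inverse.
    rwa [Subsingleton.elim (κ g₀) (κ g)]

theorem isLocalDiffeomorph_completion (hA : 𝒢.IsThreeAssociative) (hI : 𝒢.IsInversional)
    (hC : 𝒢.HasProductsConnectedToAxes) :
    IsLocalDiffeomorph 𝓘(ℝ, E) 𝓘(ℝ, S.Model) ∞ S.completion := by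
  intro g
  obtain ⟨σ, hσ, h1, h2⟩ := S.exists_local_inverse hA hI hC g
  exact (S.smoothNear_completion g).isLocalDiffeomorphAt hσ h2 h1

/-- An associator has the same class as the unit at its source. The neighbourhood is chosen so that
`g` and this unit always lie in a common set on which the completion map is injective. -/
theorem hasUniformlyDiscreteAssociators (S : 𝒢.SmoothQuotient) (hA : 𝒢.IsThreeAssociative) (hI : 𝒢.IsInversional)
    (hC : 𝒢.HasProductsConnectedToAxes) : 𝒢.HasUniformlyDiscreteAssociators := by
  have h : ∀ x, ∃ O : Set G, IsOpen O ∧ 𝒢.unit x ∈ O ∧ Set.InjOn S.completion O := by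
    intro x
    obtain ⟨σ, hσ, h1, h2⟩ := S.exists_local_inverse hA hI hC (𝒢.unit x)
    obtain ⟨O, hO, hOo, hx⟩ := _root_.mem_nhds_iff.1 h2
    refine ⟨O, hOo, hx, fun g hg g' hg' e => ?_⟩
    have h3 : σ (S.completion g) = g := hO hg
    have h4 : σ (S.completion g') = g' := hO hg'
    rw [← h3, e, h4]
  choose O hO hxO hinj using h
  refine ⟨⋃ x, O x ∩ (fun g => 𝒢.unit (𝒢.src g)) ⁻¹' O x, isOpen_iUnion fun x =>
    (hO x).inter ((hO x).preimage
      (𝒢.unit_smooth.continuous.comp 𝒢.src_smooth.continuous)), ?_, ?_⟩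
  · rintro _ ⟨x, rfl⟩
    refine Set.mem_iUnion.2 ⟨x, hxO x, ?_⟩
    simp only [Set.mem_preimage, 𝒢.src_unit]
    exact hxO x
  · refine Set.Subset.antisymm ?_ ?_
    · rintro g ⟨hg, hgA⟩
      obtain ⟨x, hx, hx'⟩ := Set.mem_iUnion.1 hg
      obtain ⟨-, l, h1, h2⟩ := (mem_assoc_iff (hA := hA)).1 hgA
      have h3 : S.completion g = S.completion (𝒢.unit (𝒢.src g)) :=
        ((rep_completion _).eq_iff (hA := hA) (rep_completion _)).2
          (h2.eqvGen.symm.trans _ _ _ h1.eqvGen)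
      exact ⟨_, (hinj x hx hx' h3).symm⟩
    · rintro _ ⟨x, rfl⟩
      refine ⟨Set.mem_iUnion.2 ⟨x, hxO x, ?_⟩, ?_⟩
      · simp only [Set.mem_preimage, 𝒢.src_unit]
        exact hxO x
      · refine (mem_assoc_iff (hA := hA)).2 ⟨by rw [𝒢.src_unit, 𝒢.tgt_unit], [𝒢.unit x], ?_, ?_⟩
        · rw [𝒢.src_unit]
        · exact ReflTransGen.refl

end SmoothQuotient

end LocalLieGroupoid

end LocalDiffeomorphismPart

/-! ### The algebraic groupoid structure on classes of words. -/

section CompletionAlgebraPart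
set_option linter.unusedSectionVars false
open Filter Relation

namespace TopLocalGroupoid

variable {G M : Type*} [TopologicalSpace G] [TopologicalSpace M] {T : TopLocalGroupoid G M}

/-- The inverse of a word with invertible letters. -/
def invWord (T : TopLocalGroupoid G M) (l : List G) : List G := (l.map T.inv).reverse

theorem isPath_invWord {l : List G} (hl : ∀ g ∈ l, g ∈ T.invDom) {y x : M}
    (h : T.IsPath y l x) : T.IsPath x (T.invWord l) y := by
  induction l generalizing y with
  | nil => exact Eq.symm h
  | cons g l ih =>
    have hg := hl g (by simp)
    have := ih (fun a ha => hl a (by simp [ha])) h.2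
    simp only [invWord, List.map_cons, List.reverse_cons]
    exact isPath_append.2 ⟨_, this, T.tgt_inv _ hg, by rw [isPath_nil, T.src_inv _ hg, h.1]⟩

/-- Letters cancel from the middle outwards, hence the induction from the right. The leading unit
covers the empty word, which is not equivalent to any unit. -/
theorem eqvGen_append_invWord {l : List G} (hl : ∀ g ∈ l, g ∈ T.invDom) {y x : M}
    (h : T.IsPath y l x) : EqvGen T.Red (T.unit y :: (l ++ T.invWord l)) [T.unit y] := by
  induction l using List.reverseRecOn generalizing x with
  | nil => exact .refl _
  | append_singleton l g ih =>
    obtain ⟨z, h1, h2, -⟩ := isPath_append.1 h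
    subst h2
    have hg := hl g (by simp)
    refine EqvGen.trans _ _ _ ?_ (ih (fun a ha => hl a (by simp [ha])) h1)
    have e : T.unit y :: (l ++ [g] ++ T.invWord (l ++ [g])) =
        (T.unit y :: l) ++ ([g, T.inv g] ++ T.invWord l) := by
      simp [invWord]
    have r₁ := eqvGen_append_left (T.unit y :: l) (eqvGen_append_right (T.invWord l)
      (eqvGen_mul_inv hg))
    have r₂ := eqvGen_append_right (T.invWord l) (eqvGen_unit_right (T := T)
      (l := T.unit y :: l) (by simp) (y := y) (x := T.tgt g)
      ⟨T.tgt_unit y, by rw [T.src_unit]; exact h1⟩)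
    rw [e]
    refine r₁.trans _ _ _ ?_
    simpa using r₂

/-- Here the innermost pair involves the first letter of `l`. The trailing unit again keeps the
remaining word nonempty. -/
theorem eqvGen_invWord_append {l : List G} (hl : ∀ g ∈ l, g ∈ T.invDom) {y x : M}
    (h : T.IsPath y l x) : EqvGen T.Red (T.invWord l ++ (l ++ [T.unit x])) [T.unit x] := by
  induction l generalizing y with
  | nil => exact .refl _
  | cons g l ih =>
    have hg := hl g (by simp)
    refine EqvGen.trans _ _ _ ?_ (ih (fun a ha => hl a (by simp [ha])) h.2)
    have e : T.invWord (g :: l) ++ (g :: l ++ [T.unit x]) =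
        T.invWord l ++ ([T.inv g, g] ++ (l ++ [T.unit x])) := by
      simp [invWord]
    have r₁ := eqvGen_append_left (T.invWord l) (eqvGen_append_right (l ++ [T.unit x])
      (eqvGen_inv_mul hg))
    have r₂ := eqvGen_append_left (T.invWord l) (eqvGen_unit_left (T := T)
      (l := l ++ [T.unit x]) (by simp) (y := T.src g) (x := x)
      (isPath_append.2 ⟨x, h.2, T.tgt_unit x, T.src_unit x⟩))
    rw [e]
    exact r₁.trans _ _ _ r₂

end TopLocalGroupoid

namespace LocalLieGroupoid

variable {E F G M : Type*}
  [NormedAddCommGroup E] [NormedSpace ℝ E] [NormedAddCommGroup F] [NormedSpace ℝ F]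
  [TopologicalSpace G] [ChartedSpace E G] [TopologicalSpace M] [ChartedSpace F M]
  {𝒢 : LocalLieGroupoid E F G M}
  [FiniteDimensional ℝ E] [FiniteDimensional ℝ F]
  [IsManifold 𝓘(ℝ, E) ∞ G] [IsManifold 𝓘(ℝ, F) ∞ M] (hA : 𝒢.IsThreeAssociative)

namespace AC

variable (𝒢) in
/-- The units of `𝒜𝒞(G)`. -/
def unit (x : M) : 𝒢.AC := 𝒢.completion (𝒢.unit x)

theorem rep_unit (x : M) : 𝒢.Rep [𝒢.unit x] (unit 𝒢 x) := rep_completion _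

theorem src_unit (x : M) : src hA (unit 𝒢 x) = x := 𝒢.src_unit x

theorem tgt_unit (x : M) : tgt hA (unit 𝒢 x) = x := 𝒢.tgt_unit x

theorem exists_mul {a b : 𝒢.AC} (h : src hA a = tgt hA b) :
    ∃ c, ∀ l l', 𝒢.Rep l a → 𝒢.Rep l' b → 𝒢.Rep (l ++ l') c := by
  obtain ⟨l₀, h₀⟩ := exists_rep a
  obtain ⟨l₁, h₁⟩ := exists_rep b
  obtain ⟨c, hc⟩ := h₀.exists_append h₁ h
  refine ⟨c, fun l l' hl hl' => ?_⟩
  exact (rep_iff_of_eqvGen (TopLocalGroupoid.eqvGen_append (T := 𝒢.toTop hA)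
    ((h₀.eq_iff hl).1 rfl) ((h₁.eq_iff hl').1 rfl)) c).1 hc

open Classical in
/-- Juxtaposition of words. -/
noncomputable def mul (a b : 𝒢.AC) : 𝒢.AC :=
  if h : src hA a = tgt hA b then (exists_mul hA h).choose else a

variable {hA}

theorem rep_mul {a b : 𝒢.AC} (h : src hA a = tgt hA b) {l l' : List G} (hl : 𝒢.Rep l a)
    (hl' : 𝒢.Rep l' b) : 𝒢.Rep (l ++ l') (mul hA a b) := by
  rw [mul, dif_pos h]
  exact (exists_mul hA h).choose_spec l l' hl hl'

theorem src_mul {a b : 𝒢.AC} (h : src hA a = tgt hA b) : src hA (mul hA a b) = src hA b := by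
  obtain ⟨l, hl⟩ := exists_rep a
  obtain ⟨l', hl'⟩ := exists_rep b
  exact (rep_mul h hl hl').src_eq (y := tgt hA a) (TopLocalGroupoid.isPath_append.2
    ⟨_, hl.isPath, by rw [h]; exact hl'.isPath⟩)

theorem tgt_mul {a b : 𝒢.AC} (h : src hA a = tgt hA b) : tgt hA (mul hA a b) = tgt hA a := by
  obtain ⟨l, hl⟩ := exists_rep a
  obtain ⟨l', hl'⟩ := exists_rep b
  exact (rep_mul h hl hl').tgt_eq (x := src hA b) (TopLocalGroupoid.isPath_append.2
    ⟨_, hl.isPath, by rw [h]; exact hl'.isPath⟩)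

theorem mul_unit (a : 𝒢.AC) : mul hA a (unit 𝒢 (src hA a)) = a := by
  obtain ⟨l, hl⟩ := exists_rep a
  exact ((rep_mul (tgt_unit hA _).symm hl (rep_unit _)).eq_iff (hA := hA) hl).2
    (TopLocalGroupoid.eqvGen_unit_right (T := 𝒢.toTop hA) hl.ne_nil hl.isPath)

theorem unit_mul (a : 𝒢.AC) : mul hA (unit 𝒢 (tgt hA a)) a = a := by
  obtain ⟨l, hl⟩ := exists_rep a
  exact ((rep_mul (src_unit hA _) (rep_unit _) hl).eq_iff (hA := hA) hl).2
    (TopLocalGroupoid.eqvGen_unit_left (T := 𝒢.toTop hA) hl.ne_nil hl.isPath)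

theorem mul_assoc {a b c : 𝒢.AC} (h : src hA a = tgt hA b) (h' : src hA b = tgt hA c) :
    mul hA (mul hA a b) c = mul hA a (mul hA b c) := by
  obtain ⟨l, hl⟩ := exists_rep a
  obtain ⟨l', hl'⟩ := exists_rep b
  obtain ⟨l'', hl''⟩ := exists_rep c
  have h1 := rep_mul (hA := hA) ((src_mul h).trans h') (rep_mul h hl hl') hl''
  have h2 := rep_mul (hA := hA) (h.trans (tgt_mul h').symm) hl (rep_mul h' hl' hl'')
  rw [List.append_assoc] at h1
  exact h1.eq h2

theorem exists_inv (hI : 𝒢.IsInversional) (a : 𝒢.AC) :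
    ∃ c, src hA c = tgt hA a ∧ tgt hA c = src hA a ∧ mul hA c a = unit 𝒢 (src hA a) ∧
      mul hA a c = unit 𝒢 (tgt hA a) ∧ ∃ l, (∀ g ∈ l, g ∈ 𝒢.invDom) ∧ 𝒢.Rep l a := by
  obtain ⟨l₀, hl₀⟩ := exists_rep a
  obtain ⟨l, hl, hll⟩ := (hI.toTop (hA := hA)).exists_redStar l₀
  replace hl₀ : 𝒢.Rep l a := (rep_iff_of_eqvGen hll.eqvGen a).2 hl₀
  have hp := TopLocalGroupoid.isPath_invWord hl (hl₀.isPath (hA := hA))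
  have hne : (𝒢.toTop hA).invWord l ≠ [] := by
    simpa [TopLocalGroupoid.invWord] using hl₀.ne_nil
  obtain ⟨c, hc⟩ := exists_rep_of_isPath hne hp
  have h1 : src hA c = tgt hA a := hc.src_eq hp
  have h2 : tgt hA c = src hA a := hc.tgt_eq hp
  refine ⟨c, h1, h2, ?_, ?_, l, hl, hl₀⟩
  · refine ((rep_mul h1 hc hl₀).eq_iff (hA := hA) (rep_unit _)).2 ?_
    refine EqvGen.trans _ _ _ ?_
      (TopLocalGroupoid.eqvGen_invWord_append hl (hl₀.isPath (hA := hA)))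
    exact TopLocalGroupoid.eqvGen_append_left _
      (TopLocalGroupoid.eqvGen_unit_right hl₀.ne_nil (hl₀.isPath (hA := hA))).symm
  · refine ((rep_mul h2.symm hl₀ hc).eq_iff (hA := hA) (rep_unit _)).2 ?_
    refine EqvGen.trans _ _ _ ?_
      (TopLocalGroupoid.eqvGen_append_invWord hl (hl₀.isPath (hA := hA)))
    exact (TopLocalGroupoid.eqvGen_unit_left (T := 𝒢.toTop hA) (by simp [hl₀.ne_nil])
      (TopLocalGroupoid.isPath_append.2 ⟨_, hl₀.isPath, hp⟩)).symm

/-- Inversion in `𝒜𝒞(G)`. -/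
noncomputable def inv (hA : 𝒢.IsThreeAssociative) (hI : 𝒢.IsInversional) (a : 𝒢.AC) : 𝒢.AC :=
  (exists_inv (hA := hA) hI a).choose

variable (hI : 𝒢.IsInversional) (a : 𝒢.AC)

theorem src_inv : src hA (inv hA hI a) = tgt hA a := (exists_inv hI a).choose_spec.1

theorem tgt_inv : tgt hA (inv hA hI a) = src hA a := (exists_inv hI a).choose_spec.2.1

theorem inv_mul : mul hA (inv hA hI a) a = unit 𝒢 (src hA a) :=
  (exists_inv hI a).choose_spec.2.2.1

theorem mul_inv : mul hA a (inv hA hI a) = unit 𝒢 (tgt hA a) :=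
  (exists_inv hI a).choose_spec.2.2.2.1

theorem exists_invertible_rep (hA : 𝒢.IsThreeAssociative) (hI : 𝒢.IsInversional) (a : 𝒢.AC) :
    ∃ l, (∀ g ∈ l, g ∈ 𝒢.invDom) ∧ 𝒢.Rep l a :=
  (exists_inv (hA := hA) hI a).choose_spec.2.2.2.2

variable {a}

/-- `c = c (a a⁻¹) = (c a) a⁻¹ = a⁻¹`. -/
theorem eq_inv_of_mul_eq_unit {c : 𝒢.AC} (h : src hA c = tgt hA a)
    (h' : mul hA c a = unit 𝒢 (src hA a)) : c = inv hA hI a := by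
  have h1 := mul_assoc (hA := hA) h (tgt_inv hI a).symm
  rw [h', mul_inv, ← tgt_inv hI a, unit_mul, ← h, mul_unit] at h1
  exact h1.symm

theorem inv_inv : inv hA hI (inv hA hI a) = a :=
  (eq_inv_of_mul_eq_unit hI (tgt_inv hI a).symm (by rw [mul_inv, src_inv])).symm

/-- This identifies the chosen inverse with the word of inverted letters in reverse order, which
depends smoothly on the letters; smoothness of inversion rests on it. -/
theorem rep_inv {l : List G} (hl : ∀ g ∈ l, g ∈ 𝒢.invDom) (h : 𝒢.Rep l a) :
    𝒢.Rep ((𝒢.toTop hA).invWord l) (inv hA hI a) := by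
  have hp := TopLocalGroupoid.isPath_invWord hl (h.isPath (hA := hA))
  have hne : (𝒢.toTop hA).invWord l ≠ [] := by
    simpa [TopLocalGroupoid.invWord] using h.ne_nil
  obtain ⟨c, hc⟩ := exists_rep_of_isPath hne hp
  have h1 : src hA c = tgt hA a := hc.src_eq hp
  rw [← eq_inv_of_mul_eq_unit hI h1]
  · exact hc
  refine ((rep_mul h1 hc h).eq_iff (hA := hA) (rep_unit _)).2 ?_
  refine EqvGen.trans _ _ _ ?_ (TopLocalGroupoid.eqvGen_invWord_append hl (h.isPath (hA := hA)))
  exact TopLocalGroupoid.eqvGen_append_left _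
    (TopLocalGroupoid.eqvGen_unit_right h.ne_nil (h.isPath (hA := hA))).symm

end AC

end LocalLieGroupoid

end CompletionAlgebraPart

/-! ### Smoothness of the groupoid operations, and the topology of the completion. -/

section CompletionGroupoidPart
set_option linter.unusedSectionVars false
open Filter Relation

namespace LocalLieGroupoid

variable {E F G M : Type*}
  [NormedAddCommGroup E] [NormedSpace ℝ E] [NormedAddCommGroup F] [NormedSpace ℝ F]
  [TopologicalSpace G] [ChartedSpace E G] [TopologicalSpace M] [ChartedSpace F M]
  {𝒢 : LocalLieGroupoid E F G M}
  [FiniteDimensional ℝ E] [FiniteDimensional ℝ F]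
  [IsManifold 𝓘(ℝ, E) ∞ G] [IsManifold 𝓘(ℝ, F) ∞ M]

namespace SmoothQuotient

section Operations

variable {EQ HQ Q : Type*} [NormedAddCommGroup EQ] [NormedSpace ℝ EQ] [TopologicalSpace HQ]
  [TopologicalSpace Q] [ChartedSpace HQ Q] {I : ModelWithCorners ℝ EQ HQ} {q₀ : Q}
  (S : 𝒢.SmoothQuotient) (hA : 𝒢.IsThreeAssociative) (hI : 𝒢.IsInversional)

/-- The source map of `𝒜𝒞(G)`. -/
def src (a : S.Space) : M := AC.src hA a

/-- The target map of `𝒜𝒞(G)`. -/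
def tgt (a : S.Space) : M := AC.tgt hA a

/-- The multiplication of `𝒜𝒞(G)`. -/
noncomputable def mul (a b : S.Space) : S.Space := AC.mul hA a b

/-- The inversion of `𝒜𝒞(G)`. -/
noncomputable def inv (a : S.Space) : S.Space := AC.inv hA hI a

theorem smooth_src_tgt (a₀ : S.Space) :
    SmoothNear 𝓘(ℝ, S.Model) 𝓘(ℝ, F) (S.tgt hA) a₀ ∧
      SmoothNear 𝓘(ℝ, S.Model) 𝓘(ℝ, F) (S.src hA) a₀ := by
  obtain ⟨l, hl⟩ := exists_rep (𝒢 := 𝒢) a₀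
  obtain ⟨vs, h1, h2, h3⟩ := exists_smooth_lift (S := S) hA hl
  exact smoothNear_of_isPath (hA := hA) (by rintro rfl; exact hl.ne_nil h2.symm) h1
    (h3.mono fun a ha => ha.isPath)

theorem contMDiff_src : ContMDiff 𝓘(ℝ, S.Model) 𝓘(ℝ, F) ∞ (S.src hA) :=
  fun a => (S.smooth_src_tgt hA a).2.contMDiffAt

theorem contMDiff_tgt : ContMDiff 𝓘(ℝ, S.Model) 𝓘(ℝ, F) ∞ (S.tgt hA) :=
  fun a => (S.smooth_src_tgt hA a).1.contMDiffAt

/-- A smooth lift through a word with invertible letters keeps its letters invertible nearby, and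
the inverse class is then represented by the inverse words. -/
theorem contMDiff_inv : ContMDiff 𝓘(ℝ, S.Model) 𝓘(ℝ, S.Model) ∞ (S.inv hA hI) := by
  intro a₀
  obtain ⟨l, hl, hla⟩ := AC.exists_invertible_rep (𝒢 := 𝒢) hA hI a₀
  obtain ⟨vs, h1, h2, h3⟩ := exists_smooth_lift (S := S) hA hla
  have hinv : ∀ v ∈ vs, v a₀ ∈ 𝒢.invDom := fun v hv => hl _ (by
    rw [← h2]; exact List.mem_map.2 ⟨v, hv, rfl⟩)
  have h4 : ∀ᶠ a in 𝓝 a₀, ∀ v ∈ vs, v a ∈ 𝒢.invDom :=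
    (eventually_all_finite vs.finite_toSet).2 fun v hv =>
      (h1 v hv).tendsto (𝒢.invDom_open.mem_nhds (hinv v hv))
  have h5 : ∀ a, ((vs.map fun v a => 𝒢.inv (v a)).reverse).evalFun a =
      (𝒢.toTop hA).invWord (vs.evalFun a) := fun a => by
    simp only [List.evalFun, TopLocalGroupoid.invWord, List.map_reverse, List.map_map]
    rfl
  refine (smoothNear_of_rep (S := S) (vs := (vs.map fun v a => 𝒢.inv (v a)).reverse) ?_
    ?_).contMDiffAt
  · intro w hw
    rw [List.mem_reverse] at hw
    obtain ⟨v, hv, rfl⟩ := List.mem_map.1 hw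
    exact smoothNear_inv (h1 v hv) (hinv v hv)
  · filter_upwards [h3, h4] with a h3 h4
    rw [h5]
    refine AC.rep_inv hI (fun g hg => ?_) h3
    obtain ⟨v, hv, rfl⟩ := List.mem_map.1 hg
    exact h4 v hv

variable {S} in
/-- Smooth families of words have smooth families of classes. -/
theorem exists_smooth_class {hA : 𝒢.IsThreeAssociative} {vs : List (Q → G)} (hne : vs ≠ [])
    (hvs : ∀ v ∈ vs, SmoothNear I 𝓘(ℝ, E) v q₀) {y x : Q → M}
    (hp : ∀ᶠ q in 𝓝 q₀, (𝒢.toTop hA).IsPath (y q) (vs.evalFun q) (x q)) :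
    ∃ f : Q → S.Space, SmoothNear I 𝓘(ℝ, S.Model) f q₀ ∧
      ∀ᶠ q in 𝓝 q₀, 𝒢.Rep (vs.evalFun q) (f q) := by
  obtain ⟨n, hn⟩ := Nat.exists_eq_succ_of_ne_zero fun h => hne (List.length_eq_zero_iff.1 h)
  obtain ⟨r, hr, -⟩ := vs.exists_ofFn_evalFun hn
  have h : ∀ᶠ q in 𝓝 q₀, 𝒢.Rep (vs.evalFun q) (S.proj n (r q)) := by
    filter_upwards [hp] with q hq
    obtain ⟨a, ha⟩ := exists_rep_of_isPath (by simpa [List.evalFun] using hne) hq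
    rw [← hr] at ha ⊢
    exact rep_proj (proj_eq_of_rep ha).1
  exact ⟨fun q => S.proj n (r q), smoothNear_of_rep hvs h, h⟩

/-- Local sections of the source map. -/
theorem exists_src_section (a₀ : S.Space) : ∃ σ : M → S.Space,
    SmoothNear 𝓘(ℝ, F) 𝓘(ℝ, S.Model) σ (S.src hA a₀) ∧ σ (S.src hA a₀) = a₀ ∧
      ∀ᶠ x in 𝓝 (S.src hA a₀), S.src hA (σ x) = x := by
  obtain ⟨l, hl⟩ := exists_rep (𝒢 := 𝒢) a₀
  have hconst : ∀ x : M, (l.map fun g (_ : M) => g).evalFun x = l := fun x => by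
    simp [List.evalFun, Function.comp_def]
  obtain ⟨bs, τ, hbs, -, hbs₀, hp, -, -⟩ := exists_path_correction (𝒢 := 𝒢) (hA := hA)
    (I := 𝓘(ℝ, F)) (q₀ := S.src hA a₀) (l.map fun g (_ : M) => g)
    (by
      intro f hf
      obtain ⟨g, -, rfl⟩ := List.mem_map.1 hf
      exact smoothNear_const _ _) (b := fun x => x) (smoothNear_id _) (y := S.tgt hA a₀)
    (by rw [hconst]; exact hl.isPath)
  rw [hconst] at hbs₀
  obtain ⟨σ, hσ, h⟩ := exists_smooth_class (S := S) (by rintro rfl; exact hl.ne_nil hbs₀.symm)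
    hbs hp
  refine ⟨σ, hσ, ?_, ?_⟩
  · have := h.self_of_nhds
    rw [hbs₀] at this
    exact this.eq hl
  · filter_upwards [h, hp] with x h1 h2 using h1.src_eq h2

theorem surjective_mfderiv_src (a : S.Space) :
    Function.Surjective (mfderiv 𝓘(ℝ, S.Model) 𝓘(ℝ, F) (S.src hA) a) := by
  obtain ⟨σ, hσ, hσ₀, h⟩ := S.exists_src_section hA a
  exact surjective_mfderiv_of_section (S.smooth_src_tgt hA a).2.mdifferentiableAt
    hσ.mdifferentiableAt hσ₀ h

/-- Inversion turns local sections of the source map into local sections of the target map. -/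
theorem surjective_mfderiv_tgt (hI : 𝒢.IsInversional) (a : S.Space) :
    Function.Surjective (mfderiv 𝓘(ℝ, S.Model) 𝓘(ℝ, F) (S.tgt hA) a) := by
  obtain ⟨σ, hσ, hσ₀, h⟩ := S.exists_src_section hA (S.inv hA hI a)
  have h1 : SmoothNear 𝓘(ℝ, F) 𝓘(ℝ, S.Model) (fun x => S.inv hA hI (σ x)) _ :=
    SmoothNear.comp (g := S.inv hA hI) ((S.contMDiff_inv hA hI).smoothNear _) hσ
  refine surjective_mfderiv_of_section (S.smooth_src_tgt hA a).1.mdifferentiableAt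
    h1.mdifferentiableAt ?_ (h.mono fun x hx => (AC.tgt_inv hI (σ x)).trans hx)
  rw [hσ₀]
  exact AC.inv_inv hI

/-- Composable pairs need not form an open set. The concatenated lifts are therefore corrected to
composable words for all nearby pairs, and the correction changes nothing where the pair is already
composable. -/
theorem exists_smooth_mul {a₀ b₀ : S.Space} (h : S.src hA a₀ = S.tgt hA b₀) :
    ∃ f : S.Space × S.Space → S.Space,
      SmoothNear (𝓘(ℝ, S.Model).prod 𝓘(ℝ, S.Model)) 𝓘(ℝ, S.Model) f (a₀, b₀) ∧
      ∀ᶠ p in 𝓝 (a₀, b₀), S.src hA p.1 = S.tgt hA p.2 → S.mul hA p.1 p.2 = f p := by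
  obtain ⟨l, hl⟩ := exists_rep (𝒢 := 𝒢) a₀
  obtain ⟨l', hl'⟩ := exists_rep (𝒢 := 𝒢) b₀
  obtain ⟨vs, h1, h2, h3⟩ := exists_smooth_lift (S := S) hA hl
  obtain ⟨ws, h4, h5, h6⟩ := exists_smooth_lift (S := S) hA hl'
  set us : List (S.Space × S.Space → G) :=
    (vs.map fun v p => v p.1) ++ ws.map fun w p => w p.2 with hus
  have hue : ∀ p, us.evalFun p = vs.evalFun p.1 ++ ws.evalFun p.2 := fun p => by
    simp only [hus, List.evalFun, List.map_append, List.map_map]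
    rfl
  have hpath : ∀ {a b : S.Space}, S.src hA a = S.tgt hA b → 𝒢.Rep (vs.evalFun a) a →
      𝒢.Rep (ws.evalFun b) b →
      (𝒢.toTop hA).IsPath (S.tgt hA a) (us.evalFun (a, b)) (S.src hA b) := by
    intro a b hab ha hb
    rw [hue]
    refine TopLocalGroupoid.isPath_append.2 ⟨_, ha.isPath, ?_⟩
    rw [show AC.src hA a = AC.tgt hA b from hab]
    exact hb.isPath
  obtain ⟨us', a, h7, -, h8, h9, h10, -⟩ := exists_path_correction (𝒢 := 𝒢) (hA := hA)
    (I := 𝓘(ℝ, S.Model).prod 𝓘(ℝ, S.Model)) (q₀ := (a₀, b₀)) us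
    (by
      intro f hf
      rcases List.mem_append.1 hf with hf | hf
      · obtain ⟨v, hv, rfl⟩ := List.mem_map.1 hf
        exact SmoothNear.comp (g := v) (f := Prod.fst) (h1 v hv) (contMDiff_fst.smoothNear _)
      · obtain ⟨v, hv, rfl⟩ := List.mem_map.1 hf
        exact SmoothNear.comp (g := v) (f := Prod.snd) (h4 v hv) (contMDiff_snd.smoothNear _))
    (b := fun p => S.src hA p.2)
    (SmoothNear.comp (g := S.src hA) (f := Prod.snd) (S.smooth_src_tgt hA b₀).2
      (contMDiff_snd.smoothNear _)) (hpath h h3.self_of_nhds h6.self_of_nhds)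
  obtain ⟨f, hf, hfr⟩ := exists_smooth_class (S := S)
    (by
      rintro rfl
      rw [hue, h2] at h8
      exact hl.ne_nil (List.append_eq_nil_iff.1 h8.symm).1) h7 h9
  refine ⟨f, hf, ?_⟩
  filter_upwards [hfr, h10, (continuous_fst.tendsto (a₀, b₀)).eventually h3,
    (continuous_snd.tendsto (a₀, b₀)).eventually h6] with p hp h10 h3 h6 hc
  rw [h10 _ (hpath hc h3 h6), hue] at hp
  exact (AC.rep_mul (hA := hA) hc h3 h6).eq hp

variable {S} {hA} in
theorem smoothNear_mul {f g : Q → S.Space} (hf : SmoothNear I 𝓘(ℝ, S.Model) f q₀)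
    (hg : SmoothNear I 𝓘(ℝ, S.Model) g q₀)
    (h : ∀ᶠ q in 𝓝 q₀, S.src hA (f q) = S.tgt hA (g q)) :
    SmoothNear I 𝓘(ℝ, S.Model) (fun q => S.mul hA (f q) (g q)) q₀ := by
  obtain ⟨m, hm, hm'⟩ := S.exists_smooth_mul hA h.self_of_nhds
  refine (SmoothNear.comp (g := m) (f := fun q => (f q, g q)) hm (hf.prodMk hg)).congr ?_
  filter_upwards [h, (hf.prodMk hg).tendsto.eventually hm'] with q h1 h2 using h2 h1

theorem contMDiffOn_mul : ContMDiffOn (𝓘(ℝ, S.Model).prod 𝓘(ℝ, S.Model)) 𝓘(ℝ, S.Model) ∞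
    (fun p : S.Space × S.Space => S.mul hA p.1 p.2) {p | S.src hA p.1 = S.tgt hA p.2} := by
  rintro ⟨a, b⟩ h
  obtain ⟨m, hm, hm'⟩ := S.exists_smooth_mul hA h
  refine hm.contMDiffAt.contMDiffWithinAt.congr_of_eventuallyEq ?_ (hm'.self_of_nhds h)
  filter_upwards [mem_nhdsWithin_of_mem_nhds hm', self_mem_nhdsWithin] with p h1 h2 using h1 h2

/-- If `β` is a local section of the source map through `b`, then `d ↦ (d β(s d)⁻¹, β(s d))` is a
smooth section of multiplication through `(a, b)`. -/
theorem isSubmersionAlong_mul (hI : 𝒢.IsInversional) :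
    IsSubmersionAlong (𝓘(ℝ, S.Model).prod 𝓘(ℝ, S.Model)) 𝓘(ℝ, S.Model)
      (fun p : S.Space × S.Space => S.mul hA p.1 p.2) {p | S.src hA p.1 = S.tgt hA p.2}
      (fun p => {v : S.Model × S.Model | (mfderiv 𝓘(ℝ, S.Model) 𝓘(ℝ, F) (S.src hA) p.1 v.1 : F) =
        (mfderiv 𝓘(ℝ, S.Model) 𝓘(ℝ, F) (S.tgt hA) p.2 v.2 : F)}) := by
  refine ⟨S.contMDiffOn_mul hA, ?_⟩
  rintro ⟨a, b⟩ (h : S.src hA a = S.tgt hA b) ζ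
  obtain ⟨β, hβ, hβ₀, hβs⟩ := S.exists_src_section hA b
  set c := S.mul hA a b with hc
  have hcs : S.src hA c = S.src hA b := AC.src_mul h
  have hsc := (S.smooth_src_tgt hA c).2
  have h1 : SmoothNear 𝓘(ℝ, S.Model) 𝓘(ℝ, S.Model) (fun d => β (S.src hA d)) c :=
    hβ.comp_of_eq hsc hcs
  have h2 : SmoothNear 𝓘(ℝ, S.Model) 𝓘(ℝ, S.Model) (fun d => S.inv hA hI (β (S.src hA d))) c :=
    SmoothNear.comp (g := S.inv hA hI) ((S.contMDiff_inv hA hI).smoothNear _) h1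
  have hβs' : ∀ᶠ d in 𝓝 c, S.src hA (β (S.src hA d)) = S.src hA d := by
    have := hsc.tendsto
    rw [hcs] at this
    exact this.eventually hβs
  have hcomp : ∀ᶠ d in 𝓝 c, S.src hA d = S.tgt hA (S.inv hA hI (β (S.src hA d))) :=
    hβs'.mono fun d hd => hd.symm.trans (AC.tgt_inv hI _).symm
  have h3 := smoothNear_mul (smoothNear_id c) h2 hcomp
  set r : S.Space → S.Space × S.Space :=
    fun d => (S.mul hA d (S.inv hA hI (β (S.src hA d))), β (S.src hA d)) with hr
  have hrs : SmoothNear 𝓘(ℝ, S.Model) (𝓘(ℝ, S.Model).prod 𝓘(ℝ, S.Model)) r c := h3.prodMk h1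
  have hrm : ∀ᶠ d in 𝓝 c, r d ∈ {p : S.Space × S.Space | S.src hA p.1 = S.tgt hA p.2} :=
    hcomp.mono fun d hd => (AC.src_mul hd).trans (AC.src_inv hI _)
  have hri : ∀ᶠ d in 𝓝 c, S.mul hA (r d).1 (r d).2 = d := by
    filter_upwards [hcomp, hβs'] with d h4 h5
    have h6 := AC.mul_assoc (hA := hA) (a := d) (b := S.inv hA hI (β (S.src hA d)))
      (c := β (S.src hA d)) h4 (AC.src_inv hI _)
    refine h6.trans ?_
    have h7 : AC.mul hA (S.inv hA hI (β (S.src hA d))) (β (S.src hA d)) =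
      AC.unit 𝒢 (AC.src hA d) := (AC.inv_mul hI _).trans (congrArg (AC.unit 𝒢) h5)
    rw [h7]
    exact AC.mul_unit d
  have hrc : r c = (a, b) := by
    have e1 : β (S.src hA c) = b := by rw [hcs, hβ₀]
    simp only [hr, e1]
    refine Prod.ext ?_ rfl
    have h6 := AC.mul_assoc (hA := hA) (a := a) (b := b) (c := S.inv hA hI b) h
      (AC.tgt_inv hI _).symm
    refine h6.trans ?_
    have h7 : AC.mul hA b (S.inv hA hI b) = AC.unit 𝒢 (AC.src hA a) :=
      (AC.mul_inv hI _).trans (congrArg (AC.unit 𝒢) h.symm)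
    rw [h7]
    exact AC.mul_unit a
  refine ⟨mfderiv 𝓘(ℝ, S.Model) (𝓘(ℝ, S.Model).prod 𝓘(ℝ, S.Model)) r c ζ, ?_, ?_⟩
  -- All values of the section are composable pairs; differentiating this equation shows that its
  -- velocity is tangent to the fibre product.
  · have e1 : MDifferentiableAt 𝓘(ℝ, S.Model) 𝓘(ℝ, S.Model) (fun d => (r d).1) c :=
      h3.mdifferentiableAt
    have e2 : MDifferentiableAt 𝓘(ℝ, S.Model) 𝓘(ℝ, S.Model) (fun d => (r d).2) c :=
      h1.mdifferentiableAt
    have e3 := ((S.contMDiff_src hA (r c).1).mdifferentiableAt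
      (by simp)).hasMFDerivAt.comp c e1.hasMFDerivAt
    have e4 := ((S.contMDiff_tgt hA (r c).2).mdifferentiableAt
      (by simp)).hasMFDerivAt.comp c e2.hasMFDerivAt
    have e5 := hasMFDerivAt_unique e3 (e4.congr_of_eventuallyEq hrm)
    have e6 := congrArg (fun L : S.Model →L[ℝ] F => L ζ) e5
    have e7 : mfderiv 𝓘(ℝ, S.Model) (𝓘(ℝ, S.Model).prod 𝓘(ℝ, S.Model)) r c = _ :=
      (e1.hasMFDerivAt.prodMk e2.hasMFDerivAt).mfderiv
    rw [e7]
    rw [hrc] at e6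
    exact e6
  · have e1 := mfderiv_comp_of_eventually_mem
      ((S.contMDiffOn_mul hA (a, b) h).mdifferentiableWithinAt (by simp))
      hrs.mdifferentiableAt hrc hrm ζ
    refine e1.symm.trans ?_
    have e2 : HasMFDerivAt 𝓘(ℝ, S.Model) 𝓘(ℝ, S.Model)
        (fun d => S.mul hA (r d).1 (r d).2) c (ContinuousLinearMap.id ℝ (TangentSpace _ c)) :=
      (hasMFDerivAt_id c).congr_of_eventuallyEq hri
    exact congrArg (fun L : S.Model →L[ℝ] S.Model => L ζ) e2.mfderiv

/-- As a continuous image of the second countable space of words, 𝒜𝒞(G) is Lindelöf, so countably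
many charts cover it. -/
theorem secondCountableTopology : SecondCountableTopology S.Space := by
  have : SecondCountableTopology G := 𝒢.secondCountable
  have h1 : SecondCountableTopology 𝒢.Word :=
    inferInstanceAs (SecondCountableTopology (Σ n : ℕ, 𝒢.wordSet n))
  have h2 : IsLindelof (Set.univ : Set S.Space) := by
    have h3 : IsLindelof (Set.range fun w : 𝒢.Word => (𝒢.toAC w : S.Space)) :=
      isLindelof_range continuous_quot_mk
    have h4 : Set.range (fun w : 𝒢.Word => (𝒢.toAC w : S.Space)) = Set.univ :=
      Set.eq_univ_of_forall fun a => Quot.exists_rep (r := 𝒢.Contracts) a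
    rwa [h4] at h3
  obtain ⟨t, ht, -, h5⟩ := h2.elim_nhds_subcover (fun a => (chartAt S.Model a).source)
    fun a _ => chart_source_mem_nhds S.Model a
  exact ChartedSpace.secondCountable_of_countable_cover S.Model (Set.univ_subset_iff.1 h5) ht

variable {S} in
theorem tendsto_mul {ι : Type*} {L : Filter ι} {f g : ι → S.Space} {a b : S.Space}
    (hf : Tendsto f L (𝓝 a)) (hg : Tendsto g L (𝓝 b))
    (hfg : ∀ i, S.src hA (f i) = S.tgt hA (g i)) (hab : S.src hA a = S.tgt hA b) :
    Tendsto (fun i => S.mul hA (f i) (g i)) L (𝓝 (S.mul hA a b)) := by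
  have h := (S.contMDiffOn_mul hA).continuousOn (a, b) hab
  exact Tendsto.comp (g := fun p : S.Space × S.Space => S.mul hA p.1 p.2) h
    (tendsto_nhdsWithin_iff.2 ⟨hf.prodMk_nhds hg, Eventually.of_forall hfg⟩)

theorem t1Space : T1Space S.Space := ChartedSpace.t1Space S.Model S.Space

theorem eq_of_tendsto_const {ι : Type*} {L : Filter ι} [L.NeBot] {a b : S.Space}
    (h : Tendsto (fun _ : ι => a) L (𝓝 b)) : a = b := by
  have := S.t1Space
  exact tendsto_const_nhds_iff.1 h

/-- If a filter on the fibre converges to both `a` and `b`, their targets agree because `M` is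
Hausdorff. The constant unit `c⁻¹ c` then converges to `a⁻¹ b`. A manifold is T1, so `a⁻¹ b` is that
unit and `a = b`. -/
theorem t2Space_src_fiber [T2Space M] (hI : 𝒢.IsInversional) (x : M) :
    T2Space (S.src hA ⁻¹' {x}) := by
  rw [t2_iff_nhds]
  rintro ⟨a, ha⟩ ⟨b, hb⟩ h
  have h1 : Tendsto (fun c : S.src hA ⁻¹' {x} => c.1) (𝓝 ⟨a, ha⟩ ⊓ 𝓝 ⟨b, hb⟩) (𝓝 a) :=
    (continuous_subtype_val.tendsto _).mono_left inf_le_left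
  have h2 : Tendsto (fun c : S.src hA ⁻¹' {x} => c.1) (𝓝 ⟨a, ha⟩ ⊓ 𝓝 ⟨b, hb⟩) (𝓝 b) :=
    (continuous_subtype_val.tendsto _).mono_left inf_le_right
  have hab : S.tgt hA a = S.tgt hA b := tendsto_nhds_unique
    (((S.contMDiff_tgt hA).continuous.tendsto a).comp h1)
    (((S.contMDiff_tgt hA).continuous.tendsto b).comp h2)
  have h3 := tendsto_mul (S := S) hA (((S.contMDiff_inv hA hI).continuous.tendsto a).comp h1) h2
    (fun c => AC.src_inv hI c.1) ((AC.src_inv hI a).trans hab)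
  have h4 : (fun c : S.src hA ⁻¹' {x} => S.mul hA (S.inv hA hI c.1) c.1) =
      fun _ => (AC.unit 𝒢 x : S.Space) := by
    funext c
    exact (AC.inv_mul hI _).trans (congrArg (AC.unit 𝒢) c.2)
  have h5 := S.eq_of_tendsto_const (h4 ▸ h3 : Tendsto (fun _ => (AC.unit 𝒢 x : S.Space)) _ _)
  have h6 : S.inv hA hI a = AC.inv hA hI b := AC.eq_inv_of_mul_eq_unit hI
    ((AC.src_inv hI a).trans hab) (h5.symm.trans (congrArg (AC.unit 𝒢) (show x = _ from hb.symm)))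
  have h7 := congrArg (AC.inv hA hI) h6
  exact Subtype.ext ((AC.inv_inv hI).symm.trans (h7.trans (AC.inv_inv hI)))

theorem t2Space_tgt_fiber [T2Space M] (hI : 𝒢.IsInversional) (x : M) :
    T2Space (S.tgt hA ⁻¹' {x}) := by
  have := S.t2Space_src_fiber hA hI x
  let e : S.tgt hA ⁻¹' {x} → S.src hA ⁻¹' {x} :=
    fun a => ⟨S.inv hA hI a.1, (AC.src_inv hI a.1).trans a.2⟩
  refine T2Space.of_injective_continuous (f := e) ?_ ?_
  · intro a b hab
    have h1 := congrArg (fun c => S.inv hA hI c.1) hab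
    exact Subtype.ext ((AC.inv_inv hI).symm.trans (h1.trans (AC.inv_inv hI)))
  · exact ((S.contMDiff_inv hA hI).continuous.comp continuous_subtype_val).subtype_mk _

/-- `𝒜𝒞(G)` as a Lie groupoid. -/
noncomputable def groupoid [T2Space M] : LocalLieGroupoid S.Model F S.Space M where
  src := S.src hA
  tgt := S.tgt hA
  unit x := S.completion (𝒢.unit x)
  mulDom := {p | S.src hA p.1 = S.tgt hA p.2}
  mul := S.mul hA
  invDom := Set.univ
  inv := S.inv hA hI
  secondCountable := S.secondCountableTopology
  t2_src_fiber := S.t2Space_src_fiber hA hI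
  t2_tgt_fiber := S.t2Space_tgt_fiber hA hI
  src_smooth := S.contMDiff_src hA
  src_submersion := S.surjective_mfderiv_src hA
  tgt_smooth := S.contMDiff_tgt hA
  tgt_submersion := S.surjective_mfderiv_tgt hA hI
  unit_smooth := S.contMDiff_completion.comp 𝒢.unit_smooth
  src_unit := AC.src_unit hA
  tgt_unit := AC.tgt_unit hA
  mulDom_open := ⟨Set.univ, isOpen_univ, (Set.univ_inter _).symm⟩
  mem_mulDom_unit_right _ := (AC.tgt_unit hA _).symm
  mem_mulDom_unit_left _ := AC.src_unit hA _
  mul_submersion := S.isSubmersionAlong_mul hA hI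
  src_mul _ _ h := AC.src_mul h
  tgt_mul _ _ h := AC.tgt_mul h
  mul_unit := AC.mul_unit
  unit_mul := AC.unit_mul
  assoc_near := ⟨Set.univ, isOpen_univ, fun _ => ⟨trivial, trivial, trivial⟩,
    fun _ _ _ _ h h' => ⟨h, (AC.src_mul h).trans h', h', h.trans (AC.tgt_mul h').symm,
      AC.mul_assoc h h'⟩⟩
  invDom_open := isOpen_univ
  unit_mem_invDom _ := trivial
  mem_mulDom_of_invDom _ _ _ _ h := h
  inv_mem_invDom _ _ := trivial
  inv_smooth := (S.contMDiff_inv hA hI).contMDiffOn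
  src_inv _ _ := AC.src_inv hI _
  tgt_inv _ _ := AC.tgt_inv hI _
  inv_mul _ _ := AC.inv_mul hI _
  mul_inv _ _ := AC.mul_inv hI _

theorem isCompletionGroupoid [T2Space M] : S.IsCompletionGroupoid (S.groupoid hA hI) where
  isLieGroupoid := ⟨rfl, rfl, fun _ _ _ h _ h' _ => AC.mul_assoc h h'⟩
  src_cls _ := rfl
  tgt_cls _ := rfl
  unit_eq _ := rfl
  mul_cls v w z h := by
    have h1 := z.isPath (hA := hA)
    rw [h] at h1
    obtain ⟨y, h2, h3⟩ := TopLocalGroupoid.isPath_append.1 h1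
    have h4 := (h2.eq_and_eq v.letters_ne_nil v.isPath).2
    have h5 := (h3.eq_and_eq w.letters_ne_nil w.isPath).1
    have h6 : AC.src hA (𝒢.toAC v) = AC.tgt hA (𝒢.toAC w) := h4.symm.trans h5
    exact (AC.rep_mul h6 ⟨v, rfl, rfl⟩ ⟨w, rfl, rfl⟩).eq ⟨z, h, rfl⟩

end Operations

end SmoothQuotient

end LocalLieGroupoid

end CompletionGroupoidPart

/-! ### Right-invariant vector fields. -/

section RightInvariantPart
set_option linter.unusedSectionVars false
open Filter Bundle

section TangentMap

variable {E H N E' H' P : Type*}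
  [NormedAddCommGroup E] [NormedSpace ℝ E] [TopologicalSpace H]
  [NormedAddCommGroup E'] [NormedSpace ℝ E'] [TopologicalSpace H']
  [TopologicalSpace N] [ChartedSpace H N] [TopologicalSpace P] [ChartedSpace H' P]
  {I : ModelWithCorners ℝ E H} {I' : ModelWithCorners ℝ E' H'}
  [IsManifold I ∞ N] [IsManifold I' ∞ P]

theorem SmoothNear.contMDiffAt_tangentMap {f : N → P} {p : TangentBundle I N}
    (h : SmoothNear I I' f p.proj) : ContMDiffAt I.tangent I'.tangent ∞ (tangentMap I I' f) p := by
  obtain ⟨O, hO, hOo, hp⟩ := _root_.mem_nhds_iff.1 h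
  have h1 : ContMDiffOn I I' ∞ f O := fun q hq => (hO hq).contMDiffWithinAt
  have h2 := h1.contMDiffOn_tangentMapWithin (m := ∞) (by simp) hOo.uniqueMDiffOn
  have h3 : π E (TangentSpace I) ⁻¹' O ∈ 𝓝 p :=
    (hOo.preimage (FiberBundle.continuous_proj E (TangentSpace I))).mem_nhds hp
  refine (h2.contMDiffAt h3).congr_of_eventuallyEq ?_
  filter_upwards [h3] with q hq
  exact congrArg (TotalSpace.mk _) (congrArg (fun L : E →L[ℝ] E' => L q.2)
    (mfderivWithin_of_isOpen hOo hq).symm)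

/-- The image of a smooth vector field along a map, under the differential of a smooth map. -/
theorem SmoothNear.contMDiffWithinAt_mfderiv {f : N → P} {EQ HQ Q : Type*} [NormedAddCommGroup EQ]
    [NormedSpace ℝ EQ] [TopologicalSpace HQ] [TopologicalSpace Q] [ChartedSpace HQ Q]
    {IQ : ModelWithCorners ℝ EQ HQ} {u : Q → N} {v : Q → E} {O : Set Q} {q : Q}
    (h : SmoothNear I I' f (u q))
    (hv : ContMDiffWithinAt IQ I.tangent ∞ (fun q => (⟨u q, v q⟩ : TangentBundle I N)) O q) :
    ContMDiffWithinAt IQ I'.tangent ∞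
      (fun q => (⟨f (u q), mfderiv I I' f (u q) (v q)⟩ : TangentBundle I' P)) O q :=
  ContMDiffAt.comp_contMDiffWithinAt (g := tangentMap I I' f) q
    (SmoothNear.contMDiffAt_tangentMap (p := ⟨u q, v q⟩) h) hv

end TangentMap

namespace LocalLieGroupoid

variable {E F G M : Type*}
  [NormedAddCommGroup E] [NormedSpace ℝ E] [NormedAddCommGroup F] [NormedSpace ℝ F]
  [TopologicalSpace G] [ChartedSpace E G] [TopologicalSpace M] [ChartedSpace F M]
  (𝒢 : LocalLieGroupoid E F G M)
  [FiniteDimensional ℝ E] [FiniteDimensional ℝ F]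
  [IsManifold 𝓘(ℝ, E) ∞ G] [IsManifold 𝓘(ℝ, F) ∞ M]

/-- A retraction onto the source fibre through the unit at `t g`, and the computation of the
right-invariant extension of `a ∈ A` by means of it. -/
theorem exists_fiber_plot (g : G) : ∃ r : G → G,
    SmoothNear 𝓘(ℝ, E) 𝓘(ℝ, E) r (𝒢.unit (𝒢.tgt g)) ∧
      r (𝒢.unit (𝒢.tgt g)) = 𝒢.unit (𝒢.tgt g) ∧
      (∀ᶠ k in 𝓝 (𝒢.unit (𝒢.tgt g)), (r k, g) ∈ 𝒢.mulDom) ∧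
      ∀ v : E, (mfderiv 𝓘(ℝ, E) 𝓘(ℝ, F) 𝒢.src (𝒢.unit (𝒢.tgt g)) v : F) = 0 →
        (mfderiv 𝓘(ℝ, E) 𝓘(ℝ, E) r (𝒢.unit (𝒢.tgt g)) v : E) = v := by
  obtain ⟨r, h1, h2, h3, h4⟩ := 𝒢.exists_src_adjustment (fun k => k) (fun _ => 𝒢.tgt g)
    (smoothNear_id _) (smoothNear_const _ _) (𝒢.src_unit _)
  have h5 : r (𝒢.unit (𝒢.tgt g)) = 𝒢.unit (𝒢.tgt g) := h3.self_of_nhds (𝒢.src_unit _)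
  refine ⟨r, h1, h5, ?_, ?_⟩
  · exact 𝒢.eventually_mem_mulDom h1 (smoothNear_const (I := 𝓘(ℝ, E)) g _)
      (by rw [h5]; exact 𝒢.mem_mulDom_unit_left g) h2
  · intro v hv
    have h6 : (mfderiv 𝓘(ℝ, E) 𝓘(ℝ, F) (fun _ : G => 𝒢.tgt g) (𝒢.unit (𝒢.tgt g)) v : F) = 0 :=
      congrArg (fun L : E →L[ℝ] F => L v) mfderiv_const
    have h6 := h4 v (hv.trans h6.symm)
    exact h6.trans (congrArg (fun L : E →L[ℝ] E => L v) mfderiv_id)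

/-- `dRight` is a derivative within part of a source fibre. Composing with a map `r` into that fibre
turns it into an unrestricted derivative. -/
theorem dRight_eq_mfderiv {Q EQ HQ : Type*} [NormedAddCommGroup EQ] [NormedSpace ℝ EQ]
    [TopologicalSpace HQ] [TopologicalSpace Q] [ChartedSpace HQ Q] {I : ModelWithCorners ℝ EQ HQ}
    {g : G} {r : Q → G} {q : Q} (hr : MDifferentiableAt I 𝓘(ℝ, E) r q)
    (h₀ : r q = 𝒢.unit (𝒢.tgt g)) (h : ∀ᶠ k in 𝓝 q, (r k, g) ∈ 𝒢.mulDom) (v : EQ) :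
    (mfderiv I 𝓘(ℝ, E) (fun k => 𝒢.mul (r k) g) q v : E) =
      𝒢.dRight g (𝒢.unit (𝒢.tgt g)) (mfderiv I 𝓘(ℝ, E) r q v : E) := by
  refine mfderiv_comp_of_eventually_mem (f := fun k => 𝒢.mul k g)
    (S := {k | (k, g) ∈ 𝒢.mulDom}) ?_ hr h₀ h v
  have h1 : ContMDiffWithinAt 𝓘(ℝ, E) 𝓘(ℝ, E) ∞ (fun k => 𝒢.mul k g) {k | (k, g) ∈ 𝒢.mulDom}
      (𝒢.unit (𝒢.tgt g)) :=
    ContMDiffWithinAt.comp (g := fun p : G × G => 𝒢.mul p.1 p.2) (f := fun k => (k, g))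
      (t := 𝒢.mulDom) _ (𝒢.mul_submersion.1 _ (𝒢.mem_mulDom_unit_left g))
      (contMDiffAt_id.prodMk contMDiffAt_const).contMDiffWithinAt fun _ h => h
  exact h1.mdifferentiableWithinAt (by simp)

/-- Right-invariant vector fields are tangent to the source fibres. -/
theorem mfderiv_src_rightInvariant (α : ∀ x, 𝒢.algFiber x) (g : G) :
    (mfderiv 𝓘(ℝ, E) 𝓘(ℝ, F) 𝒢.src g (𝒢.rightInvariant α g) : F) = 0 := by
  obtain ⟨r, h1, h2, h3, h4⟩ := 𝒢.exists_fiber_plot g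
  have h5 := 𝒢.dRight_eq_mfderiv h1.mdifferentiableAt h2 h3 (α (𝒢.tgt g)).1
  rw [h4 _ (α (𝒢.tgt g)).2] at h5
  have h6 : MDifferentiableAt 𝓘(ℝ, E) 𝓘(ℝ, E) (fun k => 𝒢.mul (r k) g) (𝒢.unit (𝒢.tgt g)) := by
    refine (𝒢.smoothNear_mul h1 (smoothNear_const (I := 𝓘(ℝ, E)) g _)
      (h3.self_of_nhds) (h3.mono fun k hk => 𝒢.composable hk)).mdifferentiableAt
  have h7 : 𝒢.mul (r (𝒢.unit (𝒢.tgt g))) g = g := by rw [h2, 𝒢.unit_mul]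
  -- The source of `r k · g` is that of `g`, independently of `k`.
  have h8 : HasMFDerivAt 𝓘(ℝ, E) 𝓘(ℝ, F) (𝒢.src ∘ fun k => 𝒢.mul (r k) g) (𝒢.unit (𝒢.tgt g))
      (0 : E →L[ℝ] F) :=
    (hasMFDerivAt_const (𝒢.src g) _).congr_of_eventuallyEq
      (h3.mono fun k hk => 𝒢.src_mul _ _ hk)
  have h9 := hasMFDerivAt_unique h8
    ((𝒢.src_smooth.mdifferentiable (by simp) _).hasMFDerivAt.comp _ h6.hasMFDerivAt)
  have h10 := congrArg (fun L : E →L[ℝ] F => L (α (𝒢.tgt g)).1) h9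
  have h11 : (0 : F) = (mfderiv 𝓘(ℝ, E) 𝓘(ℝ, F) 𝒢.src (𝒢.mul (r (𝒢.unit (𝒢.tgt g))) g)
    (mfderiv 𝓘(ℝ, E) 𝓘(ℝ, E) (fun k => 𝒢.mul (r k) g) (𝒢.unit (𝒢.tgt g))
      (α (𝒢.tgt g)).1 : E) : F) := h10
  have key : ∀ {k : G} (_ : k = g) (v : E), (mfderiv 𝓘(ℝ, E) 𝓘(ℝ, F) 𝒢.src k v : F) =
      mfderiv 𝓘(ℝ, E) 𝓘(ℝ, F) 𝒢.src g v := by rintro _ rfl _; rfl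
  exact ((h11.trans (key h7 _)).trans
    (congrArg (fun v : E => (mfderiv 𝓘(ℝ, E) 𝓘(ℝ, F) 𝒢.src g v : F)) h5)).symm

/-- The right-invariant extension of a smooth section is smooth. -/
theorem contMDiffAt_rightInvariant (α : ∀ x, 𝒢.algFiber x)
    (hα : 𝒢.IsSmoothSectionOn Set.univ α) (g₀ : G) :
    ContMDiffAt 𝓘(ℝ, E) 𝓘(ℝ, E).tangent ∞
      (fun g => (⟨g, 𝒢.rightInvariant α g⟩ : TangentBundle 𝓘(ℝ, E) G)) g₀ := by
  set e := 𝒢.unit (𝒢.tgt g₀) with he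
  obtain ⟨f, h1, h2, h3, -⟩ := 𝒢.exists_src_adjustment (I := 𝓘(ℝ, E).prod 𝓘(ℝ, E))
    (q₀ := (e, g₀)) (fun p : G × G => p.1) (fun p => 𝒢.tgt p.2) (contMDiff_fst.smoothNear _)
    (smoothNear_tgt (contMDiff_snd.smoothNear _)) (𝒢.src_unit _)
  have h4 : f (e, g₀) = e := h3.self_of_nhds (𝒢.src_unit _)
  have h5 := 𝒢.smoothNear_mul (f := f) (g := fun p : G × G => p.2) h1 (contMDiff_snd.smoothNear _)
    (by rw [h4]; exact 𝒢.mem_mulDom_unit_left g₀) h2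
  have htgt : ContMDiffAt 𝓘(ℝ, E) 𝓘(ℝ, F) ∞ 𝒢.tgt g₀ := 𝒢.tgt_smooth g₀
  have hαt : ContMDiffAt 𝓘(ℝ, E) 𝓘(ℝ, E).tangent ∞
      (fun g => (⟨𝒢.unit (𝒢.tgt g), (α (𝒢.tgt g)).1⟩ : TangentBundle 𝓘(ℝ, E) G)) g₀ :=
    ContMDiffAt.comp (g := fun x => (⟨𝒢.unit x, (α x).1⟩ : TangentBundle 𝓘(ℝ, E) G)) g₀
      (contMDiffOn_univ.1 hα (𝒢.tgt g₀)) htgt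
  have hz : ContMDiffAt 𝓘(ℝ, E) 𝓘(ℝ, E).tangent ∞
      (fun g : G => (⟨g, (0 : E)⟩ : TangentBundle 𝓘(ℝ, E) G)) g₀ :=
    (contMDiff_zeroSection ℝ (TangentSpace 𝓘(ℝ, E))) g₀
  have hv := ContMDiffAt.comp g₀ (contMDiff_equivTangentBundleProd_symm (n := ∞)
    (I := 𝓘(ℝ, E)) (I' := 𝓘(ℝ, E)) (M := G) (M' := G) _) (hαt.prodMk hz)
  -- The right-invariant field at `g` is the differential of `(k, g) ↦ f(k, g) g` at `(u(t g), g)`,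
  -- applied to `(α, 0)`. In this form its dependence on `g` is smooth.
  have h7 := (SmoothNear.contMDiffWithinAt_mfderiv (f := fun p : G × G => 𝒢.mul (f p) p.2)
    (u := fun g => (𝒢.unit (𝒢.tgt g), g)) (v := fun g => (((α (𝒢.tgt g)).1 : E), (0 : E)))
    (O := Set.univ) (q := g₀) h5 (contMDiffWithinAt_univ.2 hv)).contMDiffAt univ_mem
  refine h7.congr_of_eventuallyEq ?_
  have hu : Tendsto (fun g => (𝒢.unit (𝒢.tgt g), g)) (𝓝 g₀) (𝓝 (e, g₀)) :=
    ((𝒢.unit_smooth.comp 𝒢.tgt_smooth).continuous.tendsto g₀).prodMk_nhds tendsto_id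
  filter_upwards [hu.eventually h3.eventually_nhds, hu.eventually h5] with g h3 h5
  have h8 : f (𝒢.unit (𝒢.tgt g), g) = 𝒢.unit (𝒢.tgt g) := h3.self_of_nhds (𝒢.src_unit _)
  have key : ∀ {k : G} (_ : g = k) {v w : E} (_ : v = w),
      (⟨g, v⟩ : TangentBundle 𝓘(ℝ, E) G) = ⟨k, w⟩ := by rintro _ rfl _ _ rfl; rfl
  refine key (by rw [h8, 𝒢.unit_mul]) ?_
  obtain ⟨r, r1, r2, r3, r4⟩ := 𝒢.exists_fiber_plot g
  have e1 := 𝒢.dRight_eq_mfderiv r1.mdifferentiableAt r2 r3 (α (𝒢.tgt g)).1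
  rw [r4 _ (α (𝒢.tgt g)).2] at e1
  refine e1.symm.trans ?_
  have e2 : Tendsto (fun k => (r k, g)) (𝓝 (𝒢.unit (𝒢.tgt g))) (𝓝 (𝒢.unit (𝒢.tgt g), g)) := by
    have := r1.tendsto
    rw [r2] at this
    exact this.prodMk_nhds tendsto_const_nhds
  have e3 : ∀ᶠ k in 𝓝 (𝒢.unit (𝒢.tgt g)), 𝒢.mul (r k) g = 𝒢.mul (f (r k, g)) g := by
    filter_upwards [e2.eventually h3, r3] with k h h'
    rw [h (𝒢.composable h')]
  have e4 : HasMFDerivAt 𝓘(ℝ, E) 𝓘(ℝ, E) (fun k => 𝒢.mul (r k) g) (𝒢.unit (𝒢.tgt g))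
      ((mfderiv (𝓘(ℝ, E).prod 𝓘(ℝ, E)) 𝓘(ℝ, E) (fun p : G × G => 𝒢.mul (f p) p.2)
        (𝒢.unit (𝒢.tgt g), g)).comp
          ((mfderiv 𝓘(ℝ, E) 𝓘(ℝ, E) r (𝒢.unit (𝒢.tgt g))).prod (0 : E →L[ℝ] E))) :=
    (HasMFDerivAt.comp (g := fun p : G × G => 𝒢.mul (f p) p.2) (f := fun k => (r k, g))
      (𝒢.unit (𝒢.tgt g)) (by rw [r2]; exact (h5.mdifferentiableAt (by simp)).hasMFDerivAt)
      (r1.mdifferentiableAt.hasMFDerivAt.prodMk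
        (hasMFDerivAt_const g (𝒢.unit (𝒢.tgt g))))).congr_of_eventuallyEq e3
  refine (congrArg (fun L : E →L[ℝ] E => L (α (𝒢.tgt g)).1) e4.mfderiv).trans ?_
  change (mfderiv (𝓘(ℝ, E).prod 𝓘(ℝ, E)) 𝓘(ℝ, E) (fun p : G × G => 𝒢.mul (f p) p.2)
    (𝒢.unit (𝒢.tgt g), g) ((mfderiv 𝓘(ℝ, E) 𝓘(ℝ, E) r (𝒢.unit (𝒢.tgt g)) (α (𝒢.tgt g)).1 : E),
      (0 : E)) : E) = _
  rw [r4 _ (α (𝒢.tgt g)).2]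

end LocalLieGroupoid

end RightInvariantPart

/-! ### Brackets of vector fields tangent to the fibres of a map. -/

section VerticalPart
set_option linter.unusedSectionVars false
open Filter Bundle VectorField

variable {E F G M : Type*}
  [NormedAddCommGroup E] [NormedSpace ℝ E] [NormedAddCommGroup F] [NormedSpace ℝ F]
  [TopologicalSpace G] [ChartedSpace E G] [TopologicalSpace M] [ChartedSpace F M]
  [IsManifold 𝓘(ℝ, E) ∞ G] [IsManifold 𝓘(ℝ, F) ∞ M]

/-- The bracket of two vector fields in the kernel of the differential of a map is in the kernel. -/
theorem SmoothNear.mfderiv_mlieBracket_eq_zero [CompleteSpace E] {f : G → M} {g : G}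
    (hf : SmoothNear 𝓘(ℝ, E) 𝓘(ℝ, F) f g) {V W : ∀ k : G, TangentSpace 𝓘(ℝ, E) k}
    (hV : MDifferentiableAt 𝓘(ℝ, E) 𝓘(ℝ, E).tangent
      (fun k => (⟨k, V k⟩ : TangentBundle 𝓘(ℝ, E) G)) g)
    (hW : MDifferentiableAt 𝓘(ℝ, E) 𝓘(ℝ, E).tangent
      (fun k => (⟨k, W k⟩ : TangentBundle 𝓘(ℝ, E) G)) g)
    (hV₀ : ∀ᶠ k in 𝓝 g, (mfderiv 𝓘(ℝ, E) 𝓘(ℝ, F) f k (V k) : F) = 0)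
    (hW₀ : ∀ᶠ k in 𝓝 g, (mfderiv 𝓘(ℝ, E) 𝓘(ℝ, F) f k (W k) : F) = 0) :
    (mfderiv 𝓘(ℝ, E) 𝓘(ℝ, F) f g (mlieBracket 𝓘(ℝ, E) V W g) : F) = 0 := by
  have : IsManifold 𝓘(ℝ, E) 1 G := IsManifold.of_le (n := ∞) (by simp)
  have : IsManifold 𝓘(ℝ, F) 1 M := IsManifold.of_le (n := ∞) (by simp)
  have : IsManifold 𝓘(ℝ, E) 2 G := IsManifold.of_le (n := ∞) (mod_cast le_top : ((2 : ℕ∞) : WithTop ℕ∞) ≤ ∞)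
  set χ := extChartAt 𝓘(ℝ, E) g with hχ
  set c := extChartAt 𝓘(ℝ, F) (f g) with hc
  set y₀ : E := χ g with hy₀
  have hχy₀ : χ.symm y₀ = g := χ.left_inv (mem_extChartAt_source g)
  set V' : E → E := mpullbackWithin 𝓘(ℝ, E) 𝓘(ℝ, E) χ.symm V (Set.range 𝓘(ℝ, E)) with hV'
  set W' : E → E := mpullbackWithin 𝓘(ℝ, E) 𝓘(ℝ, E) χ.symm W (Set.range 𝓘(ℝ, E)) with hW'
  have hV1 : DifferentiableAt ℝ V' y₀ := by
    have := (hV.mdifferentiableWithinAt (s :=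
      Set.univ)).differentiableWithinAt_mpullbackWithin_vectorField
    rw [Set.preimage_univ, Set.univ_inter] at this
    exact this.differentiableAt (by rw [ModelWithCorners.range_eq_univ]; exact univ_mem)
  have hW1 : DifferentiableAt ℝ W' y₀ := by
    have := (hW.mdifferentiableWithinAt (s :=
      Set.univ)).differentiableWithinAt_mpullbackWithin_vectorField
    rw [Set.preimage_univ, Set.univ_inter] at this
    exact this.differentiableAt (by rw [ModelWithCorners.range_eq_univ]; exact univ_mem)
  have hχs : ∀ᶠ y in 𝓝 y₀, ContMDiffAt 𝓘(ℝ, E) 𝓘(ℝ, E) ∞ χ.symm y := by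
    have := (contMDiffOn_extChartAt_symm (I := 𝓘(ℝ, E)) (n := ∞) g).smoothNear
      (extChartAt_target_mem_nhds g)
    exact this
  have htend : Tendsto χ.symm (𝓝 y₀) (𝓝 g) := by
    have := hχs.self_of_nhds.continuousAt.tendsto
    rwa [hχy₀] at this
  have hfc : ∀ᶠ k in 𝓝 g, f k ∈ (chartAt F (f g)).source :=
    hf.tendsto (chart_source_mem_nhds F (f g))
  have hd : ∀ y, ContMDiffAt 𝓘(ℝ, E) 𝓘(ℝ, E) ∞ χ.symm y →
      ContMDiffAt 𝓘(ℝ, E) 𝓘(ℝ, F) ∞ f (χ.symm y) → f (χ.symm y) ∈ (chartAt F (f g)).source →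
      ContDiffAt ℝ ∞ (fun y => c (f (χ.symm y))) y ∧ ∀ v : E,
        fderiv ℝ (fun y => c (f (χ.symm y))) y v =
          (mfderiv 𝓘(ℝ, F) 𝓘(ℝ, F) c (f (χ.symm y))
            (mfderiv 𝓘(ℝ, E) 𝓘(ℝ, F) f (χ.symm y)
              (mfderiv 𝓘(ℝ, E) 𝓘(ℝ, E) χ.symm y v : E) : F) : F) := by
    intro y h1 h2 h3
    have h4 : ContMDiffAt 𝓘(ℝ, F) 𝓘(ℝ, F) ∞ c (f (χ.symm y)) := contMDiffAt_extChartAt' h3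
    refine ⟨((h4.comp y (h2.comp y h1)).contDiffAt :), fun v => ?_⟩
    have h5 := (h2.mdifferentiableAt (by simp)).hasMFDerivAt.comp y
        (h1.mdifferentiableAt (by simp)).hasMFDerivAt
    have h6 : mfderiv 𝓘(ℝ, E) 𝓘(ℝ, F) (fun y => c (f (χ.symm y))) y = _ :=
      ((h4.mdifferentiableAt (by simp)).hasMFDerivAt.comp y h5).mfderiv
    rw [mfderiv_eq_fderiv] at h6
    exact congrArg (fun L : E →L[ℝ] F => L v) h6
  have hmem : ∀ᶠ y in 𝓝 y₀, y ∈ χ.target := extChartAt_target_mem_nhds g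
  have hinv : ∀ y ∈ χ.target, ∀ X : ∀ k : G, TangentSpace 𝓘(ℝ, E) k,
      (mfderiv 𝓘(ℝ, E) 𝓘(ℝ, E) χ.symm y
        (mpullbackWithin 𝓘(ℝ, E) 𝓘(ℝ, E) χ.symm X (Set.range 𝓘(ℝ, E)) y : E) : E) =
        X (χ.symm y) := by
    intro y hy X
    have h1 := isInvertible_mfderivWithin_extChartAt_symm (I := 𝓘(ℝ, E)) hy
    have h2 : mfderivWithin 𝓘(ℝ, E) 𝓘(ℝ, E) χ.symm (Set.range 𝓘(ℝ, E)) y =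
        mfderiv 𝓘(ℝ, E) 𝓘(ℝ, E) χ.symm y := by
      rw [ModelWithCorners.range_eq_univ, mfderivWithin_univ]
    rw [mpullbackWithin_apply, ← h2]
    exact h1.self_apply_inverse _
  have hzero : ∀ X : ∀ k : G, TangentSpace 𝓘(ℝ, E) k,
      (∀ᶠ k in 𝓝 g, (mfderiv 𝓘(ℝ, E) 𝓘(ℝ, F) f k (X k) : F) = 0) →
      (fun y => fderiv ℝ (fun y => c (f (χ.symm y))) y
        (mpullbackWithin 𝓘(ℝ, E) 𝓘(ℝ, E) χ.symm X (Set.range 𝓘(ℝ, E)) y)) =ᶠ[𝓝 y₀]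
        fun _ => (0 : F) := by
    intro X hX
    filter_upwards [hmem, hχs, htend.eventually hf, htend.eventually hfc, htend.eventually hX]
      with y h1 h2 h3 h4 h5
    refine ((hd y h2 h3 h4).2 _).trans ?_
    rw [hinv y h1 X, h5]
    exact map_zero _
  have hy := hd y₀ hχs.self_of_nhds (by rw [hχy₀]; exact hf.contMDiffAt)
    (by rw [hχy₀]; exact mem_chart_source F (f g))
  obtain ⟨L, hL⟩ : ∃ L : E, lieBracket ℝ V' W' y₀ = L := ⟨_, rfl⟩
  -- In coordinates, the differential of the map on the bracket is the difference of the derivatives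
  -- of its values on `V'` and on `W'`, and both values vanish identically near the point.
  have h1 := fderiv_apply_lieBracket hy.1 (by
    rw [minSmoothness_of_isRCLikeNormedField]
    exact (mod_cast le_top : ((2 : ℕ∞) : WithTop ℕ∞) ≤ ∞)) hW1 hV1
  rw [(hzero W hW₀).fderiv_eq, (hzero V hV₀).fderiv_eq, fderiv_fun_const, hL] at h1
  have h2 : (mfderiv 𝓘(ℝ, E) 𝓘(ℝ, E) χ.symm y₀ L : E) =
      mlieBracket 𝓘(ℝ, E) V W g := by
    have e1 : mlieBracket 𝓘(ℝ, E) V W g =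
        (mfderiv 𝓘(ℝ, E) 𝓘(ℝ, E) χ g).inverse L := by
      rw [← hL]
      rw [← mlieBracketWithin_univ, mlieBracketWithin_apply, Set.preimage_univ, Set.univ_inter]
      have h : lieBracketWithin ℝ V' W' (Set.range 𝓘(ℝ, E)) = lieBracket ℝ V' W' := by
        rw [ModelWithCorners.range_eq_univ, lieBracketWithin_univ]
      exact congrArg (fun B : E → E => (mfderiv 𝓘(ℝ, E) 𝓘(ℝ, E) χ g).inverse (B (χ g))) h
    have e2 := mfderivWithin_extChartAt_symm_comp_mfderiv_extChartAt' (I := 𝓘(ℝ, E))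
      (mem_extChartAt_source (I := 𝓘(ℝ, E)) g)
    rw [ModelWithCorners.range_eq_univ, mfderivWithin_univ] at e2
    have e3 := (isInvertible_mfderiv_extChartAt (I := 𝓘(ℝ, E))
      (mem_extChartAt_source (I := 𝓘(ℝ, E)) g)).self_apply_inverse L
    have e4 := congrArg (fun L : E →L[ℝ] E => L (mlieBracket 𝓘(ℝ, E) V W g)) e2
    refine Eq.trans ?_ e4
    refine congrArg (mfderiv 𝓘(ℝ, E) 𝓘(ℝ, E) χ.symm y₀ : E → E) ?_
    rw [e1]
    exact e3.symm
  have h3 := (hy.2 _).symm.trans h1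
  rw [h2] at h3
  have h4 : ∀ {k : G} (_ : k = g) (v : E), (mfderiv 𝓘(ℝ, F) 𝓘(ℝ, F) c (f k)
      (mfderiv 𝓘(ℝ, E) 𝓘(ℝ, F) f k v : F) : F) = 0 →
      (mfderiv 𝓘(ℝ, E) 𝓘(ℝ, F) f g v : F) = 0 := by
    rintro _ rfl v hv
    exact (isInvertible_mfderiv_extChartAt (I := 𝓘(ℝ, F))
      (mem_extChartAt_source (I := 𝓘(ℝ, F)) _)).injective (hv.trans (map_zero _).symm)
  exact h4 hχy₀ _ (h3.trans (sub_self (0 : F)))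

end VerticalPart

/-! ### Étale morphisms and the isomorphism of Lie algebroids. -/

section AlgebroidIsoPart
set_option linter.unusedSectionVars false
open Filter Bundle VectorField

theorem mfderiv_comp_apply_of_base_eq {E H N E' H' P E'' H'' R : Type*}
    [NormedAddCommGroup E] [NormedSpace ℝ E] [TopologicalSpace H]
    [NormedAddCommGroup E'] [NormedSpace ℝ E'] [TopologicalSpace H']
    [NormedAddCommGroup E''] [NormedSpace ℝ E''] [TopologicalSpace H'']
    [TopologicalSpace N] [ChartedSpace H N] [TopologicalSpace P] [ChartedSpace H' P]
    [TopologicalSpace R] [ChartedSpace H'' R]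
    {I : ModelWithCorners ℝ E H} {I' : ModelWithCorners ℝ E' H'} {I'' : ModelWithCorners ℝ E'' H''}
    {f : N → P} {r : R → N} {q : R} {x : N} (hf : MDifferentiableAt I I' f x)
    (hr : MDifferentiableAt I'' I r q) (hx : r q = x) (ζ : E'') :
    (mfderiv I'' I' (fun q' => f (r q')) q ζ : E') =
      (mfderiv I I' f x (mfderiv I'' I r q ζ : E) : E') := by
  subst hx
  exact congrArg (fun L : E'' →L[ℝ] E' => L ζ) (mfderiv_comp q hf hr)

namespace LocalLieGroupoid

variable {E F G M E' G' : Type*}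
  [NormedAddCommGroup E] [NormedSpace ℝ E] [NormedAddCommGroup F] [NormedSpace ℝ F]
  [NormedAddCommGroup E'] [NormedSpace ℝ E']
  [TopologicalSpace G] [ChartedSpace E G] [TopologicalSpace M] [ChartedSpace F M]
  [TopologicalSpace G'] [ChartedSpace E' G']
  [FiniteDimensional ℝ E] [FiniteDimensional ℝ F] [FiniteDimensional ℝ E']
  [IsManifold 𝓘(ℝ, E) ∞ G] [IsManifold 𝓘(ℝ, F) ∞ M] [IsManifold 𝓘(ℝ, E') ∞ G']

/-- An étale morphism of local Lie groupoids over the identity of `M`. -/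
structure IsEtaleHom (𝒢 : LocalLieGroupoid E F G M) (ℋ : LocalLieGroupoid E' F G' M)
    (φ : G → G') : Prop where
  isLocalDiffeomorph : IsLocalDiffeomorph 𝓘(ℝ, E) 𝓘(ℝ, E') ∞ φ
  src_map : ∀ g, ℋ.src (φ g) = 𝒢.src g
  tgt_map : ∀ g, ℋ.tgt (φ g) = 𝒢.tgt g
  map_unit : ∀ x, φ (𝒢.unit x) = ℋ.unit x
  mem_mulDom : ∀ g h, (g, h) ∈ 𝒢.mulDom → (φ g, φ h) ∈ ℋ.mulDom
  map_mul : ∀ g h, (g, h) ∈ 𝒢.mulDom → φ (𝒢.mul g h) = ℋ.mul (φ g) (φ h)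

namespace IsEtaleHom

variable {𝒢 : LocalLieGroupoid E F G M} {ℋ : LocalLieGroupoid E' F G' M} {φ : G → G'}

theorem mdifferentiableAt (h : 𝒢.IsEtaleHom ℋ φ) (g : G) :
    MDifferentiableAt 𝓘(ℝ, E) 𝓘(ℝ, E') φ g :=
  h.isLocalDiffeomorph.contMDiff.mdifferentiable (by simp) g

theorem isInvertible_mfderiv (h : 𝒢.IsEtaleHom ℋ φ) (g : G) :
    (mfderiv 𝓘(ℝ, E) 𝓘(ℝ, E') φ g).IsInvertible :=
  ⟨h.isLocalDiffeomorph.mfderivToContinuousLinearEquiv (by simp) g,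
    h.isLocalDiffeomorph.mfderivToContinuousLinearEquiv_coe (by simp) g⟩

theorem mfderiv_comp_mfderiv (h : 𝒢.IsEtaleHom ℋ φ) {f : G → M} {f' : G' → M}
    (hf' : ContMDiff 𝓘(ℝ, E') 𝓘(ℝ, F) ∞ f') (hff : ∀ g, f' (φ g) = f g) {g : G} {g' : G'}
    (hg : φ g = g') (v : E) :
    (mfderiv 𝓘(ℝ, E') 𝓘(ℝ, F) f' g' (mfderiv 𝓘(ℝ, E) 𝓘(ℝ, E') φ g v : E') : F) =
      mfderiv 𝓘(ℝ, E) 𝓘(ℝ, F) f g v := by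
  obtain rfl : (fun g => f' (φ g)) = f := funext hff
  exact (mfderiv_comp_apply_of_base_eq (hf'.mdifferentiable (by simp) _) (h.mdifferentiableAt g)
    hg v).symm

/-- The differential of an étale morphism at a unit. -/
noncomputable def unitEquiv (h : 𝒢.IsEtaleHom ℋ φ) (x : M) : E ≃ₗ[ℝ] E' :=
  (h.isLocalDiffeomorph.mfderivToContinuousLinearEquiv (by simp) (𝒢.unit x)).toLinearEquiv

/-- The map induced on the fibres of the Lie algebroids. -/
noncomputable def algEquiv (h : 𝒢.IsEtaleHom ℋ φ) (x : M) : 𝒢.algFiber x ≃ₗ[ℝ] ℋ.algFiber x :=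
  LinearEquiv.ofSubmodules (h.unitEquiv x) (𝒢.algFiber x) (ℋ.algFiber x) (by
    ext w
    refine (Submodule.mem_map_equiv (e := h.unitEquiv x) (p := 𝒢.algFiber x)).trans ?_
    set e := h.unitEquiv x with he
    have h1 := h.mfderiv_comp_mfderiv ℋ.src_smooth h.src_map (h.map_unit x) (e.symm w)
    have h2 : (mfderiv 𝓘(ℝ, E) 𝓘(ℝ, E') φ (𝒢.unit x) (e.symm w) : E') = w :=
      e.apply_symm_apply w
    rw [h2] at h1
    change (mfderiv 𝓘(ℝ, E) 𝓘(ℝ, F) 𝒢.src (𝒢.unit x) (e.symm w) : F) = 0 ↔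
      (mfderiv 𝓘(ℝ, E') 𝓘(ℝ, F) ℋ.src (ℋ.unit x) w : F) = 0
    exact ⟨fun h => h1.trans h, fun h => h1.symm.trans h⟩)

/-- Right-invariant vector fields are related. -/
theorem rightInvariant_map (h : 𝒢.IsEtaleHom ℋ φ) (α : ∀ x, 𝒢.algFiber x) (g : G) :
    (ℋ.rightInvariant (fun y => h.algEquiv y (α y)) (φ g) : E') =
      mfderiv 𝓘(ℝ, E) 𝓘(ℝ, E') φ g (𝒢.rightInvariant α g) := by
  obtain ⟨r, r1, r2, r3, r4⟩ := 𝒢.exists_fiber_plot g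
  set y := 𝒢.tgt g with hy
  set q := 𝒢.unit y with hq
  have e1 := 𝒢.dRight_eq_mfderiv r1.mdifferentiableAt r2 r3 (α y).1
  rw [r4 _ (α y).2] at e1
  have hd : MDifferentiableAt 𝓘(ℝ, E) 𝓘(ℝ, E') (fun k => φ (r k)) q :=
    (h.mdifferentiableAt (r q)).comp q r1.mdifferentiableAt
  have e2 := ℋ.dRight_eq_mfderiv (g := φ g) (r := fun k => φ (r k)) (q := q) hd
    (by rw [r2, h.tgt_map, h.map_unit]) (r3.mono fun k hk => h.mem_mulDom _ _ hk) (α y).1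
  have e3 : (mfderiv 𝓘(ℝ, E) 𝓘(ℝ, E') (fun k => φ (r k)) q (α y).1 : E') =
      (h.algEquiv y (α y)).1 := by
    refine (mfderiv_comp_apply_of_base_eq (h.mdifferentiableAt q) r1.mdifferentiableAt r2
      (α y).1).trans ?_
    exact congrArg (fun w : E => (mfderiv 𝓘(ℝ, E) 𝓘(ℝ, E') φ q w : E')) (r4 _ (α y).2)
  rw [e3] at e2
  have hm : MDifferentiableAt 𝓘(ℝ, E) 𝓘(ℝ, E) (fun k => 𝒢.mul (r k) g) q :=
    (𝒢.smoothNear_mul r1 (smoothNear_const (I := 𝓘(ℝ, E)) g _)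
      r3.self_of_nhds (r3.mono fun k hk => 𝒢.composable hk)).mdifferentiableAt
  have hmq : 𝒢.mul (r q) g = g := by rw [r2]; exact 𝒢.unit_mul g
  -- Differentiating `φ (k g) = φ k · φ g` along the source fibre at the unit gives the relation
  -- between the two fields.
  have e4 : (fun k => ℋ.mul (φ (r k)) (φ g)) =ᶠ[𝓝 q] fun k => φ (𝒢.mul (r k) g) :=
    r3.mono fun k hk => (h.map_mul _ _ hk).symm
  have e5 : (mfderiv 𝓘(ℝ, E) 𝓘(ℝ, E') (fun k => ℋ.mul (φ (r k)) (φ g)) q (α y).1 : E') =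
      mfderiv 𝓘(ℝ, E) 𝓘(ℝ, E') φ g (𝒢.rightInvariant α g) := by
    have h1 : (mfderiv 𝓘(ℝ, E) 𝓘(ℝ, E') (fun k => ℋ.mul (φ (r k)) (φ g)) q (α y).1 : E') =
        mfderiv 𝓘(ℝ, E) 𝓘(ℝ, E') (fun k => φ (𝒢.mul (r k) g)) q (α y).1 :=
      congrArg (fun L : E →L[ℝ] E' => L (α y).1) e4.mfderiv_eq
    refine h1.trans ((mfderiv_comp_apply_of_base_eq (h.mdifferentiableAt g) hm hmq
      (α y).1).trans ?_)
    exact congrArg (fun w : E => (mfderiv 𝓘(ℝ, E) 𝓘(ℝ, E') φ g w : E')) e1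
  refine Eq.trans ?_ (e2.symm.trans e5)
  exact congrArg (fun z => (ℋ.dRight (φ g) (ℋ.unit (ℋ.tgt (φ g)))
    ((h.algEquiv z (α z)).1 : E') : E')) (h.tgt_map g)

/-- Since the differential of `φ` is invertible, related fields are pullbacks, and naturality of the
Lie bracket under pullback becomes available. -/
theorem mpullback_rightInvariant (h : 𝒢.IsEtaleHom ℋ φ) (α : ∀ x, 𝒢.algFiber x) :
    mpullback 𝓘(ℝ, E) 𝓘(ℝ, E') φ (ℋ.rightInvariant fun y => h.algEquiv y (α y)) =
      𝒢.rightInvariant α := by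
  funext g
  rw [mpullback_apply]
  refine (congrArg (mfderiv 𝓘(ℝ, E) 𝓘(ℝ, E') φ g).inverse (h.rightInvariant_map α g)).trans ?_
  exact (h.isInvertible_mfderiv g).inverse_apply_self _

/-- The differential of `φ` carries smooth sections forwards; that of a smooth local inverse at the
unit carries them back. -/
theorem isSmoothSectionOn_iff (h : 𝒢.IsEtaleHom ℋ φ) {O : Set M} (hO : IsOpen O)
    (α : ∀ x, 𝒢.algFiber x) :
    𝒢.IsSmoothSectionOn O α ↔ ℋ.IsSmoothSectionOn O fun x => h.algEquiv x (α x) := by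
  have key : ∀ x, (⟨ℋ.unit x, (h.algEquiv x (α x)).1⟩ : TangentBundle 𝓘(ℝ, E') G') =
      ⟨φ (𝒢.unit x), mfderiv 𝓘(ℝ, E) 𝓘(ℝ, E') φ (𝒢.unit x) (α x).1⟩ := by
    intro x
    have : ∀ {k : G'} (_ : φ (𝒢.unit x) = k) (v : E'),
      (⟨k, v⟩ : TangentBundle 𝓘(ℝ, E') G') = ⟨φ (𝒢.unit x), v⟩ := by rintro _ rfl _; rfl
    exact this (h.map_unit x) _
  unfold IsSmoothSectionOn
  simp only [key]
  constructor
  · intro hα x hx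
    exact SmoothNear.contMDiffWithinAt_mfderiv (h.isLocalDiffeomorph.contMDiff.smoothNear _)
      (hα x hx)
  · intro hα x₀ hx₀
    have hl := h.isLocalDiffeomorph (𝒢.unit x₀)
    have h1 := SmoothNear.contMDiffWithinAt_mfderiv (f := hl.localInverse)
      (u := fun x => φ (𝒢.unit x))
      (v := fun x => mfderiv 𝓘(ℝ, E) 𝓘(ℝ, E') φ (𝒢.unit x) (α x).1)
      (hl.localInverse_contMDiffOn.smoothNear
        (hl.localInverse_open_source.mem_nhds hl.localInverse_mem_source)) (hα x₀ hx₀)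
    refine (h1.contMDiffAt (hO.mem_nhds hx₀)).contMDiffWithinAt.congr_of_eventuallyEq_of_mem ?_ hx₀
    refine mem_nhdsWithin_of_mem_nhds ?_
    filter_upwards [(𝒢.unit_smooth.continuous.tendsto x₀).eventually
      hl.localInverse_eventuallyEq_left.eventually_nhds,
      ((𝒢.unit_smooth.continuous.tendsto x₀).eventually
        (h.isLocalDiffeomorph.contMDiff.continuous.tendsto _ |>.eventually
          (hl.localInverse_open_source.mem_nhds hl.localInverse_mem_source)))] with x hx hx'
    have h2 : MDifferentiableAt 𝓘(ℝ, E') 𝓘(ℝ, E) hl.localInverse (φ (𝒢.unit x)) :=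
      (hl.localInverse_contMDiffOn.contMDiffAt
        (hl.localInverse_open_source.mem_nhds hx')).mdifferentiableAt (by simp)
    have h3 : HasMFDerivAt 𝓘(ℝ, E) 𝓘(ℝ, E) (hl.localInverse ∘ φ) (𝒢.unit x)
        (ContinuousLinearMap.id ℝ E) := (hasMFDerivAt_id _).congr_of_eventuallyEq hx
    have h4 := hasMFDerivAt_unique
      (h2.hasMFDerivAt.comp (𝒢.unit x) (h.mdifferentiableAt _).hasMFDerivAt) h3
    have h5 := congrArg (fun L : E →L[ℝ] E => L (α x).1) h4
    have : ∀ {k : G} (_ : k = 𝒢.unit x) {v w : E} (_ : v = w),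
      (⟨𝒢.unit x, w⟩ : TangentBundle 𝓘(ℝ, E) G) = ⟨k, v⟩ := by rintro _ rfl _ _ rfl; rfl
    exact this hx.self_of_nhds h5

/-- Étale morphisms induce isomorphisms of Lie algebroids. -/
noncomputable def lieAlgebroidIso (h : 𝒢.IsEtaleHom ℋ φ) : LieAlgebroidIso 𝒢 ℋ where
  toEquiv := h.algEquiv
  smooth_iff _ hO α := h.isSmoothSectionOn_iff hO α
  anchor_comp x a := h.mfderiv_comp_mfderiv ℋ.tgt_smooth h.tgt_map (h.map_unit x) a.1
  map_bracket α β hα hβ x := by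
    have := FiniteDimensional.complete ℝ E
    have : IsManifold 𝓘(ℝ, E) (minSmoothness ℝ 2) G := IsManifold.of_le (n := ∞) (by
      rw [minSmoothness_of_isRCLikeNormedField]
      exact (mod_cast le_top : ((2 : ℕ∞) : WithTop ℕ∞) ≤ ∞))
    have : IsManifold 𝓘(ℝ, E') (minSmoothness ℝ 2) G' := IsManifold.of_le (n := ∞) (by
      rw [minSmoothness_of_isRCLikeNormedField]
      exact (mod_cast le_top : ((2 : ℕ∞) : WithTop ℕ∞) ≤ ∞))
    have hv : ∀ α : (∀ x, 𝒢.algFiber x), ∀ g : G,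
      (mfderiv 𝓘(ℝ, E) 𝓘(ℝ, F) 𝒢.src g (𝒢.rightInvariant α g) : F) = 0 :=
      𝒢.mfderiv_src_rightInvariant
    -- Both right-invariant fields are tangent to the source fibres, hence so is their bracket, and
    -- its value at a unit lies in the algebroid.
    refine ⟨⟨𝒢.algBracket α β x, ?_⟩, rfl, ?_⟩
    · exact (𝒢.src_smooth.smoothNear _).mfderiv_mlieBracket_eq_zero
        ((𝒢.contMDiffAt_rightInvariant α hα _).mdifferentiableAt (by simp))
        ((𝒢.contMDiffAt_rightInvariant β hβ _).mdifferentiableAt (by simp))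
        (Eventually.of_forall (hv α)) (Eventually.of_forall (hv β))
    · have hα' := (h.isSmoothSectionOn_iff isOpen_univ α).1 hα
      have hβ' := (h.isSmoothSectionOn_iff isOpen_univ β).1 hβ
      have h1 := mpullback_mlieBracket (I := 𝓘(ℝ, E)) (n := ∞) (x₀ := 𝒢.unit x)
        ((ℋ.contMDiffAt_rightInvariant _ hα' (φ (𝒢.unit x))).mdifferentiableAt (by simp))
        ((ℋ.contMDiffAt_rightInvariant _ hβ' (φ (𝒢.unit x))).mdifferentiableAt (by simp))
        (h.isLocalDiffeomorph.contMDiff _) (by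
          rw [minSmoothness_of_isRCLikeNormedField]
          exact (mod_cast le_top : ((2 : ℕ∞) : WithTop ℕ∞) ≤ ∞))
      rw [h.mpullback_rightInvariant, h.mpullback_rightInvariant, mpullback_apply] at h1
      have h2 := (h.isInvertible_mfderiv (𝒢.unit x)).self_apply_inverse
        (mlieBracket 𝓘(ℝ, E') (ℋ.rightInvariant fun y => h.algEquiv y (α y))
          (ℋ.rightInvariant fun y => h.algEquiv y (β y)) (φ (𝒢.unit x)))
      have h3 : (mfderiv 𝓘(ℝ, E) 𝓘(ℝ, E') φ (𝒢.unit x) (𝒢.algBracket α β x) : E') =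
          mlieBracket 𝓘(ℝ, E') (ℋ.rightInvariant fun y => h.algEquiv y (α y))
            (ℋ.rightInvariant fun y => h.algEquiv y (β y)) (φ (𝒢.unit x)) :=
        (congrArg (fun v : E => (mfderiv 𝓘(ℝ, E) 𝓘(ℝ, E') φ (𝒢.unit x) v : E')) h1.symm).trans h2
      refine h3.trans ?_
      exact congrArg (fun k => (mlieBracket 𝓘(ℝ, E')
        (ℋ.rightInvariant fun y => h.algEquiv y (α y))
        (ℋ.rightInvariant fun y => h.algEquiv y (β y)) k : E')) (h.map_unit x)

end IsEtaleHom

/-- The completion map is étale. -/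
theorem SmoothQuotient.isEtaleHom_completion {𝒢 : LocalLieGroupoid E F G M} [T2Space M]
    (S : 𝒢.SmoothQuotient) (hA : 𝒢.IsThreeAssociative) (hI : 𝒢.IsInversional)
    (hC : 𝒢.HasProductsConnectedToAxes) :
    𝒢.IsEtaleHom (S.groupoid hA hI) S.completion where
  isLocalDiffeomorph := S.isLocalDiffeomorph_completion hA hI hC
  src_map _ := rfl
  tgt_map _ := rfl
  map_unit _ := rfl
  mem_mulDom _ _ h := 𝒢.composable h
  map_mul g k h := by
    have h1 := AC.rep_mul (hA := hA) (a := 𝒢.completion g) (b := 𝒢.completion k) (𝒢.composable h)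
      (rep_completion g) (rep_completion k)
    exact (rep_completion (𝒢.mul g k)).eq
      ((rep_iff_of_red (TopLocalGroupoid.Red.mk (T := 𝒢.toTop hA) [] [] h) _).1 h1)

end LocalLieGroupoid

end AlgebroidIsoPart

theorem mainTheorem3 {E F G M : Type*}
    [NormedAddCommGroup E] [NormedSpace ℝ E] [FiniteDimensional ℝ E]
    [NormedAddCommGroup F] [NormedSpace ℝ F] [FiniteDimensional ℝ F]
    [TopologicalSpace G] [ChartedSpace E G] [IsManifold 𝓘(ℝ, E) ∞ G]
    [TopologicalSpace M] [ChartedSpace F M] [IsManifold 𝓘(ℝ, F) ∞ M]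
    [T2Space M] [SecondCountableTopology M]
    (𝒢 : LocalLieGroupoid E F G M)
    (h_assoc : 𝒢.IsThreeAssociative)
    (h_biregular : 𝒢.IsBiregular)
    (h_axes : 𝒢.HasProductsConnectedToAxes)
    (h_inversional : 𝒢.IsInversional) :
    (𝒢.ACIsSmooth ↔ 𝒢.HasUniformlyDiscreteAssociators) ∧
      ∀ S : 𝒢.SmoothQuotient,
        IsLocalDiffeomorph 𝓘(ℝ, E) 𝓘(ℝ, S.Model) ∞ S.completion ∧
          ∃ ℋ : LocalLieGroupoid S.Model F S.Space M,
            S.IsCompletionGroupoid ℋ ∧ Nonempty (LocalLieGroupoid.LieAlgebroidIso 𝒢 ℋ) := by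
  refine ⟨⟨fun ⟨S⟩ => S.hasUniformlyDiscreteAssociators h_assoc h_inversional h_axes, fun h =>
    ⟨LocalLieGroupoid.smoothQuotient h h_inversional h_axes h_assoc⟩⟩, fun S => ?_⟩
  have h := S.isEtaleHom_completion h_assoc h_inversional h_axes
  exact ⟨h.isLocalDiffeomorph, S.groupoid h_assoc h_inversional,
    S.isCompletionGroupoid h_assoc h_inversional, ⟨h.lieAlgebroidIso⟩⟩
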